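/- Let $N\ge 1$, $m\ge 0$, $T>0$, let $F:\mathbb{R}^N\times\mathbb{R}^m\to\mathbb{R}$, $f:\mathbb{R}^N\times\mathbb{R}^m\to\mathbb{R}^N$ and $g:\mathbb{R}^N\to\mathbb{R}$ be of class $C^1$, and let $K\subset\mathbb{R}^m$ be compact and convex. A *feasible (feedback) map* is an element of $L^\infty(0,T;W^{1,\infty}(\mathbb{R}^N,K))$, represented by a map $u(t,x)$ that for every $t\in[0,T]$ is $K$-valued and Lipschitz in $x$, with a Lipschitz constant independent of $t$, and that is measurable in $t$ for every $x$. A *state* of $u$ from $(t,y)\in[0,T]\times\mathbb{R}^N$ is a solution on $[t,T]$ of $x'(s)=f(x(s),u(s,x(s)))$, $x(t)=y$ (in integrated form), and its cost is $\int_t^T F(x(s),u(s,x(s)))\,ds+g(x(T))$. A feasible $u$ is *optimal* if for all $(t,y)\in[0,T]\times\mathbb{R}^N$ it has a state from $(t,y)$ whose cost is at most the cost of every state from $(t,y)$ of every feasible map. Let $u$ be a feasible map, and let $p\in L^\infty_{loc}([0,T]\times\mathbb{R}^N;\mathbb{R}^N)$ be its costate, i.e. a distributional solution of the linear transport system $$p_t+\nabla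 p\,f(x,u(t,x))+p\,\nabla[f(x,u(t,x))]=\nabla[F(x,u(t,x))]\ \text{ in }[0,T]\times\mathbb{R}^N,\qquad p(T,x)=-\nabla g(x)$$ (the terminal condition being part of the weak formulation; $\nabla$ is the gradient in $x$). Put $$\nabla I(u)(t,x)=F_u(x,u(t,x))-p(t,x)\,f_u(x,u(t,x)).$$ For $t\in[0,T]$ the *obstacle problem at time $t$* is to minimize $$\int_{\mathbb{R}^N}\Big(\tfrac12|\nabla V(x)-\nabla u(t,x)|^2+\nabla I(u)(t,x)\,(V(x)-u(t,x))\Big)\,dx$$ over all $V:\mathbb{R}^N\to\mathbb{R}^m$ that have a weak gradient and satisfy $V\in K$ a.e., $V-u(t,\cdot)\in H^1(\mathbb{R}^N;\mathbb{R}^m)$ and $\nabla I(u)(t,\cdot)(V-u(t,\cdot))\in L^1(\mathbb{R}^N)$. 1. Let $U$ be a feasible map. Then $u+\varepsilon(U-u)$ is feasible for every $\varepsilon\in[0,1]$, and, for every $t\in[0,T]$ for which $U(t,\cdot)$ solves the obstacle problem at time $t$, $$\int_{\mathbb{R}^N}\nabla I(u)(t,x)\,(U(t,x)-u(t,x))\,dx\le-\int_{\mathbb{R}^N}|\nabla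 U(t,x)-\nabla u(t,x)|^2\,dx\le 0 .$$ In particular, if $U(t,\cdot)$ solves the obstacle problem for every $t\in[0,T]$, then $U$ is a feasible direction of descent at $u$, on average in space, for every $t\in[0,T]$. 2. If $u$ is optimal, then for almost every $t\in[0,T]$ the unique solution of the obstacle problem at time $t$ is $u(t,\cdot)$ itself: a map $V$ solves it if and only if $V=u(t,\cdot)$ a.e. -/

import Mathlib

open MeasureTheory Set
open scoped ContDiff

namespace FeedbackControl

noncomputable section

/-- `ℝⁿ` with the Euclidean norm. -/
abbrev Vec (n : ℕ) : Type := EuclideanSpace ℝ (Fin n)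

/-- Gradients (Jacobian matrices) of maps `ℝᴺ → ℝᵐ`, stored as the family of the `N` partial
derivatives. The norm is the Euclidean (Frobenius) norm of the `m × N` matrix. -/
abbrev Grad (N m : ℕ) : Type := PiLp 2 (fun _ : Fin N => Vec m)

/-! ### Weak gradients -/

/-- `D` is a weak gradient of `w : ℝᴺ → ℝᵐ`: both are locally integrable and
`∫ ∂ᵢφ w dx = - ∫ φ Dᵢ dx` for every `φ ∈ C_c^∞(ℝᴺ)` and every `i`. -/
structure HasWeakGradient {N m : ℕ} (w : Vec N → Vec m) (D : Vec N → Grad N m) : Prop where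
  locallyIntegrable : LocallyIntegrable w
  grad_locallyIntegrable : LocallyIntegrable D
  integral_eq : ∀ φ : Vec N → ℝ, ContDiff ℝ ∞ φ → HasCompactSupport φ → ∀ i : Fin N,
    ∫ x, (fderiv ℝ φ x (EuclideanSpace.single i 1)) • w x = - ∫ x, φ x • D x i

open Classical in
/-- The weak gradient `∇w` (unique up to null sets when it exists; `0` if there is none). -/
def weakGradient {N m : ℕ} (w : Vec N → Vec m) : Vec N → Grad N m :=
  if h : ∃ D, HasWeakGradient w D then h.choose else 0

/-! ### Feedback maps, states, cost and optimality -/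

/-- `u` is a feasible feedback map, `u ∈ L^∞(0, T; W^{1,∞}(ℝᴺ, K))`. Elements of this space are
represented by maps that, for each `t ∈ [0, T]`, are `K`-valued and Lipschitz in `x`, with a
Lipschitz constant that does not depend on `t` (for the bounded sets `K` considered here this is
a bound in `W^{1,∞}`), and are measurable in `t`. -/
structure IsFeasible {N m : ℕ} (T : ℝ) (K : Set (Vec m)) (u : ℝ → Vec N → Vec m) : Prop where
  mem : ∀ t ∈ Icc 0 T, ∀ x, u t x ∈ K
  lipschitz : ∃ L : NNReal, ∀ t ∈ Icc 0 T, LipschitzWith L (u t)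
  aemeasurable : ∀ x, AEMeasurable (fun t => u t x) (volume.restrict (Icc 0 T))

/-- `x` is a state on `[t, T]` for the feedback map `u`:
`x'(s) = f(x(s), u(s, x(s)))` in `(t, T)`, `x(t) = y`, in integrated (Carathéodory) form. -/
def IsState {N m : ℕ} (T : ℝ) (f : Vec N → Vec m → Vec N) (u : ℝ → Vec N → Vec m)
    (t : ℝ) (y : Vec N) (x : ℝ → Vec N) : Prop :=
  ContinuousOn x (Icc t T) ∧
    ∀ s ∈ Icc t T, x s = y + ∫ r in t..s, f (x r) (u r (x r))

/-- The cost `∫_t^T F(x(s), u(s, x(s))) ds + g(x(T))`. -/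
def cost {N m : ℕ} (T : ℝ) (F : Vec N → Vec m → ℝ) (g : Vec N → ℝ) (u : ℝ → Vec N → Vec m)
    (t : ℝ) (x : ℝ → Vec N) : ℝ :=
  (∫ s in t..T, F (x s) (u s (x s))) + g (x T)

/-- `u` is an optimal feedback map: it is feasible and, simultaneously for all initial data
`(t, y) ∈ [0, T] × ℝᴺ`, it has a state issuing from `(t, y)` whose cost is not larger than the cost
of any state issuing from `(t, y)` of any feasible feedback map. -/
def IsOptimal {N m : ℕ} (T : ℝ) (K : Set (Vec m)) (F : Vec N → Vec m → ℝ)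
    (f : Vec N → Vec m → Vec N) (g : Vec N → ℝ) (u : ℝ → Vec N → Vec m) : Prop :=
  IsFeasible T K u ∧
    ∀ t ∈ Icc 0 T, ∀ y : Vec N, ∃ x : ℝ → Vec N, IsState T f u t y x ∧
      ∀ (V : ℝ → Vec N → Vec m) (z : ℝ → Vec N), IsFeasible T K V → IsState T f V t y z →
        cost T F g u t x ≤ cost T F g V t z

/-! ### The costate -/

/-- The divergence of a vector field on `ℝᴺ`. -/
def divergence {N : ℕ} (v : Vec N → Vec N) (x : Vec N) : ℝ :=
  ∑ i, fderiv ℝ v x (EuclideanSpace.single i 1) i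

/-- `p` is a (locally bounded, distributional) solution of the linear transport system
`p_t + ∇p v + p ∇v = ∇[F(x, u(t, x))]` in `[0, T] × ℝᴺ`, where `v(t, x) = f(x, u(t, x))`, under the
terminal condition `p(T, x) = -∇g(x)`.

The `e`-component of the system is tested with `φ ∈ C_c^∞((0, ∞) × ℝᴺ)` on `[0, T] × ℝᴺ`; the
derivatives of `p` are moved to `φ v`, and the terminal values enter through the boundary term at
`t = T`. The maps `v(t, ·)` and `F(·, u(t, ·))` are locally Lipschitz, and their gradients are their
almost everywhere derivatives. -/
structure IsCostate {N m : ℕ} (T : ℝ) (F : Vec N → Vec m → ℝ) (f : Vec N → Vec m → Vec N)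
    (g : Vec N → ℝ) (u : ℝ → Vec N → Vec m) (p : ℝ → Vec N → Vec N) : Prop where
  aestronglyMeasurable : AEStronglyMeasurable (fun q : ℝ × Vec N => p q.1 q.2)
    ((volume.restrict (Icc 0 T)).prod volume)
  locallyBounded : ∀ R : ℝ, ∃ C : ℝ,
    ∀ᵐ q : ℝ × Vec N ∂((volume.restrict (Icc 0 T)).prod volume), ‖q.2‖ ≤ R → ‖p q.1 q.2‖ ≤ C
  weak_eq : ∀ φ : ℝ → Vec N → ℝ,
    ContDiff ℝ ∞ (fun q : ℝ × Vec N => φ q.1 q.2) →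
    HasCompactSupport (fun q : ℝ × Vec N => φ q.1 q.2) →
    tsupport (fun q : ℝ × Vec N => φ q.1 q.2) ⊆ {q | 0 < q.1} →
    ∀ e : Vec N,
      (∫ t in (0 : ℝ)..T, ∫ x,
        (- inner ℝ (p t x) e *
            (deriv (fun s => φ s x) t
              + fderiv ℝ (φ t) x (f x (u t x))
              + φ t x * divergence (fun y => f y (u t y)) x)
          + φ t x * inner ℝ (p t x) (fderiv ℝ (fun y => f y (u t y)) x e)))
        - ∫ x, φ T x * fderiv ℝ g x e
      = ∫ t in (0 : ℝ)..T, ∫ x, φ t x * fderiv ℝ (fun y => F y (u t y)) x e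

/-- `∇I(u)(t, x) = F_u(x, u(t, x)) - p(t, x) f_u(x, u(t, x))`, as a linear form on `ℝᵐ`. -/
def gradI {N m : ℕ} (F : Vec N → Vec m → ℝ) (f : Vec N → Vec m → Vec N)
    (u : ℝ → Vec N → Vec m) (p : ℝ → Vec N → Vec N) (t : ℝ) (x : Vec N) : Vec m →L[ℝ] ℝ :=
  fderiv ℝ (F x) (u t x) - (innerSL ℝ (p t x)).comp (fderiv ℝ (f x) (u t x))

/-! ### The obstacle problem at a fixed time -/

/-- The competitors of the obstacle problem with reference map `w` and linear term `G`: the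
`K`-valued maps `V` with `V - w ∈ H¹(ℝᴺ; ℝᵐ)` for which the linear term is integrable. -/
structure IsAdmissible {N m : ℕ} (K : Set (Vec m)) (w : Vec N → Vec m)
    (G : Vec N → Vec m →L[ℝ] ℝ) (V : Vec N → Vec m) : Prop where
  mem : ∀ᵐ x, V x ∈ K
  hasWeakGradient : ∃ D, HasWeakGradient V D
  sub_memLp : MemLp (fun x => V x - w x) 2
  gradient_sub_memLp : MemLp (fun x => weakGradient V x - weakGradient w x) 2
  integrable : Integrable (fun x => G x (V x - w x))

/-- The functional `∫ (½ |∇V - ∇w|² + G (V - w)) dx`. -/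
def obstacleEnergy {N m : ℕ} (w : Vec N → Vec m) (G : Vec N → Vec m →L[ℝ] ℝ)
    (V : Vec N → Vec m) : ℝ :=
  ∫ x, ((1 / 2 : ℝ) * ‖weakGradient V x - weakGradient w x‖ ^ 2 + G x (V x - w x))

/-- `V` solves the obstacle problem: it minimizes the functional among all competitors. -/
def IsObstacleSolution {N m : ℕ} (K : Set (Vec m)) (w : Vec N → Vec m)
    (G : Vec N → Vec m →L[ℝ] ℝ) (V : Vec N → Vec m) : Prop :=
  IsAdmissible K w G V ∧
    ∀ W, IsAdmissible K w G W → obstacleEnergy w G V ≤ obstacleEnergy w G W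

end

end FeedbackControl

/-!
The two parts of the theorem rest on the convexity of the obstacle problem and on the identification
of the costate of an optimal feedback map.

*Descent.* If `U(t)` minimizes the obstacle functional, then it does so along the segment from `u(t)`
to `U(t)`, all of whose points are competitors. The functional is `θ ↦ θ² A / 2 + θ B` on this
segment, with `A = ∫ |∇U - ∇u|²` and `B = ∫ ∇I(u)(U - u)`, and minimality at `θ = 1` says that
`B ≤ -A` (`IsObstacleSolution.integral_le`).

*Uniqueness at an optimal map.* The second part reduces to the pointwise maximum principle
`∇I(u)(t, x)(k - u(t, x)) ≥ 0` for all `k ∈ K` and almost all `(t, x)`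
(`IsOptimal.ae_gradI_nonneg`). Given this, the obstacle functional is nonnegative, it vanishes at
`u(t)`, and it vanishes at `V` only if `∇V = ∇u(t)` almost everywhere. Then `V - u(t)` is square
integrable with zero gradient, hence zero, as the dimension is positive (`isObstacleSolution_iff`).

For the maximum principle let `w(t, x)` be the value function. It is the cost of the optimal states
of `u`, and by Gronwall's inequality it is locally Lipschitz, so that it is differentiable almost
everywhere by Rademacher's theorem. At almost every `(t, x)` one has
`w_t + ∇w f(x, u) + F(x, u) = 0` along the feedback (`fderiv_extValue_apply_field`). Since `u` beats
the maps that use a constant control `k ∈ K` for a short time and `u` afterwards, one also has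
`w_t + ∇w f(x, k) + F(x, k) ≥ 0` (`fderiv_extValue_apply_const_control`). Hence
`k ↦ ∇w f(x, k) + F(x, k)` is minimal over `K` at `u(t, x)`, and its derivative `F_u + ∇w f_u` is
nonnegative in the directions `k - u(t, x)`. No viscosity solutions are needed.

It remains to see that `p = -∇w`. Differentiating the first equation weakly in space shows that
`q = p + ∇w` solves the transport system without source and with zero terminal value
(`IsCostate.isTransported_add_spaceGrad`; the weak commutation of derivatives is
`integral_transport_eq`). Uniqueness for this system is `IsTransported.ae_eq_zero`: the field
`f(x, u)` is Lipschitz in space, and a mollification of `q` solves the system up to a commutator that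
is bounded by `|q|` and the mean oscillation of `q`, as its kernel has integral zero
(`abs_commutator_le`). An energy estimate for the mollified field follows, with weights supported in
tubes around trajectories that increase along the flow. In the limit, Gronwall's inequality shows
that `q` vanishes in the tubes. The field may grow fast at infinity, but it has trajectories up to
the time `T` from all initial data, because an optimal map has states. Hence countably many tubes
cover almost all of `[0, T] × ℝᴺ`.
-/


namespace FeedbackControl

open Filter Topology Metric

set_option linter.unusedSectionVars false

/-! ### Locally Lipschitz functions -/

section LocallyLipschitz

variable {E F : Type*} [NormedAddCommGroup E] [NormedSpace ℝ E] [FiniteDimensional ℝ E]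
  [NormedAddCommGroup F] [NormedSpace ℝ F]

theorem _root_.LocallyLipschitz.exists_lipschitzOnWith_closedBall {f : E → F}
    (hf : LocallyLipschitz f) (R : ℝ) :
    ∃ C, LipschitzOnWith C f (closedBall 0 R) :=
  have : ProperSpace E := FiniteDimensional.proper ℝ E
  (hf.locallyLipschitzOn).exists_lipschitzOnWith_of_compact (isCompact_closedBall 0 R)

theorem _root_.LocallyLipschitz.exists_lipschitzWith {f : E → F}
    (hf : LocallyLipschitz f) (hc : HasCompactSupport f) : ∃ C, LipschitzWith C f := by
  have : ProperSpace E := FiniteDimensional.proper ℝ E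
  obtain ⟨R, hR⟩ := hc.isCompact.isBounded.subset_closedBall 0
  obtain ⟨C, hC⟩ := hf.exists_lipschitzOnWith_closedBall (R + 1)
  obtain ⟨M, hM⟩ := hc.exists_bound_of_continuous hf.continuous
  have hM0 : 0 ≤ M := (norm_nonneg _).trans (hM 0)
  have hzero : ∀ x, R < ‖x‖ → f x = 0 := fun x hx => by
    by_contra h
    have := hR (subset_tsupport f h)
    rw [mem_closedBall_zero_iff] at this
    linarith
  -- a point of the support and a point outside the larger ball are at distance at least one
  have key : ∀ x y, R + 1 < ‖y‖ → ‖f x - f y‖ ≤ M * ‖x - y‖ := fun x y hy => by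
    rw [hzero y (by linarith), sub_zero]
    rcases lt_or_ge R ‖x‖ with hx | hx
    · rw [hzero x hx, norm_zero]; positivity
    · have h1 : 1 ≤ ‖x - y‖ := by
        have := norm_sub_norm_le y x
        rw [norm_sub_rev] at this; linarith
      calc ‖f x‖ ≤ M * 1 := by simpa using hM x
        _ ≤ _ := by gcongr
  refine ⟨max C ⟨M, hM0⟩, LipschitzWith.of_dist_le_mul fun x y => ?_⟩
  rw [dist_eq_norm, dist_eq_norm]
  have hle : M ≤ (max C ⟨M, hM0⟩ : NNReal) := by
    have := le_max_right C (⟨M, hM0⟩ : NNReal); exact_mod_cast this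
  have hle' : (C : ℝ) ≤ (max C ⟨M, hM0⟩ : NNReal) := by
    have := le_max_left C (⟨M, hM0⟩ : NNReal); exact_mod_cast this
  rcases lt_or_ge (R + 1) ‖y‖ with hy | hy
  · exact (key x y hy).trans (by gcongr)
  rcases lt_or_ge (R + 1) ‖x‖ with hx | hx
  · rw [norm_sub_rev, norm_sub_rev x]
    exact (key y x hx).trans (by gcongr)
  · have := hC.dist_le_mul x (by simpa using hx) y (by simpa using hy)
    rw [dist_eq_norm, dist_eq_norm] at this
    exact this.trans (by gcongr)

variable [MeasurableSpace E] [BorelSpace E] [FiniteDimensional ℝ F]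
  (μ : Measure E) [μ.IsAddHaarMeasure]

/-- Rademacher's theorem for locally Lipschitz functions. -/
theorem _root_.LocallyLipschitz.ae_differentiableAt {f : E → F} (hf : LocallyLipschitz f) :
    ∀ᵐ x ∂μ, DifferentiableAt ℝ f x := by
  have h : ∀ n : ℕ, ∀ᵐ x ∂μ, x ∈ closedBall (0 : E) n →
      DifferentiableWithinAt ℝ f (closedBall 0 n) x := fun n => by
    obtain ⟨C, hC⟩ := hf.exists_lipschitzOnWith_closedBall (n : ℝ)
    exact hC.ae_differentiableWithinAt_of_mem
  filter_upwards [ae_all_iff.2 h] with x hx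
  obtain ⟨n, hn⟩ := exists_nat_gt ‖x‖
  refine (hx n (by simpa using hn.le)).differentiableAt ?_
  exact Filter.mem_of_superset (isOpen_ball.mem_nhds (by simpa using hn)) ball_subset_closedBall

variable {μ}

/-- A compactly supported locally Lipschitz function has derivatives of zero mean. -/
theorem integral_fderiv_eq_zero {k : E → ℝ} (hk : LocallyLipschitz k)
    (hc : HasCompactSupport k) (e : E) : ∫ x, fderiv ℝ k x e ∂μ = 0 := by
  obtain ⟨C, hC⟩ := hk.exists_lipschitzWith hc
  have h := (LipschitzWith.const (α := E) (1 : ℝ)).integral_lineDeriv_mul_eq (μ := μ) hC hc (-e)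
  have h0 : ∀ x : E, lineDeriv ℝ (fun _ : E => (1 : ℝ)) x (-e) = 0 := fun x => by
    simp [lineDeriv]
  simp only [h0, zero_mul, integral_zero, neg_neg, mul_one] at h
  rw [h]
  refine integral_congr_ae ?_
  filter_upwards [hk.ae_differentiableAt μ] with x hx
  exact hx.lineDeriv_eq_fderiv.symm

theorem norm_fderiv_le_of_lipschitzOnWith {f : E → F} {C : NNReal} {R : ℝ}
    (hf : LipschitzOnWith C f (closedBall 0 R)) {x : E} (hx : ‖x‖ < R) :
    ‖fderiv ℝ f x‖ ≤ C :=
  norm_fderiv_le_of_lipschitzOn ℝ (Filter.mem_of_superset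
    (isOpen_ball.mem_nhds (by simpa using hx)) ball_subset_closedBall) hf

/-- The gradient of a locally Lipschitz function is bounded on bounded sets. -/
theorem _root_.LocallyLipschitz.exists_norm_fderiv_le {f : E → F} (hf : LocallyLipschitz f)
    (R : ℝ) : ∃ C : ℝ, ∀ x, ‖x‖ ≤ R → ‖fderiv ℝ f x‖ ≤ C := by
  obtain ⟨C, hC⟩ := hf.exists_lipschitzOnWith_closedBall (R + 1)
  exact ⟨C, fun x hx => norm_fderiv_le_of_lipschitzOnWith hC (by linarith)⟩

/-- A measurable function that is bounded on bounded sets is locally integrable. -/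
theorem locallyIntegrable_of_bound {f : E → F} (hm : AEStronglyMeasurable f μ)
    (hb : ∀ R : ℝ, ∃ C : ℝ, ∀ᵐ x ∂μ, ‖x‖ ≤ R → ‖f x‖ ≤ C) : LocallyIntegrable f μ := by
  have : ProperSpace E := FiniteDimensional.proper ℝ E
  rw [locallyIntegrable_iff]
  intro K hK
  obtain ⟨R, hR⟩ := hK.isBounded.subset_closedBall 0
  obtain ⟨C, hC⟩ := hb R
  refine Measure.integrableOn_of_bounded (M := C) hK.measure_lt_top.ne hm ?_
  refine (ae_restrict_iff' hK.measurableSet).2 ?_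
  filter_upwards [hC] with x hx hxK
  exact hx (by simpa using hR hxK)

theorem integrable_of_bound_of_support {f : E → F} (hm : AEStronglyMeasurable f μ) (R C : ℝ)
    (hb : ∀ x, ‖x‖ ≤ R → ‖f x‖ ≤ C) (hz : ∀ x, R < ‖x‖ → f x = 0) : Integrable f μ := by
  have : ProperSpace E := FiniteDimensional.proper ℝ E
  refine (integrableOn_iff_integrable_of_support_subset (s := closedBall 0 R) ?_).1 ?_
  · intro x hx
    by_contra h
    exact hx (hz x (by simpa using h))
  · refine Measure.integrableOn_of_bounded (M := C)
      (isCompact_closedBall _ _).measure_lt_top.ne hm ?_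
    exact (ae_restrict_iff' isClosed_closedBall.measurableSet).2
      (.of_forall fun x hx => hb x (by simpa using hx))

theorem _root_.LocallyLipschitz.locallyIntegrable_fderiv {f : E → F} (hf : LocallyLipschitz f) :
    LocallyIntegrable (fun x => fderiv ℝ f x) μ := by
  have : CompleteSpace F := FiniteDimensional.complete ℝ F
  refine locallyIntegrable_of_bound (measurable_fderiv ℝ f).aestronglyMeasurable fun R => ?_
  obtain ⟨C, hC⟩ := hf.exists_norm_fderiv_le R
  exact ⟨C, .of_forall hC⟩

theorem _root_.LocallyLipschitz.locallyIntegrable_fderiv_apply {f : E → F}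
    (hf : LocallyLipschitz f) (e : E) : LocallyIntegrable (fun x => fderiv ℝ f x e) μ := by
  have := (ContinuousLinearMap.apply ℝ F e).continuous.comp_aestronglyMeasurable
    (hf.locallyIntegrable_fderiv (μ := μ)).aestronglyMeasurable
  refine locallyIntegrable_of_bound this fun R => ?_
  obtain ⟨C, hC⟩ := hf.exists_norm_fderiv_le R
  exact ⟨C * ‖e‖, .of_forall fun x hx =>
    ((fderiv ℝ f x).le_opNorm e).trans (by gcongr; exact hC x hx)⟩

/-- A locally integrable function times a continuous compactly supported function. -/
theorem integrable_mul_of_hasCompactSupport {f h : E → ℝ} (hf : LocallyIntegrable f μ)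
    (hh : Continuous h) (hc : HasCompactSupport h) : Integrable (fun x => f x * h x) μ := by
  simpa [mul_comm] using hf.integrable_smul_left_of_hasCompactSupport hh hc

theorem _root_.LocallyLipschitz.mul_real {f h : E → ℝ} (hf : LocallyLipschitz f)
    (hh : LocallyLipschitz h) : LocallyLipschitz (fun x => f x * h x) :=
  (contDiff_mul (𝕜 := ℝ) (𝔸 := ℝ)).locallyLipschitz.comp (hf.prodMk hh)

/-- Integration by parts for locally Lipschitz functions, one of which has compact support. -/
theorem integral_fderiv_mul_eq_neg {f h : E → ℝ} (hf : LocallyLipschitz f)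
    (hh : LocallyLipschitz h) (hc : HasCompactSupport h) (e : E) :
    ∫ x, fderiv ℝ f x e * h x ∂μ = - ∫ x, f x * fderiv ℝ h x e ∂μ := by
  have h0 := integral_fderiv_eq_zero (μ := μ) (hf.mul_real hh) (hc.mul_left (f := f)) e
  have hI1 : Integrable (fun x => fderiv ℝ f x e * h x) μ :=
    integrable_mul_of_hasCompactSupport (hf.locallyIntegrable_fderiv_apply e) hh.continuous hc
  have hI2 : Integrable (fun x => f x * fderiv ℝ h x e) μ := by
    have hc' : HasCompactSupport (fun x => fderiv ℝ h x e) := hc.fderiv_apply (𝕜 := ℝ) e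
    obtain ⟨R, hR⟩ := hc'.isCompact.isBounded.subset_closedBall 0
    obtain ⟨C, hC⟩ := hh.exists_norm_fderiv_le R
    have : ProperSpace E := FiniteDimensional.proper ℝ E
    obtain ⟨M, hM⟩ := (isCompact_closedBall (0 : E) R).exists_bound_of_continuousOn
      hf.continuous.continuousOn
    refine integrable_of_bound_of_support (hf.continuous.aestronglyMeasurable.mul
      (measurable_fderiv_apply_const ℝ h e).aestronglyMeasurable) R (M * (C * ‖e‖)) ?_ ?_
    · intro x hx
      rw [norm_mul]
      have h1 := hM x (by simpa using hx)
      have h2 : ‖fderiv ℝ h x e‖ ≤ C * ‖e‖ :=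
        ((fderiv ℝ h x).le_opNorm e).trans (by gcongr; exact hC x hx)
      exact mul_le_mul h1 h2 (norm_nonneg _) ((norm_nonneg _).trans h1)
    · intro x hx
      have : fderiv ℝ h x e = 0 := by
        by_contra h'
        have := hR (subset_tsupport _ h')
        rw [mem_closedBall_zero_iff] at this
        linarith
      rw [this, mul_zero]
  have : (fun x => fderiv ℝ (fun x => f x * h x) x e) =ᵐ[μ]
      fun x => fderiv ℝ f x e * h x + f x * fderiv ℝ h x e := by
    filter_upwards [hf.ae_differentiableAt μ, hh.ae_differentiableAt μ] with x h1 h2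
    rw [fderiv_fun_mul h1 h2]
    simp [mul_comm, add_comm]
  rw [integral_congr_ae this, integral_add hI1 hI2] at h0
  linarith

/-- A derivative of the convolution `ψ ⋆ q` falls on the smooth kernel `ψ`. -/
theorem hasFDerivAt_integral_sub_mul {ψ q : E → ℝ} (hψ : ContDiff ℝ 1 ψ)
    (hc : HasCompactSupport ψ) (hq : LocallyIntegrable q μ) (x : E) :
    HasFDerivAt (fun x => ∫ z, ψ (x - z) * q z ∂μ) (∫ z, q z • fderiv ℝ ψ (x - z) ∂μ) x := by
  have h := hc.hasFDerivAt_convolution_left (ContinuousLinearMap.mul ℝ ℝ) hψ hq x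
  have e1 : (fun x => ∫ z, ψ (x - z) * q z ∂μ)
      = convolution ψ q (ContinuousLinearMap.mul ℝ ℝ) μ := by
    funext y
    exact convolution_mul_swap.symm
  have e2 : ∫ z, q z • fderiv ℝ ψ (x - z) ∂μ = convolution (fderiv ℝ ψ) q
      (ContinuousLinearMap.precompL E (ContinuousLinearMap.mul ℝ ℝ)) μ x := by
    rw [convolution_eq_swap]
    refine integral_congr_ae (.of_forall fun z => ?_)
    ext v
    simp [ContinuousLinearMap.precompL_apply, mul_comm]
  rw [e1, e2]
  exact h

theorem fderiv_integral_sub_mul_apply {ψ q : E → ℝ} (hψ : ContDiff ℝ 1 ψ)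
    (hc : HasCompactSupport ψ) (hq : LocallyIntegrable q μ) (x e : E) :
    fderiv ℝ (fun x => ∫ z, ψ (x - z) * q z ∂μ) x e
      = ∫ z, fderiv ℝ ψ (x - z) e * q z ∂μ := by
  rw [(hasFDerivAt_integral_sub_mul hψ hc hq x).fderiv, ContinuousLinearMap.integral_apply]
  · simp [mul_comm]
  · have hc' : HasCompactSupport fun z => fderiv ℝ ψ (x - z) :=
      (hc.fderiv (𝕜 := ℝ)).comp_homeomorph (Homeomorph.subLeft x)
    exact hq.integrable_smul_right_of_hasCompactSupport
      ((hψ.continuous_fderiv one_ne_zero).comp (by fun_prop)) hc'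

end LocallyLipschitz

/-! ### Weak gradients -/

section WeakGradient

variable {N m : ℕ}

/-- The classical gradient, in the format of weak gradients. -/
noncomputable def classicalGrad (w : Vec N → Vec m) (x : Vec N) : Grad N m :=
  WithLp.toLp 2 fun i => fderiv ℝ w x (EuclideanSpace.single i 1)

theorem locallyIntegrable_pi_apply {ι : Type*} [Fintype ι] {β : ι → Type*}
    [∀ i, NormedAddCommGroup (β i)] {D : Vec N → PiLp 2 β}
    (hD : LocallyIntegrable D) (i : ι) : LocallyIntegrable (fun x => D x i) :=
  hD.mono ((PiLp.continuous_apply 2 β i).comp_aestronglyMeasurable hD.aestronglyMeasurable)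
    (.of_forall fun x => PiLp.norm_apply_le (D x) i)

theorem norm_classicalGrad_le {w : Vec N → Vec m} {x : Vec N} {C : ℝ}
    (hC : ‖fderiv ℝ w x‖ ≤ C) : ‖classicalGrad w x‖ ≤ √(∑ _i : Fin N, C ^ 2) := by
  rw [PiLp.norm_eq_of_L2]
  gcongr with i
  calc ‖fderiv ℝ w x (EuclideanSpace.single i 1)‖
      ≤ ‖fderiv ℝ w x‖ * ‖EuclideanSpace.single i (1 : ℝ)‖ := ContinuousLinearMap.le_opNorm _ _
    _ ≤ C := by simpa using hC

theorem _root_.LocallyLipschitz.aestronglyMeasurable_classicalGrad {w : Vec N → Vec m}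
    (hw : LocallyLipschitz w) : AEStronglyMeasurable (classicalGrad w) := by
  refine (PiLp.continuous_toLp 2 (fun _ : Fin N => Vec m)).comp_aestronglyMeasurable
    (aemeasurable_pi_lambda _ fun i => ?_).aestronglyMeasurable
  exact (hw.locallyIntegrable_fderiv_apply _).aestronglyMeasurable.aemeasurable

theorem hasWeakGradient_of_locallyLipschitz {w : Vec N → Vec m} (hw : LocallyLipschitz w) :
    HasWeakGradient w (classicalGrad w) where
  locallyIntegrable := hw.continuous.locallyIntegrable
  grad_locallyIntegrable := by
    refine locallyIntegrable_of_bound (hw.aestronglyMeasurable_classicalGrad) fun R => ?_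
    obtain ⟨C, hC⟩ := hw.exists_norm_fderiv_le R
    exact ⟨√(∑ _i : Fin N, C ^ 2), .of_forall fun x hx => (norm_classicalGrad_le (hC x hx))⟩
  integral_eq φ hφ hc i := by
    have hloc : LocallyIntegrable (fun x => fderiv ℝ w x (EuclideanSpace.single i 1)) :=
      hw.locallyIntegrable_fderiv_apply _
    have hI1 : Integrable fun x => fderiv ℝ φ x (EuclideanSpace.single i 1) • w x :=
      hw.continuous.locallyIntegrable.integrable_smul_left_of_hasCompactSupport
        ((hφ.continuous_fderiv (by simp)).clm_apply continuous_const)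
        (hc.fderiv_apply (𝕜 := ℝ) _)
    have hI2 : Integrable fun x => φ x • classicalGrad w x i :=
      hloc.integrable_smul_left_of_hasCompactSupport hφ.continuous hc
    ext j
    have e1 := (EuclideanSpace.proj (𝕜 := ℝ) j).integral_comp_comm hI1
    have e2 := (EuclideanSpace.proj (𝕜 := ℝ) j).integral_comp_comm hI2
    have hwj : LocallyLipschitz (fun x => w x j) :=
      (EuclideanSpace.proj (𝕜 := ℝ) (ι := Fin m) j).lipschitz.locallyLipschitz.comp hw
    have hibp := integral_fderiv_mul_eq_neg (μ := volume) hwj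
      (hφ.of_le (by simp) : ContDiff ℝ 1 φ).locallyLipschitz hc (EuclideanSpace.single i 1)
    have hae : (fun x => EuclideanSpace.proj (𝕜 := ℝ) j (φ x • classicalGrad w x i)) =ᵐ[volume]
        fun x => fderiv ℝ (fun x => w x j) x (EuclideanSpace.single i 1) * φ x := by
      filter_upwards [hw.ae_differentiableAt volume] with x hx
      have : HasFDerivAt (fun x => w x j)
          ((EuclideanSpace.proj (𝕜 := ℝ) j).comp (fderiv ℝ w x)) x :=
        (EuclideanSpace.proj (𝕜 := ℝ) j).hasFDerivAt.comp x hx.hasFDerivAt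
      rw [this.fderiv]
      simp [classicalGrad, mul_comm]
    change EuclideanSpace.proj (𝕜 := ℝ) j _ = - EuclideanSpace.proj (𝕜 := ℝ) j _
    rw [← e1, ← e2, integral_congr_ae hae, hibp, neg_neg]
    simp [mul_comm]

theorem HasWeakGradient.ae_eq {w : Vec N → Vec m} {D₁ D₂ : Vec N → Grad N m}
    (h₁ : HasWeakGradient w D₁) (h₂ : HasWeakGradient w D₂) : D₁ =ᵐ[volume] D₂ := by
  have h : ∀ i, ∀ᵐ x, D₁ x i = D₂ x i := fun i => by
    refine ae_eq_of_integral_contDiff_smul_eq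
      (locallyIntegrable_pi_apply h₁.grad_locallyIntegrable i)
      (locallyIntegrable_pi_apply h₂.grad_locallyIntegrable i) fun φ hφ hc => ?_
    rw [← neg_inj, ← h₁.integral_eq φ hφ hc i, ← h₂.integral_eq φ hφ hc i]
  filter_upwards [ae_all_iff.2 h] with x hx
  ext i : 1
  exact hx i

theorem hasWeakGradient_weakGradient {w : Vec N → Vec m} (h : ∃ D, HasWeakGradient w D) :
    HasWeakGradient w (weakGradient w) := by
  rw [weakGradient, dif_pos h]
  exact h.choose_spec

theorem HasWeakGradient.weakGradient_ae_eq {w : Vec N → Vec m} {D : Vec N → Grad N m}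
    (h : HasWeakGradient w D) : weakGradient w =ᵐ[volume] D :=
  (hasWeakGradient_weakGradient ⟨D, h⟩).ae_eq h

theorem HasWeakGradient.congr {w w' : Vec N → Vec m} {D : Vec N → Grad N m}
    (h : HasWeakGradient w D) (hw : w' =ᵐ[volume] w) : HasWeakGradient w' D where
  locallyIntegrable := h.locallyIntegrable.congr hw.symm
  grad_locallyIntegrable := h.grad_locallyIntegrable
  integral_eq φ hφ hc i := by
    rw [← h.integral_eq φ hφ hc i]
    refine integral_congr_ae ?_
    filter_upwards [hw] with x hx
    rw [hx]

theorem HasWeakGradient.add {w w' : Vec N → Vec m} {D D' : Vec N → Grad N m}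
    (h : HasWeakGradient w D) (h' : HasWeakGradient w' D') :
    HasWeakGradient (fun x => w x + w' x) (fun x => D x + D' x) where
  locallyIntegrable := h.locallyIntegrable.add h'.locallyIntegrable
  grad_locallyIntegrable := h.grad_locallyIntegrable.add h'.grad_locallyIntegrable
  integral_eq φ hφ hc i := by
    have hd : Continuous fun x => fderiv ℝ φ x (EuclideanSpace.single i 1) :=
      (hφ.continuous_fderiv (by simp)).clm_apply continuous_const
    have hdc : HasCompactSupport fun x => fderiv ℝ φ x (EuclideanSpace.single i 1) :=
      hc.fderiv_apply (𝕜 := ℝ) _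
    simp only [smul_add, PiLp.add_apply]
    rw [integral_add, integral_add, h.integral_eq φ hφ hc i, h'.integral_eq φ hφ hc i, neg_add]
    · exact (locallyIntegrable_pi_apply h.grad_locallyIntegrable
        i).integrable_smul_left_of_hasCompactSupport hφ.continuous hc
    · exact (locallyIntegrable_pi_apply h'.grad_locallyIntegrable
        i).integrable_smul_left_of_hasCompactSupport hφ.continuous hc
    · exact h.locallyIntegrable.integrable_smul_left_of_hasCompactSupport hd hdc
    · exact h'.locallyIntegrable.integrable_smul_left_of_hasCompactSupport hd hdc

theorem HasWeakGradient.const_smul {w : Vec N → Vec m} {D : Vec N → Grad N m}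
    (h : HasWeakGradient w D) (c : ℝ) :
    HasWeakGradient (fun x => c • w x) (fun x => c • D x) where
  locallyIntegrable := h.locallyIntegrable.smul c
  grad_locallyIntegrable := h.grad_locallyIntegrable.smul c
  integral_eq φ hφ hc i := by
    simp only [PiLp.smul_apply, smul_comm _ c]
    rw [integral_smul, integral_smul, h.integral_eq φ hφ hc i, smul_neg]

/-- Young's inequality with a parameter. -/
theorem norm_mul_le_young {ε : ℝ} (hε : 0 < ε) (a b : ℝ) :
    ‖a * b‖ ≤ ε * a ^ 2 + ε⁻¹ * ‖b‖ ^ 2 := by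
  have h2 : ε * a ^ 2 + ε⁻¹ * ‖b‖ ^ 2 - 2 * (‖a‖ * ‖b‖) = ε * (‖a‖ - ε⁻¹ * ‖b‖) ^ 2 := by
    rw [← sq_abs a, ← Real.norm_eq_abs]
    field_simp
    ring
  have h3 : 0 ≤ ε * (‖a‖ - ε⁻¹ * ‖b‖) ^ 2 := by positivity
  have h5 : 0 ≤ ‖a‖ * ‖b‖ := by positivity
  rw [norm_mul]
  linarith

/-- A constant convolution of a compactly supported function with a square integrable one
vanishes, since such a convolution tends to zero at infinity. -/
theorem eq_zero_of_forall_integral_sub_mul_eq (hN : 0 < N) {ψ : Vec N → ℝ} (hψ : Continuous ψ)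
    (hψc : HasCompactSupport ψ) {w : Vec N → ℝ} (hw : MemLp w 2) {c : ℝ}
    (hconst : ∀ y, ∫ z, ψ (y - z) * w z = c) : c = 0 := by
  obtain ⟨R, hR⟩ := hψc.isCompact.isBounded.subset_closedBall 0
  have hw2 : Integrable (fun x => ‖w x‖ ^ 2) := hw.integrable_norm_pow (by norm_num)
  set e : Vec N := EuclideanSpace.single ⟨0, hN⟩ 1 with he
  set b : ℕ → ℝ := fun n => ∫ z, indicator (closedBall ((n : ℝ) • e) R) (fun z => ‖w z‖ ^ 2) z
  have hb : Tendsto b atTop (𝓝 0) := by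
    have : Tendsto b atTop (𝓝 (∫ _z : Vec N, (0 : ℝ))) := by
      refine tendsto_integral_of_dominated_convergence (fun z => ‖w z‖ ^ 2) (fun n =>
        hw2.aestronglyMeasurable.indicator isClosed_closedBall.measurableSet) hw2
        (fun n => .of_forall fun z => ?_) (.of_forall fun z => ?_)
      · refine (norm_indicator_le_norm_self _ _).trans (le_of_eq ?_)
        simp
      · refine tendsto_const_nhds.congr' ?_
        obtain ⟨n₀, hn₀⟩ := exists_nat_gt (R + ‖z‖)
        filter_upwards [eventually_ge_atTop n₀] with n hn
        refine (indicator_of_notMem ?_ _).symm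
        rw [mem_closedBall, dist_eq_norm, not_le]
        have h1 : ‖(n : ℝ) • e‖ = n := by simp [norm_smul, he]
        have h2 := norm_sub_norm_le ((n : ℝ) • e) z
        have h3 : (n₀ : ℝ) ≤ n := by exact_mod_cast hn
        rw [norm_sub_rev] at h2
        linarith
    simpa using this
  set A : ℝ := ∫ z, ψ z ^ 2
  -- Young's inequality on the support of the translated kernel
  have hle : ∀ ε : ℝ, 0 < ε → ∀ n : ℕ, |c| ≤ ε * A + ε⁻¹ * b n := fun ε hε n => by
    rw [← hconst ((n : ℝ) • e)]
    have hψn : Continuous fun z => ψ ((n : ℝ) • e - z) := hψ.comp (continuous_const.sub continuous_id)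
    have hψnc : HasCompactSupport fun z => ψ ((n : ℝ) • e - z) :=
      hψc.comp_homeomorph (Homeomorph.subLeft ((n : ℝ) • e))
    have hψsq : Integrable (fun z => ψ ((n : ℝ) • e - z) ^ 2) := by
      simp only [pow_two]
      exact (hψn.mul hψn).integrable_of_hasCompactSupport hψnc.mul_left
    have hA : A = ∫ z, ψ ((n : ℝ) • e - z) ^ 2 :=
      (integral_sub_left_eq_self (fun z => ψ z ^ 2) volume _).symm
    have hwi : Integrable (indicator (closedBall ((n : ℝ) • e) R) fun z => ‖w z‖ ^ 2) :=
      hw2.indicator isClosed_closedBall.measurableSet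
    rw [hA, ← integral_const_mul, ← integral_const_mul,
      ← integral_add (hψsq.const_mul _) (hwi.const_mul _)]
    rw [← Real.norm_eq_abs]
    refine norm_integral_le_of_norm_le ((hψsq.const_mul _).add (hwi.const_mul _))
      (.of_forall fun z => ?_)
    by_cases hz : z ∈ closedBall ((n : ℝ) • e) R
    · simp only [indicator_of_mem hz]
      exact norm_mul_le_young hε _ _
    · have : ψ ((n : ℝ) • e - z) = 0 := by
        by_contra h'
        have := hR (subset_tsupport _ h')
        rw [mem_closedBall_zero_iff, norm_sub_rev, ← dist_eq_norm] at this
        exact hz this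
      simp [this, indicator_of_notMem hz]
  have hle' : ∀ ε : ℝ, 0 < ε → |c| ≤ ε * A := fun ε hε => by
    have : Tendsto (fun n => ε * A + ε⁻¹ * b n) atTop (𝓝 (ε * A + ε⁻¹ * 0)) :=
      (hb.const_mul _).const_add _
    simpa using ge_of_tendsto' this (hle ε hε)
  have : Tendsto (fun ε : ℝ => ε * A) (𝓝[>] 0) (𝓝 (0 * A)) :=
    (tendsto_nhdsWithin_of_tendsto_nhds tendsto_id).mul_const A
  have h0 : |c| ≤ 0 * A := ge_of_tendsto this (eventually_nhdsWithin_of_forall hle')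
  exact abs_nonpos_iff.1 (by simpa using h0)

/-- A square integrable map on a space of positive dimension with vanishing weak gradient
vanishes: its convolution with a test function is constant, and tends to zero at infinity. -/
theorem HasWeakGradient.ae_eq_zero_of_memLp (hN : 0 < N) {w : Vec N → Vec m}
    (h : HasWeakGradient w 0) (hw : MemLp w 2) : w =ᵐ[volume] 0 := by
  have hcomp : ∀ j, ∀ᵐ x, w x j = 0 := fun j => by
    have hwj : LocallyIntegrable (fun x => w x j) :=
      locallyIntegrable_pi_apply h.locallyIntegrable j
    refine ae_eq_zero_of_integral_contDiff_smul_eq_zero hwj fun φ hφ hc => ?_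
    set ψ : Vec N → ℝ := fun x => φ (-x) with hψ_def
    have hψ : ContDiff ℝ ∞ ψ := hφ.comp contDiff_neg
    have hψc : HasCompactSupport ψ := hc.comp_homeomorph (Homeomorph.neg (Vec N))
    set J : Vec N → ℝ := fun y => ∫ z, ψ (y - z) * w z j with hJ
    have hψ1 : ContDiff ℝ 1 ψ := hψ.of_le (by simp)
    have hJd : Differentiable ℝ J := fun y =>
      (hasFDerivAt_integral_sub_mul hψ1 hψc hwj y).differentiableAt
    have hJ0 : ∀ y, fderiv ℝ J y = 0 := fun y => by
      refine ContinuousLinearMap.coe_injective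
        ((EuclideanSpace.basisFun (Fin N) ℝ).toBasis.ext fun i => ?_)
      simp only [OrthonormalBasis.coe_toBasis, EuclideanSpace.basisFun_apply,
        ContinuousLinearMap.coe_coe, ContinuousLinearMap.toLinearMap_zero,
        LinearMap.zero_apply]
      rw [hJ, fderiv_integral_sub_mul_apply hψ1 hψc hwj]
      have hη : ContDiff ℝ ∞ (fun z => ψ (y - z)) := hψ.comp (contDiff_const.sub contDiff_id)
      have hηc : HasCompactSupport (fun z => ψ (y - z)) :=
        hψc.comp_homeomorph (Homeomorph.subLeft y)
      have key := h.integral_eq _ hη hηc i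
      have hI : Integrable fun z => fderiv ℝ (fun z => ψ (y - z)) z
          (EuclideanSpace.single i 1) • w z :=
        h.locallyIntegrable.integrable_smul_left_of_hasCompactSupport
          ((hη.continuous_fderiv (by simp)).clm_apply continuous_const)
          (hηc.fderiv_apply (𝕜 := ℝ) _)
      have e1 := (EuclideanSpace.proj (𝕜 := ℝ) j).integral_comp_comm hI
      rw [key] at e1
      have e2 : ∀ z, fderiv ℝ (fun z => ψ (y - z)) z (EuclideanSpace.single i 1)
          = - fderiv ℝ ψ (y - z) (EuclideanSpace.single i 1) := fun z => by
        have := ((hψ.differentiable (by simp)) (y - z)).hasFDerivAt.comp z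
          ((hasFDerivAt_id z).const_sub y)
        erw [this.fderiv]
        simp
      simpa [e2, integral_neg] using e1
    have hconst : ∀ y, J y = J 0 := fun y => is_const_of_fderiv_eq_zero hJd hJ0 y 0
    suffices hJz : J 0 = 0 by
      simpa [hJ, hψ_def] using hJz
    exact eq_zero_of_forall_integral_sub_mul_eq hN hψ.continuous hψc
      (hw.mono ((PiLp.continuous_apply 2 _ j).comp_aestronglyMeasurable hw.aestronglyMeasurable)
        (.of_forall fun x => PiLp.norm_apply_le (w x) j)) hconst
  filter_upwards [ae_all_iff.2 hcomp] with x hx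
  ext j
  exact hx j

end WeakGradient

/-! ### The obstacle problem -/

section Obstacle

variable {N m : ℕ} {K : Set (Vec m)} {w V : Vec N → Vec m} {G : Vec N → Vec m →L[ℝ] ℝ}

theorem integrable_norm_sq_grad_sub (hV : IsAdmissible K w G V) :
    Integrable fun x => ‖weakGradient V x - weakGradient w x‖ ^ 2 :=
  hV.gradient_sub_memLp.integrable_norm_pow (by norm_num)

theorem obstacleEnergy_eq (hV : IsAdmissible K w G V) :
    obstacleEnergy w G V = 1 / 2 * (∫ x, ‖weakGradient V x - weakGradient w x‖ ^ 2)
      + ∫ x, G x (V x - w x) := by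
  rw [obstacleEnergy, integral_add ((integrable_norm_sq_grad_sub hV).const_mul _) hV.integrable,
    integral_const_mul]

theorem weakGradient_add_smul_sub (hw : ∃ D, HasWeakGradient w D) (hV : ∃ D, HasWeakGradient V D)
    (θ : ℝ) : HasWeakGradient (fun x => w x + θ • (V x - w x))
      (fun x => weakGradient w x + θ • (weakGradient V x - weakGradient w x)) := by
  have h1 := hasWeakGradient_weakGradient hw
  have h2 := hasWeakGradient_weakGradient hV
  have h := h1.add ((h2.add (h1.const_smul (-1))).const_smul θ)
  simpa [sub_eq_add_neg] using h

theorem weakGradient_add_smul_sub_ae (hw : ∃ D, HasWeakGradient w D)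
    (hV : ∃ D, HasWeakGradient V D) (θ : ℝ) :
    (fun x => weakGradient (fun x => w x + θ • (V x - w x)) x - weakGradient w x) =ᵐ[volume]
      fun x => θ • (weakGradient V x - weakGradient w x) := by
  filter_upwards [(weakGradient_add_smul_sub hw hV θ).weakGradient_ae_eq] with x hx
  rw [hx, add_sub_cancel_left]

theorem isAdmissible_add_smul_sub (hK : Convex ℝ K) (hw : ∃ D, HasWeakGradient w D)
    (hwK : ∀ᵐ x, w x ∈ K) (hV : IsAdmissible K w G V) {θ : ℝ} (hθ : θ ∈ Icc (0 : ℝ) 1) :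
    IsAdmissible K w G (fun x => w x + θ • (V x - w x)) where
  mem := by
    filter_upwards [hwK, hV.mem] with x hx hx'
    exact hK.add_smul_sub_mem hx hx' hθ
  hasWeakGradient := ⟨_, weakGradient_add_smul_sub hw hV.hasWeakGradient θ⟩
  sub_memLp := by
    have h := hV.sub_memLp.const_smul θ
    simp only [add_sub_cancel_left]
    exact h
  gradient_sub_memLp := (hV.gradient_sub_memLp.const_smul θ).ae_eq
    (weakGradient_add_smul_sub_ae hw hV.hasWeakGradient θ).symm
  integrable := by
    simpa using hV.integrable.const_mul θ

theorem obstacleEnergy_add_smul_sub (hK : Convex ℝ K) (hw : ∃ D, HasWeakGradient w D)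
    (hwK : ∀ᵐ x, w x ∈ K) (hV : IsAdmissible K w G V) {θ : ℝ} (hθ : θ ∈ Icc (0 : ℝ) 1) :
    obstacleEnergy w G (fun x => w x + θ • (V x - w x))
      = θ ^ 2 / 2 * (∫ x, ‖weakGradient V x - weakGradient w x‖ ^ 2)
        + θ * ∫ x, G x (V x - w x) := by
  rw [obstacleEnergy_eq (isAdmissible_add_smul_sub hK hw hwK hV hθ)]
  have h : (fun x => ‖weakGradient (fun x => w x + θ • (V x - w x)) x - weakGradient w x‖ ^ 2)
      =ᵐ[volume] fun x => θ ^ 2 * ‖weakGradient V x - weakGradient w x‖ ^ 2 := by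
    filter_upwards [weakGradient_add_smul_sub_ae hw hV.hasWeakGradient θ] with x hx
    rw [hx, norm_smul, mul_pow, Real.norm_eq_abs, sq_abs]
  rw [integral_congr_ae h, integral_const_mul]
  simp only [add_sub_cancel_left, map_smul, smul_eq_mul]
  rw [integral_const_mul]
  ring

/-- The variational inequality satisfied by a solution of the obstacle problem, tested in the
direction of the reference map. -/
theorem IsObstacleSolution.integral_le (hK : Convex ℝ K) (hw : ∃ D, HasWeakGradient w D)
    (hwK : ∀ᵐ x, w x ∈ K) (hV : IsObstacleSolution K w G V) :
    ∫ x, G x (V x - w x) ≤ - ∫ x, ‖weakGradient V x - weakGradient w x‖ ^ 2 := by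
  set A := ∫ x, ‖weakGradient V x - weakGradient w x‖ ^ 2 with hA
  set B := ∫ x, G x (V x - w x)
  have hA0 : 0 ≤ A := integral_nonneg fun x => by positivity
  have hmin : ∀ θ ∈ Ico (0 : ℝ) 1, B ≤ - ((1 + θ) / 2 * A) := fun θ hθ => by
    have h := hV.2 _ (isAdmissible_add_smul_sub hK hw hwK hV.1 ⟨hθ.1, hθ.2.le⟩)
    rw [obstacleEnergy_eq hV.1, obstacleEnergy_add_smul_sub hK hw hwK hV.1 ⟨hθ.1, hθ.2.le⟩] at h
    have h1 : (1 - θ) * B ≤ (1 - θ) * (-((1 + θ) / 2 * A)) := by linarith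
    exact le_of_mul_le_mul_left h1 (by linarith [hθ.2])
  have hlim : Tendsto (fun θ : ℝ => - ((1 + θ) / 2 * A)) (𝓝[<] 1) (𝓝 (-((1 + 1) / 2 * A))) :=
    (Continuous.tendsto (by fun_prop) 1).mono_left nhdsWithin_le_nhds
  have := ge_of_tendsto hlim (Filter.mem_of_superset
    (Ico_mem_nhdsLT (zero_lt_one (α := ℝ))) hmin)
  linarith

/-- The reference map is itself a competitor, of energy zero. A representative that differs from it on a
null set is allowed. -/
theorem isAdmissible_self (hw : ∃ D, HasWeakGradient w D) (hwK : ∀ᵐ x, w x ∈ K)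
    (hV : V =ᵐ[volume] w) : IsAdmissible K w G V where
  mem := by
    filter_upwards [hwK, hV] with x hx hx'
    rwa [hx']
  hasWeakGradient := ⟨_, (hasWeakGradient_weakGradient hw).congr hV⟩
  sub_memLp := by
    refine (MemLp.zero (ε := Vec m)).ae_eq ?_
    filter_upwards [hV] with x hx
    simp [hx]
  gradient_sub_memLp := by
    refine (MemLp.zero (ε := Grad N m)).ae_eq ?_
    filter_upwards [((hasWeakGradient_weakGradient hw).congr hV).weakGradient_ae_eq] with x hx
    simp [hx]
  integrable := by
    refine (integrable_zero (Vec N) ℝ volume).congr ?_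
    filter_upwards [hV] with x hx
    simp [hx]

/-- If the linear term is nonnegative in all feasible directions, then the reference map is the
unique solution of the obstacle problem. -/
theorem isObstacleSolution_iff (hN : 0 < N) (hw : ∃ D, HasWeakGradient w D)
    (hwK : ∀ᵐ x, w x ∈ K) (hG : ∀ᵐ x, ∀ k ∈ K, 0 ≤ G x (k - w x)) :
    IsObstacleSolution K w G V ↔ V =ᵐ[volume] w := by
  have hnonneg : ∀ W, IsAdmissible K w G W →
      0 ≤ᵐ[volume] fun x => (1 / 2 : ℝ) * ‖weakGradient W x - weakGradient w x‖ ^ 2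
        + G x (W x - w x) := fun W hW => by
    filter_upwards [hG, hW.mem] with x hx hx'
    have := hx _ hx'
    simp only [Pi.zero_apply]
    positivity
  have hzero : ∀ W, W =ᵐ[volume] w → obstacleEnergy w G W = 0 := fun W hW => by
    rw [obstacleEnergy, ← integral_zero (Vec N) ℝ]
    refine integral_congr_ae ?_
    filter_upwards [((hasWeakGradient_weakGradient hw).congr hW).weakGradient_ae_eq, hW]
      with x hx hx'
    simp [hx, hx']
  constructor
  · intro hV
    have hle : obstacleEnergy w G V ≤ 0 :=
      (hV.2 w (isAdmissible_self hw hwK .rfl)).trans_eq (hzero w .rfl)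
    have h0 : obstacleEnergy w G V = 0 := le_antisymm hle (integral_nonneg_of_ae (hnonneg V hV.1))
    have hint : Integrable fun x => (1 / 2 : ℝ) * ‖weakGradient V x - weakGradient w x‖ ^ 2
        + G x (V x - w x) := ((integrable_norm_sq_grad_sub hV.1).const_mul _).add hV.1.integrable
    have hae := (integral_eq_zero_iff_of_nonneg_ae (hnonneg V hV.1) hint).1 h0
    have hgrad : (fun x => weakGradient V x + (-1 : ℝ) • weakGradient w x) =ᵐ[volume] 0 := by
      filter_upwards [hG, hV.1.mem, hae] with x hx hx' hx''
      have h1 := hx _ hx'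
      simp only [Pi.zero_apply] at hx''
      have h2 : ‖weakGradient V x - weakGradient w x‖ ^ 2 = 0 :=
        le_antisymm (by linarith) (by positivity)
      simpa [sub_eq_add_neg] using h2
    have hwg := (hasWeakGradient_weakGradient hV.1.hasWeakGradient).add
      ((hasWeakGradient_weakGradient hw).const_smul (-1))
    have hwg0 : HasWeakGradient (fun x => V x + (-1 : ℝ) • w x) 0 :=
      { locallyIntegrable := hwg.locallyIntegrable
        grad_locallyIntegrable := locallyIntegrable_zero
        integral_eq := fun φ hφ hc i => by
          rw [hwg.integral_eq φ hφ hc i]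
          congr 1
          refine integral_congr_ae ?_
          filter_upwards [hgrad] with x hx
          rw [hx] }
    have hL2 : MemLp (fun x => V x + (-1 : ℝ) • w x) 2 := by
      simpa [sub_eq_add_neg] using hV.1.sub_memLp
    filter_upwards [hwg0.ae_eq_zero_of_memLp hN hL2] with x hx
    simpa [← sub_eq_add_neg, sub_eq_zero] using hx
  · intro hV
    refine ⟨isAdmissible_self hw hwK hV, fun W hW => ?_⟩
    rw [hzero V hV]
    exact integral_nonneg_of_ae (hnonneg W hW)

end Obstacle

/-! ### Convex combinations of feasible maps -/

theorem IsFeasible.add_smul_sub {N m : ℕ} {T : ℝ} {K : Set (Vec m)} (hK : Convex ℝ K)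
    {u U : ℝ → Vec N → Vec m} (hu : IsFeasible T K u) (hU : IsFeasible T K U) {ε : ℝ}
    (hε : ε ∈ Icc (0 : ℝ) 1) : IsFeasible T K (fun t x => u t x + ε • (U t x - u t x)) where
  mem t ht x := hK.add_smul_sub_mem (hu.mem t ht x) (hU.mem t ht x) hε
  lipschitz := by
    obtain ⟨L, hL⟩ := hu.lipschitz
    obtain ⟨L', hL'⟩ := hU.lipschitz
    exact ⟨_, fun t ht => (hL t ht).add
      ((lipschitzWith_smul ε).comp ((hL' t ht).sub (hL t ht)))⟩
  aemeasurable x :=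
    (hu.aemeasurable x).add (((hU.aemeasurable x).sub (hu.aemeasurable x)).const_smul ε)

/-! ### Gronwall estimates -/

section Gronwall

/-- Gronwall's inequality in integral form. -/
theorem le_mul_exp_of_le_add_integral {a b c L : ℝ} {φ : ℝ → ℝ} (hφ : ContinuousOn φ (Icc a b))
    (hL : 0 ≤ L) (h : ∀ s ∈ Icc a b, φ s ≤ c + L * ∫ r in a..s, φ r) :
    ∀ s ∈ Icc a b, φ s ≤ c * Real.exp (L * (s - a)) := by
  intro s hs
  have hab : a ≤ b := hs.1.trans hs.2
  set φ' : ℝ → ℝ := IccExtend hab ((Icc a b).domRestrict φ) with hφ'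
  have hc : Continuous φ' := (continuousOn_iff_continuous_domRestrict.1 hφ).Icc_extend'
  have heq : ∀ r ∈ Icc a b, φ' r = φ r := fun r hr => by
    rw [hφ', IccExtend_of_mem hab _ hr, domRestrict_apply]
  have hint : ∀ r ∈ Icc a b, ∫ q in a..r, φ' q = ∫ q in a..r, φ q := fun r hr =>
    intervalIntegral.integral_congr fun q hq => by
      rw [uIcc_of_le hr.1] at hq
      exact heq q ⟨hq.1, hq.2.trans hr.2⟩
  have hd : ∀ r, HasDerivAt (fun r => c + L * ∫ q in a..r, φ' q) (L * φ' r) r := fun r =>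
    ((intervalIntegral.integral_hasDerivAt_right (hc.intervalIntegrable _ _)
      (hc.stronglyMeasurableAtFilter _ _) hc.continuousAt).const_mul L).const_add c
  have hle : ∀ r ∈ Icc a b, φ' r ≤ c + L * ∫ q in a..r, φ' q := fun r hr => by
    rw [heq r hr, hint r hr]
    exact h r hr
  have := le_gronwallBound_of_liminf_deriv_right_le (f := fun r => c + L * ∫ q in a..r, φ' q)
    (f' := fun r => L * φ' r) (δ := c) (K := L) (ε := 0) (a := a) (b := b)
    (fun r _ => (hd r).continuousAt.continuousWithinAt)
    (fun x _ r hr => (hd x).hasDerivWithinAt.liminf_right_slope_le hr)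
    (by simp) (fun x hx => by
      rw [add_zero]
      exact mul_le_mul_of_nonneg_left (hle x ⟨hx.1, hx.2.le⟩) hL) s hs
  rw [gronwallBound_ε0] at this
  rw [← heq s hs]
  exact (hle s hs).trans this

/-- A Gronwall estimate which is only available as long as the function is at most one. -/
theorem le_mul_exp_of_le_add_integral_of_le_one {a b c L : ℝ} {φ : ℝ → ℝ}
    (hφ : ContinuousOn φ (Icc a b)) (hL : 0 ≤ L) (hc : 0 ≤ c) (hφa : φ a ≤ c)
    (hsmall : c * Real.exp (L * (b - a)) < 1)
    (h : ∀ s ∈ Icc a b, (∀ r ∈ Icc a s, φ r ≤ 1) → φ s ≤ c + L * ∫ r in a..s, φ r) :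
    ∀ s ∈ Icc a b, φ s ≤ c * Real.exp (L * (s - a)) := by
  have key : ∀ s ∈ Icc a b, (∀ r ∈ Icc a s, φ r ≤ 1) → φ s < 1 := fun s hs hs1 => by
    refine lt_of_le_of_lt (le_mul_exp_of_le_add_integral
      (hφ.mono (Icc_subset_Icc_right hs.2)) hL (fun r hr => h r ⟨hr.1, hr.2.trans hs.2⟩
        fun q hq => hs1 q ⟨hq.1, hq.2.trans hr.2⟩) s ⟨hs.1, le_rfl⟩) (lt_of_le_of_lt ?_ hsmall)
    gcongr
    exact hs.2
  have hlt : ∀ s ∈ Icc a b, φ s < 1 := by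
    by_contra! hcon
    obtain ⟨s₁, hs₁, h1⟩ := hcon
    have hφa1 : φ a < 1 := by
      have := hs₁.1.trans hs₁.2
      have h2 : 1 ≤ Real.exp (L * (b - a)) :=
        Real.one_le_exp (mul_nonneg hL (sub_nonneg.2 this))
      nlinarith
    -- the first time at which the value one is attained
    have hZ : IsCompact {s ∈ Icc a b | φ s = 1} :=
      isCompact_Icc.of_isClosed_subset
        (hφ.preimage_isClosed_of_isClosed isClosed_Icc isClosed_singleton) fun s hs => hs.1
    have hivt : ∀ σ ∈ Icc a b, 1 ≤ φ σ → ∃ s ∈ Icc a σ, φ s = 1 := fun σ hσ hσ1 =>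
      intermediate_value_Icc hσ.1 (hφ.mono (Icc_subset_Icc_right hσ.2)) ⟨hφa1.le, hσ1⟩
    obtain ⟨s₂, hs₂, h2⟩ := hivt s₁ hs₁ h1
    obtain ⟨s₀, hs₀, hmin⟩ := hZ.exists_isLeast ⟨s₂, ⟨hs₂.1, hs₂.2.trans hs₁.2⟩, h2⟩
    refine (key s₀ hs₀.1 fun r hr => ?_).ne hs₀.2
    by_contra! hr1
    obtain ⟨q, hq, hq1⟩ := hivt r ⟨hr.1, hr.2.trans hs₀.1.2⟩ hr1.le
    have hle : s₀ ≤ q := hmin ⟨⟨hq.1, hq.2.trans (hr.2.trans hs₀.1.2)⟩, hq1⟩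
    have : r = s₀ := le_antisymm hr.2 (hle.trans hq.2)
    rw [this, hs₀.2] at hr1
    exact lt_irrefl _ hr1
  exact le_mul_exp_of_le_add_integral hφ hL fun s hs => h s hs fun r hr =>
    (hlt r ⟨hr.1, hr.2.trans hs.2⟩).le

/-- A bounded function which is dominated by a multiple of its integral up to a fixed final time
is almost everywhere nonpositive. -/
theorem ae_nonpos_of_le_mul_integral {a b C : ℝ} (hC : 0 ≤ C) {e : ℝ → ℝ}
    (he : IntervalIntegrable e volume a b)
    (h : ∀ᵐ t ∂volume.restrict (Icc a b), e t ≤ C * ∫ s in t..b, e s) :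
    ∀ᵐ t ∂volume.restrict (Icc a b), e t ≤ 0 := by
  rcases lt_or_ge b a with hba | hab
  · simp [Icc_eq_empty hba.not_ge]
  set G : ℝ → ℝ := fun t => ∫ s in t..b, e s with hG
  have hGc : ContinuousOn G (Icc a b) := by
    have := intervalIntegral.continuousOn_primitive_interval_left (f := e) (μ := volume)
      (a := a) (b := b) (by
        rw [uIcc_of_le hab]
        exact (intervalIntegrable_iff_integrableOn_Icc_of_le hab).1 he)
    rwa [uIcc_of_le hab] at this
  have hGle : ∀ t ∈ Icc a b, G t ≤ C * ∫ s in t..b, G s := fun t ht => by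
    rw [← intervalIntegral.integral_const_mul]
    refine intervalIntegral.integral_mono_ae_restrict ht.2 (he.mono_set ?_) ?_ ?_
    · rw [uIcc_of_le ht.2, uIcc_of_le hab]
      exact Icc_subset_Icc_left ht.1
    · refine ContinuousOn.intervalIntegrable (continuousOn_const.mul (hGc.mono ?_))
      rw [uIcc_of_le ht.2]
      exact Icc_subset_Icc_left ht.1
    · exact ae_restrict_of_ae_restrict_of_subset (Icc_subset_Icc_left ht.1) h
  have hG0 : ∀ t ∈ Icc a b, G t ≤ 0 := fun t ht => by
    have hrefl : ContinuousOn (fun s => G (a + b - s)) (Icc a b) :=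
      hGc.comp (by fun_prop) fun s hs => ⟨by linarith [hs.2], by linarith [hs.1]⟩
    have := le_mul_exp_of_le_add_integral (c := 0) hrefl hC (fun s hs => by
      have h1 := hGle (a + b - s) ⟨by linarith [hs.2], by linarith [hs.1]⟩
      rw [zero_add, intervalIntegral.integral_comp_sub_left (fun s => G s) (a + b)]
      simpa using h1) (a + b - t) ⟨by linarith [ht.2], by linarith [ht.1]⟩
    simpa using this
  filter_upwards [h, ae_restrict_mem measurableSet_Icc] with t ht htm
  exact ht.trans (mul_nonpos_of_nonneg_of_nonpos hC (hG0 t htm))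

end Gronwall

/-! ### Carathéodory fields and their trajectories -/

section Field

variable {E F : Type*} [NormedAddCommGroup E] [NormedSpace ℝ E] [MeasurableSpace E]
  [NormedAddCommGroup F] [NormedSpace ℝ F]

/-- A time dependent field which is measurable, and which is bounded and Lipschitz on every ball,
uniformly in time. -/
structure IsCaratheodory (v : ℝ → E → F) : Prop where
  stronglyMeasurable : StronglyMeasurable fun q : ℝ × E => v q.1 q.2
  bound : ∀ R : ℝ, ∃ L : NNReal, (∀ t, LipschitzOnWith L (v t) (closedBall 0 R)) ∧
    ∀ t, ∀ x ∈ closedBall (0 : E) R, ‖v t x‖ ≤ L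

/-- `x` is a trajectory on `[t, T]` of the field `v` issuing from `y`, in integrated form. -/
def IsTrajectory (T : ℝ) (v : ℝ → E → E) (t : ℝ) (y : E) (x : ℝ → E) : Prop :=
  ContinuousOn x (Icc t T) ∧ ∀ s ∈ Icc t T, x s = y + ∫ r in t..s, v r (x r)

variable [BorelSpace E] [FiniteDimensional ℝ E]

theorem IsCaratheodory.locallyLipschitz {v : ℝ → E → F} (hv : IsCaratheodory v) (t : ℝ) :
    LocallyLipschitz (v t) := fun x => by
  obtain ⟨L, hL, -⟩ := hv.bound (‖x‖ + 1)
  exact ⟨L, _, Filter.mem_of_superset (isOpen_ball.mem_nhds (by simp)) ball_subset_closedBall,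
    hL t⟩

theorem IsCaratheodory.aestronglyMeasurable_comp {v : ℝ → E → F} (hv : IsCaratheodory v)
    {a b : ℝ} {x : ℝ → E} (hx : ContinuousOn x (Icc a b)) :
    AEStronglyMeasurable (fun r => v r (x r)) (volume.restrict (Icc a b)) := by
  have h1 : AEMeasurable (fun r => (r, x r)) (volume.restrict (Icc a b)) :=
    aemeasurable_id.prodMk (hx.aemeasurable measurableSet_Icc)
  exact hv.stronglyMeasurable.aestronglyMeasurable.comp_aemeasurable h1

theorem IsCaratheodory.intervalIntegrable_comp {v : ℝ → E → F} (hv : IsCaratheodory v)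
    {a b : ℝ} (hab : a ≤ b) {x : ℝ → E} (hx : ContinuousOn x (Icc a b)) :
    IntervalIntegrable (fun r => v r (x r)) volume a b := by
  rw [intervalIntegrable_iff_integrableOn_Icc_of_le hab]
  obtain ⟨R, hR⟩ := isCompact_Icc.exists_bound_of_continuousOn hx
  obtain ⟨L, -, hL⟩ := hv.bound R
  exact Integrable.of_bound (hv.aestronglyMeasurable_comp hx) L
    ((ae_restrict_iff' measurableSet_Icc).2
      (.of_forall fun r hr => hL r _ (by simpa using hR r hr)))

/-- The Lipschitz estimate on which the Gronwall arguments for trajectories rest. -/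
theorem IsCaratheodory.norm_integral_sub_le {v : ℝ → E → F} (hv : IsCaratheodory v) {a b R : ℝ}
    {L : NNReal} (hL : ∀ t, LipschitzOnWith L (v t) (closedBall 0 R)) (hab : a ≤ b)
    {x z : ℝ → E} (hx : ContinuousOn x (Icc a b)) (hz : ContinuousOn z (Icc a b))
    (hxR : ∀ r ∈ Icc a b, ‖x r‖ ≤ R) (hzR : ∀ r ∈ Icc a b, ‖z r‖ ≤ R) :
    ‖(∫ r in a..b, v r (x r)) - ∫ r in a..b, v r (z r)‖ ≤ L * ∫ r in a..b, ‖x r - z r‖ := by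
  rw [← intervalIntegral.integral_sub (hv.intervalIntegrable_comp hab hx)
    (hv.intervalIntegrable_comp hab hz), ← intervalIntegral.integral_const_mul]
  have hc : ContinuousOn (fun r => (L : ℝ) * ‖x r - z r‖) (uIcc a b) := by
    rw [uIcc_of_le hab]
    exact continuousOn_const.mul (hx.sub hz).norm
  refine intervalIntegral.norm_integral_le_of_norm_le hab (.of_forall fun r hr => ?_)
    hc.intervalIntegrable
  have hr' : r ∈ Icc a b := ⟨hr.1.le, hr.2⟩
  rw [← dist_eq_norm, ← dist_eq_norm]
  exact (hL r).dist_le_mul _ (by simpa using hxR r hr') _ (by simpa using hzR r hr')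

/-- A trajectory stays close to a given approximate trajectory. -/
theorem IsTrajectory.norm_sub_le {v : ℝ → E → E} (hv : IsCaratheodory v) {T t R c : ℝ} {y : E}
    {L : NNReal} (hL : ∀ t, LipschitzOnWith L (v t) (closedBall 0 (R + 1)))
    {z x₀ : ℝ → E} (hz : IsTrajectory T v t y z) (hx : ContinuousOn x₀ (Icc t T))
    (hxR : ∀ r ∈ Icc t T, ‖x₀ r‖ ≤ R) (htT : t ≤ T)
    (herr : ∀ s ∈ Icc t T, ‖y - x₀ s + ∫ r in t..s, v r (x₀ r)‖ ≤ c)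
    (hc : c * Real.exp (L * (T - t)) < 1) :
    ∀ s ∈ Icc t T, ‖z s - x₀ s‖ ≤ c * Real.exp (L * (s - t)) := by
  have hc0 : 0 ≤ c := (norm_nonneg _).trans (herr t ⟨le_rfl, htT⟩)
  have hzt : z t = y := by simpa using hz.2 t ⟨le_rfl, htT⟩
  refine le_mul_exp_of_le_add_integral_of_le_one (hz.1.sub hx).norm L.coe_nonneg hc0 ?_ hc ?_
  · have := herr t ⟨le_rfl, htT⟩
    rw [hzt]
    simpa using this
  · intro s hs hs1
    have hsub : Icc t s ⊆ Icc t T := Icc_subset_Icc_right hs.2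
    have h1 := hv.norm_integral_sub_le hL hs.1 (hz.1.mono hsub) (hx.mono hsub)
      (fun r hr => by
        have h2 := hs1 r hr
        have h3 := hxR r (hsub hr)
        have h4 := norm_sub_norm_le (z r) (x₀ r)
        linarith) (fun r hr => (hxR r (hsub hr)).trans (by linarith))
    calc ‖z s - x₀ s‖ = ‖(y - x₀ s + ∫ r in t..s, v r (x₀ r))
          + ((∫ r in t..s, v r (z r)) - ∫ r in t..s, v r (x₀ r))‖ := by
          rw [hz.2 s hs]; congr 1; abel
      _ ≤ c + L * ∫ r in t..s, ‖z r - x₀ r‖ := (norm_add_le _ _).trans (add_le_add (herr s hs) h1)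

/-- Two trajectories that stay in a ball diverge at most exponentially. -/
theorem IsTrajectory.norm_sub_le_of_mem_ball {v : ℝ → E → E} (hv : IsCaratheodory v)
    {T t R : ℝ} {y₁ y₂ : E} {L : NNReal} (hL : ∀ t, LipschitzOnWith L (v t) (closedBall 0 R))
    {z₁ z₂ : ℝ → E} (hz₁ : IsTrajectory T v t y₁ z₁) (hz₂ : IsTrajectory T v t y₂ z₂)
    (h₁ : ∀ s ∈ Icc t T, ‖z₁ s‖ ≤ R) (h₂ : ∀ s ∈ Icc t T, ‖z₂ s‖ ≤ R) :
    ∀ s ∈ Icc t T, ‖z₁ s - z₂ s‖ ≤ ‖y₁ - y₂‖ * Real.exp (L * (s - t)) := by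
  refine le_mul_exp_of_le_add_integral (hz₁.1.sub hz₂.1).norm L.coe_nonneg fun s hs => ?_
  have hsub : Icc t s ⊆ Icc t T := Icc_subset_Icc_right hs.2
  have h := hv.norm_integral_sub_le hL hs.1 (hz₁.1.mono hsub) (hz₂.1.mono hsub)
    (fun r hr => h₁ r (hsub hr)) (fun r hr => h₂ r (hsub hr))
  calc ‖z₁ s - z₂ s‖ = ‖(y₁ - y₂) + ((∫ r in t..s, v r (z₁ r)) - ∫ r in t..s, v r (z₂ r))‖ := by
        rw [hz₁.2 s hs, hz₂.2 s hs]; congr 1; abel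
    _ ≤ _ := (norm_add_le _ _).trans (add_le_add le_rfl h)

/-- Trajectories with the same initial data are unique. -/
theorem IsTrajectory.eqOn {v : ℝ → E → E} (hv : IsCaratheodory v) {T t : ℝ} {y : E}
    {z₁ z₂ : ℝ → E} (hz₁ : IsTrajectory T v t y z₁) (hz₂ : IsTrajectory T v t y z₂) :
    EqOn z₁ z₂ (Icc t T) := fun s hs => by
  obtain ⟨R₁, hR₁⟩ := isCompact_Icc.exists_bound_of_continuousOn hz₁.1
  obtain ⟨R₂, hR₂⟩ := isCompact_Icc.exists_bound_of_continuousOn hz₂.1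
  obtain ⟨L, hL, -⟩ := hv.bound (max R₁ R₂)
  have := hz₁.norm_sub_le_of_mem_ball hv hL hz₂ (fun s hs => (hR₁ s hs).trans (le_max_left _ _))
    (fun s hs => (hR₂ s hs).trans (le_max_right _ _)) s hs
  rw [sub_self, norm_zero, zero_mul] at this
  exact sub_eq_zero.1 (norm_le_zero_iff.1 this)

theorem IsTrajectory.apply_self {v : ℝ → E → E} {T t : ℝ} {y : E} {z : ℝ → E} (htT : t ≤ T)
    (hz : IsTrajectory T v t y z) : z t = y := by
  simpa using hz.2 t ⟨le_rfl, htT⟩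

/-- The dynamic programming property: a trajectory, started anew at a later time from its current
position, follows itself. -/
theorem IsTrajectory.restart {v : ℝ → E → E} (hv : IsCaratheodory v) {T t s : ℝ} {y : E}
    {z : ℝ → E} (hz : IsTrajectory T v t y z) (hs : s ∈ Icc t T) :
    IsTrajectory T v s (z s) z := by
  refine ⟨hz.1.mono (Icc_subset_Icc_left hs.1), fun r hr => ?_⟩
  have hr' : r ∈ Icc t T := ⟨hs.1.trans hr.1, hr.2⟩
  rw [hz.2 r hr', hz.2 s hs, add_assoc, intervalIntegral.integral_add_adjacent_intervals]
  · exact hv.intervalIntegrable_comp hs.1 (hz.1.mono (Icc_subset_Icc_right hs.2))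
  · exact hv.intervalIntegrable_comp hr.1 (hz.1.mono (Icc_subset_Icc hs.1 hr.2))

/-- The speed of a trajectory is bounded by the bound of the field. -/
theorem IsTrajectory.norm_sub_le_mul {v : ℝ → E → E} (hv : IsCaratheodory v) {T t R : ℝ} {y : E}
    {L : NNReal} (hL : ∀ t, ∀ x ∈ closedBall (0 : E) R, ‖v t x‖ ≤ L) {z : ℝ → E}
    (hz : IsTrajectory T v t y z) (hzR : ∀ s ∈ Icc t T, ‖z s‖ ≤ R) {r s : ℝ}
    (hr : r ∈ Icc t T) (hs : s ∈ Icc r T) : ‖z s - z r‖ ≤ L * (s - r) := by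
  have h := (hz.restart hv hr).2 s hs
  rw [h, add_sub_cancel_left]
  refine (intervalIntegral.norm_integral_le_of_norm_le_const (C := L) fun q hq => ?_).trans_eq ?_
  · rw [uIoc_of_le hs.1] at hq
    exact hL q _ (by simpa using hzR q ⟨hr.1.trans hq.1.le, hq.2.trans hs.2⟩)
  · rw [abs_of_nonneg (sub_nonneg.2 hs.1)]

end Field

/-! ### The value function -/

section Value

variable {N : ℕ} {T : ℝ} {v : ℝ → Vec N → Vec N} {l : ℝ → Vec N → ℝ} {g : Vec N → ℝ}
  {X : ℝ → Vec N → ℝ → Vec N}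

/-- The cost of the trajectory `X t y`, as a function of the initial data `(t, y)`. If
`X t y` is an optimal state from `(t, y)`, this is the value function of the control problem. -/
noncomputable def valueFn (T : ℝ) (l : ℝ → Vec N → ℝ) (g : Vec N → ℝ) (X : ℝ → Vec N → ℝ → Vec N)
    (t : ℝ) (y : Vec N) : ℝ :=
  (∫ s in t..T, l s (X t y s)) + g (X t y T)

/-- The value along a trajectory decreases by the running cost. -/
theorem valueFn_eq (hv : IsCaratheodory v) (hl : IsCaratheodory l)
    (hX : ∀ t ∈ Icc 0 T, ∀ y, IsTrajectory T v t y (X t y)) {t s : ℝ} (ht : t ∈ Icc 0 T)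
    (hs : s ∈ Icc t T) (y : Vec N) :
    valueFn T l g X t y = (∫ r in t..s, l r (X t y r)) + valueFn T l g X s (X t y s) := by
  have heq : EqOn (X t y) (X s (X t y s)) (Icc s T) :=
    ((hX t ht y).restart hv hs).eqOn hv (hX s ⟨ht.1.trans hs.1, hs.2⟩ _)
  rw [valueFn, valueFn, ← heq ⟨hs.2, le_rfl⟩, ← add_assoc]
  congr 1
  rw [← intervalIntegral.integral_add_adjacent_intervals
    (hl.intervalIntegrable_comp hs.1 ((hX t ht y).1.mono (Icc_subset_Icc_right hs.2)))
    (hl.intervalIntegrable_comp hs.2 ((hX t ht y).1.mono (Icc_subset_Icc_left hs.1)))]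
  congr 1
  refine intervalIntegral.integral_congr fun r hr => ?_
  rw [uIcc_of_le hs.2] at hr
  simp only [heq hr]

/-- All trajectories issuing from initial data near `(t₀, y₀)` stay in a common ball. -/
theorem exists_ball_of_trajectories (hv : IsCaratheodory v)
    (hX : ∀ t ∈ Icc 0 T, ∀ y, IsTrajectory T v t y (X t y)) {t₀ : ℝ} (ht₀ : t₀ ∈ Icc 0 T)
    (y₀ : Vec N) : ∃ R : ℝ, ∃ δ > 0, ∀ t ∈ Icc 0 T, ∀ y, |t - t₀| < δ → ‖y - y₀‖ < δ →
      ∀ s ∈ Icc t T, ‖X t y s‖ ≤ R := by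
  -- the reference trajectory is extended by a constant to times before `t₀`
  set x₀ : ℝ → Vec N := fun s => X t₀ y₀ (max t₀ s) with hx₀
  have hX₀ := hX t₀ ht₀ y₀
  have hmaps : MapsTo (fun s => max t₀ s) (Icc 0 T) (Icc t₀ T) := fun s hs =>
    ⟨le_max_left _ _, max_le ht₀.2 hs.2⟩
  have hxc : ContinuousOn x₀ (Icc 0 T) := hX₀.1.comp (by fun_prop) hmaps
  obtain ⟨R, hR⟩ := isCompact_Icc.exists_bound_of_continuousOn hxc
  obtain ⟨L, hL, hLb⟩ := hv.bound (R + 1)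
  have hX₀R : ∀ s ∈ Icc t₀ T, ‖X t₀ y₀ s‖ ≤ R + 1 := fun s hs => by
    have := hR s ⟨ht₀.1.trans hs.1, hs.2⟩
    simp only [hx₀, max_eq_right hs.1] at this
    linarith
  have hx₀t : X t₀ y₀ t₀ = y₀ := hX₀.apply_self ht₀.2
  set δ : ℝ := (2 * (1 + L) * Real.exp (L * T))⁻¹ with hδ
  have hexp := Real.exp_pos (L * T)
  have hδ0 : 0 < δ := by positivity
  refine ⟨R + 1, δ, hδ0, fun t ht y hty hyy s hs => ?_⟩
  have hsub : Icc t T ⊆ Icc 0 T := Icc_subset_Icc_left ht.1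
  have hxint : ∀ a ∈ Icc 0 T, ∀ b ∈ Icc a T,
      IntervalIntegrable (fun r => v r (x₀ r)) volume a b := fun a ha b hb =>
    hv.intervalIntegrable_comp hb.1 (hxc.mono (Icc_subset_Icc ha.1 hb.2))
  have hint : ∀ b ∈ Icc t₀ T, x₀ b = y₀ + ∫ r in t₀..b, v r (x₀ r) := fun b hb => by
    simp only [hx₀, max_eq_right hb.1]
    rw [hX₀.2 b hb]
    congr 1
    refine intervalIntegral.integral_congr fun r hr => ?_
    rw [uIcc_of_le hb.1] at hr
    simp only [max_eq_right hr.1]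
  have hvx : ∀ r ∈ Icc 0 T, ‖v r (x₀ r)‖ ≤ L := fun r hr =>
    hLb r _ (by simpa using (hR r hr).trans (by linarith))
  have hvi : ∀ a ∈ Icc 0 T, ∀ b ∈ Icc a T, ‖∫ r in a..b, v r (x₀ r)‖ ≤ L * |b - a| :=
    fun a ha b hb => intervalIntegral.norm_integral_le_of_norm_le_const fun r hr => by
      rw [uIoc_of_le hb.1] at hr
      exact hvx r ⟨ha.1.trans hr.1.le, hr.2.trans hb.2⟩
  -- the extended trajectory is an approximate trajectory
  have herr : ∀ s ∈ Icc t T, ‖y - x₀ s + ∫ r in t..s, v r (x₀ r)‖ ≤ (1 + L) * δ := fun s hs => by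
    have hfin : ‖y - y₀‖ + L * |t - t₀| ≤ (1 + L) * δ := by
      have := mul_le_mul_of_nonneg_left hty.le L.coe_nonneg
      linarith
    refine le_trans ?_ hfin
    rcases le_total t₀ t with h | h
    · have e : y - x₀ s + ∫ r in t..s, v r (x₀ r) = (y - y₀) - ∫ r in t₀..t, v r (x₀ r) := by
        rw [hint s ⟨h.trans hs.1, hs.2⟩, ← intervalIntegral.integral_add_adjacent_intervals
          (hxint t₀ ht₀ t ⟨h, ht.2⟩) (hxint t ht s hs)]
        abel
      rw [e]
      exact (norm_sub_le _ _).trans (add_le_add le_rfl (hvi t₀ ht₀ t ⟨h, ht.2⟩))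
    · rcases le_total s t₀ with h' | h'
      · have e : x₀ s = y₀ := by simp only [hx₀, max_eq_left h', hx₀t]
        rw [e]
        refine (norm_add_le _ _).trans (add_le_add le_rfl ((hvi t ht s hs).trans ?_))
        refine mul_le_mul_of_nonneg_left ?_ L.coe_nonneg
        rw [abs_of_nonneg (sub_nonneg.2 hs.1), abs_sub_comm, abs_of_nonneg (sub_nonneg.2 h)]
        linarith
      · have e : y - x₀ s + ∫ r in t..s, v r (x₀ r) = (y - y₀) + ∫ r in t..t₀, v r (x₀ r) := by
          rw [hint s ⟨h', hs.2⟩, ← intervalIntegral.integral_add_adjacent_intervals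
            (hxint t ht t₀ ⟨h, ht₀.2⟩) (hxint t₀ ht₀ s ⟨h', hs.2⟩)]
          abel
        rw [e]
        refine (norm_add_le _ _).trans (add_le_add le_rfl ?_)
        rw [abs_sub_comm]
        exact hvi t ht t₀ ⟨h, ht₀.2⟩
  have hsmall : (1 + L) * δ * Real.exp (L * (T - t)) < 1 := by
    have h1 : Real.exp (L * (T - t)) ≤ Real.exp (L * T) := by
      gcongr
      linarith [ht.1]
    calc (1 + L) * δ * Real.exp (L * (T - t)) ≤ (1 + L) * δ * Real.exp (L * T) := by gcongr
      _ = 1 / 2 := by rw [hδ]; field_simp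
      _ < 1 := by norm_num
  have h1 := (hX t ht y).norm_sub_le hv hL (hxc.mono hsub) (fun r hr => hR r (hsub hr)) ht.2
    herr hsmall s hs
  have h2 : ‖X t y s - x₀ s‖ ≤ 1 := by
    refine h1.trans (le_trans ?_ hsmall.le)
    gcongr
    exact hs.2
  have h3 := hR s (hsub hs)
  have h4 := norm_sub_norm_le (X t y s) (x₀ s)
  linarith

/-- The value function is locally Lipschitz. -/
theorem exists_lipschitz_valueFn (hv : IsCaratheodory v) (hl : IsCaratheodory l)
    (hg : LocallyLipschitz g) (hX : ∀ t ∈ Icc 0 T, ∀ y, IsTrajectory T v t y (X t y))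
    {t₀ : ℝ} (ht₀ : t₀ ∈ Icc 0 T) (y₀ : Vec N) :
    ∃ C : ℝ, ∃ δ > 0, 0 ≤ C ∧ ∀ t₁ ∈ Icc 0 T, ∀ t₂ ∈ Icc 0 T, ∀ y₁ y₂, |t₁ - t₀| < δ →
      |t₂ - t₀| < δ → ‖y₁ - y₀‖ < δ → ‖y₂ - y₀‖ < δ →
      |valueFn T l g X t₁ y₁ - valueFn T l g X t₂ y₂| ≤ C * (|t₁ - t₂| + ‖y₁ - y₂‖) := by
  obtain ⟨R, δ, hδ, hR⟩ := exists_ball_of_trajectories hv hX ht₀ y₀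
  obtain ⟨L, hL, hLb⟩ := hv.bound R
  obtain ⟨M, hM, hMb⟩ := hl.bound R
  obtain ⟨Cg, hCg⟩ := hg.exists_lipschitzOnWith_closedBall R
  set C₁ : ℝ := (M * T + Cg) * Real.exp (L * T) with hC₁
  have hT : 0 ≤ T := ht₀.1.trans ht₀.2
  have hC₁0 : 0 ≤ C₁ := by positivity
  -- equal initial times
  have hA : ∀ t ∈ Icc 0 T, ∀ y₁ y₂, |t - t₀| < δ → ‖y₁ - y₀‖ < δ → ‖y₂ - y₀‖ < δ →
      |valueFn T l g X t y₁ - valueFn T l g X t y₂| ≤ C₁ * ‖y₁ - y₂‖ :=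
    fun t ht y₁ y₂ htt h₁ h₂ => by
      have hR₁ := hR t ht y₁ htt h₁
      have hR₂ := hR t ht y₂ htt h₂
      have hX₁ := hX t ht y₁
      have hX₂ := hX t ht y₂
      have hdist : ∀ s ∈ Icc t T, ‖X t y₁ s - X t y₂ s‖ ≤ ‖y₁ - y₂‖ * Real.exp (L * T) :=
        fun s hs => (hX₁.norm_sub_le_of_mem_ball hv hL hX₂ hR₁ hR₂ s hs).trans (by
          gcongr
          linarith [hs.1, hs.2, ht.1])
      have hTm : T ∈ Icc t T := ⟨ht.2, le_rfl⟩
      have h1 := hl.norm_integral_sub_le hM ht.2 hX₁.1 hX₂.1 hR₁ hR₂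
      have h2 : ∫ r in t..T, ‖X t y₁ r - X t y₂ r‖ ≤ T * (‖y₁ - y₂‖ * Real.exp (L * T)) := by
        have h3 := intervalIntegral.norm_integral_le_of_norm_le_const
          (f := fun r => ‖X t y₁ r - X t y₂ r‖) (a := t) (b := T)
          (C := ‖y₁ - y₂‖ * Real.exp (L * T)) fun r hr => by
            rw [uIoc_of_le ht.2] at hr
            rw [norm_norm]
            exact hdist r ⟨hr.1.le, hr.2⟩
        refine (le_abs_self _).trans (h3.trans ?_)
        rw [abs_of_nonneg (sub_nonneg.2 ht.2), mul_comm]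
        gcongr
        linarith [ht.1]
      have h4 : ‖g (X t y₁ T) - g (X t y₂ T)‖ ≤ Cg * (‖y₁ - y₂‖ * Real.exp (L * T)) := by
        have := hCg.dist_le_mul _ (by simpa using hR₁ T hTm) _ (by simpa using hR₂ T hTm)
        rw [dist_eq_norm, dist_eq_norm] at this
        exact this.trans (by gcongr; exact hdist T hTm)
      calc |valueFn T l g X t y₁ - valueFn T l g X t y₂|
          = ‖((∫ s in t..T, l s (X t y₁ s)) - ∫ s in t..T, l s (X t y₂ s))
            + (g (X t y₁ T) - g (X t y₂ T))‖ := by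
            rw [valueFn, valueFn, Real.norm_eq_abs]; congr 1; ring
        _ ≤ M * (T * (‖y₁ - y₂‖ * Real.exp (L * T))) + Cg * (‖y₁ - y₂‖ * Real.exp (L * T)) :=
            (norm_add_le _ _).trans (add_le_add (h1.trans (by gcongr)) h4)
        _ = C₁ * ‖y₁ - y₂‖ := by rw [hC₁]; ring
  set δ' : ℝ := δ / (1 + 2 * L) with hδ'
  have hδ'0 : 0 < δ' := by positivity
  have hδ'δ : (1 + 2 * L) * δ' = δ := by rw [hδ']; field_simp
  have hδ'le : δ' ≤ δ := by
    rw [← hδ'δ]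
    nlinarith [L.coe_nonneg]
  -- equal initial states
  have hB : ∀ t₁ ∈ Icc 0 T, ∀ t₂ ∈ Icc t₁ T, ∀ y, |t₁ - t₀| < δ' → |t₂ - t₀| < δ' →
      ‖y - y₀‖ < δ' → |valueFn T l g X t₁ y - valueFn T l g X t₂ y|
        ≤ (M + C₁ * L) * |t₁ - t₂| := fun t₁ ht₁ t₂ ht₂ y h₁ h₂ hy => by
    have hX₁ := hX t₁ ht₁ y
    have hR₁ := hR t₁ ht₁ y (h₁.trans_le hδ'le) (hy.trans_le hδ'le)
    have habs : |t₁ - t₂| = t₂ - t₁ := by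
      rw [abs_sub_comm, abs_of_nonneg (sub_nonneg.2 ht₂.1)]
    have hmove : ‖X t₁ y t₂ - y‖ ≤ L * (t₂ - t₁) := by
      have := hX₁.norm_sub_le_mul hv hLb hR₁ ⟨le_rfl, ht₁.2⟩ ht₂
      rwa [hX₁.apply_self ht₁.2] at this
    have hnear : ‖X t₁ y t₂ - y₀‖ < δ := by
      have h3 : t₂ - t₁ ≤ 2 * δ' := by
        have := abs_lt.1 h₁
        have := abs_lt.1 h₂
        linarith
      have h4 := mul_le_mul_of_nonneg_left h3 L.coe_nonneg
      have h5 := norm_sub_le_norm_sub_add_norm_sub (X t₁ y t₂) y y₀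
      linarith
    have ht₂' : t₂ ∈ Icc 0 T := ⟨ht₁.1.trans ht₂.1, ht₂.2⟩
    have h6 := hA t₂ ht₂' _ _ (h₂.trans_le hδ'le) hnear (hy.trans_le hδ'le)
    have h7 : ‖∫ r in t₁..t₂, l r (X t₁ y r)‖ ≤ M * |t₂ - t₁| :=
      intervalIntegral.norm_integral_le_of_norm_le_const fun r hr => by
        rw [uIoc_of_le ht₂.1] at hr
        exact hMb r _ (by simpa using hR₁ r ⟨hr.1.le, hr.2.trans ht₂.2⟩)
    rw [valueFn_eq hv hl hX ht₁ ht₂ y, add_sub_assoc]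
    refine (abs_add_le _ _).trans ?_
    rw [abs_sub_comm t₂ t₁] at h7
    have h8 := mul_le_mul_of_nonneg_left hmove hC₁0
    rw [Real.norm_eq_abs] at h7
    rw [habs] at h7 ⊢
    linarith
  refine ⟨M + C₁ * L + C₁, δ', hδ'0, by positivity, fun t₁ ht₁ t₂ ht₂ y₁ y₂ h₁ h₂ hy₁ hy₂ => ?_⟩
  have h1 := hA t₁ ht₁ y₁ y₂ (h₁.trans_le hδ'le) (hy₁.trans_le hδ'le) (hy₂.trans_le hδ'le)
  have h2 : |valueFn T l g X t₁ y₂ - valueFn T l g X t₂ y₂| ≤ (M + C₁ * L) * |t₁ - t₂| := by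
    rcases le_total t₁ t₂ with h | h
    · exact hB t₁ ht₁ t₂ ⟨h, ht₂.2⟩ y₂ h₁ h₂ hy₂
    · rw [abs_sub_comm, abs_sub_comm t₁]
      exact hB t₂ ht₂ t₁ ⟨h, ht₁.2⟩ y₂ h₂ h₁ hy₂
  have h3 := abs_sub_le (valueFn T l g X t₁ y₁) (valueFn T l g X t₁ y₂) (valueFn T l g X t₂ y₂)
  have h4 : 0 ≤ (M + C₁ * L) * ‖y₁ - y₂‖ := by positivity
  have h5 : 0 ≤ C₁ * |t₁ - t₂| := by positivity
  linarith

/-- The value function, extended to all times by its boundary values. -/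
noncomputable def extValue (T : ℝ) (l : ℝ → Vec N → ℝ) (g : Vec N → ℝ)
    (X : ℝ → Vec N → ℝ → Vec N) (q : ℝ × Vec N) : ℝ :=
  valueFn T l g X (max 0 (min T q.1)) q.2

theorem extValue_of_mem {t : ℝ} (ht : t ∈ Icc 0 T) (y : Vec N) :
    extValue T l g X (t, y) = valueFn T l g X t y := by
  simp [extValue, ht.1, ht.2]

theorem locallyLipschitz_extValue (hT : 0 ≤ T) (hv : IsCaratheodory v) (hl : IsCaratheodory l)
    (hg : LocallyLipschitz g) (hX : ∀ t ∈ Icc 0 T, ∀ y, IsTrajectory T v t y (X t y)) :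
    LocallyLipschitz (extValue T l g X) := by
  set c : ℝ → ℝ := fun t => max 0 (min T t) with hc
  have hcm : ∀ t, c t ∈ Icc 0 T := fun t => ⟨le_max_left _ _, max_le hT (min_le_left _ _)⟩
  have hcl : ∀ s t, |c s - c t| ≤ |s - t| := fun s t =>
    (abs_max_sub_max_le_max 0 (min T s) 0 (min T t)).trans
      (by simpa using (abs_min_sub_min_le_max T s T t).trans (by simp))
  rintro ⟨t₀, y₀⟩
  obtain ⟨C, δ, hδ, hC, h⟩ := exists_lipschitz_valueFn hv hl hg hX (hcm t₀) y₀
  refine ⟨⟨2 * C, by positivity⟩, ball (t₀, y₀) δ, ball_mem_nhds _ hδ,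
    LipschitzOnWith.of_dist_le_mul ?_⟩
  rintro ⟨t₁, y₁⟩ h₁ ⟨t₂, y₂⟩ h₂
  rw [mem_ball, Prod.dist_eq, max_lt_iff, Real.dist_eq, dist_eq_norm] at h₁ h₂
  have h3 := h _ (hcm t₁) _ (hcm t₂) y₁ y₂ ((hcl _ _).trans_lt h₁.1) ((hcl _ _).trans_lt h₂.1)
    h₁.2 h₂.2
  rw [Real.dist_eq]
  refine h3.trans ?_
  rw [Prod.dist_eq, Real.dist_eq, dist_eq_norm]
  have h4 := (hcl t₁ t₂).trans (le_max_left |t₁ - t₂| ‖y₁ - y₂‖)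
  have h5 := le_max_right |t₁ - t₂| ‖y₁ - y₂‖
  have h6 : C * (|c t₁ - c t₂| + ‖y₁ - y₂‖)
      ≤ C * (max |t₁ - t₂| ‖y₁ - y₂‖ + max |t₁ - t₂| ‖y₁ - y₂‖) := by gcongr
  refine h6.trans (le_of_eq ?_)
  change _ = 2 * C * max |t₁ - t₂| ‖y₁ - y₂‖
  ring

end Value

/-! ### Lebesgue points in time -/

section LebesguePoints

variable {E F : Type*} [NormedAddCommGroup E] [NormedSpace ℝ E] [MeasurableSpace E]
  [NormedAddCommGroup F] [NormedSpace ℝ F] [BorelSpace E] [FiniteDimensional ℝ E]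
  [CompleteSpace F]

theorem IsCaratheodory.intervalIntegrable_const {v : ℝ → E → F} (hv : IsCaratheodory v)
    (x : E) (a b : ℝ) : IntervalIntegrable (fun r => v r x) volume a b := by
  rcases le_total a b with h | h
  · exact hv.intervalIntegrable_comp h continuousOn_const
  · exact (hv.intervalIntegrable_comp h continuousOn_const).symm

/-- Almost every time is a Lebesgue point of `v(·, x)` simultaneously for all `x`: this holds for
`x` in a countable dense set, and extends by the Lipschitz continuity of the field. -/
theorem IsCaratheodory.ae_hasDerivAt_integral {v : ℝ → E → F} (hv : IsCaratheodory v) :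
    ∀ᵐ t, ∀ x, HasDerivAt (fun s => ∫ r in t..s, v r x) (v t x) t := by
  have hsep : TopologicalSpace.SeparableSpace E :=
    have : ProperSpace E := FiniteDimensional.proper ℝ E
    inferInstance
  have h : ∀ n, ∀ᵐ t, ∀ c, HasDerivAt (fun s => ∫ r in c..s,
      v r (TopologicalSpace.denseSeq E n)) (v t (TopologicalSpace.denseSeq E n)) t := fun n =>
    LocallyIntegrable.ae_hasDerivAt_integral <| by
      rw [locallyIntegrable_iff]
      intro k hk
      obtain ⟨a, ha⟩ := hk.bddBelow
      obtain ⟨b, hb⟩ := hk.bddAbove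
      rcases lt_or_ge b a with hba | hab
      · have : k = ∅ := by
          ext r
          simp only [mem_empty_iff_false, iff_false]
          exact fun hr => absurd ((ha hr).trans (hb hr)) hba.not_ge
        simp [this]
      · exact ((intervalIntegrable_iff_integrableOn_Icc_of_le hab).1
          (hv.intervalIntegrable_const _ a b)).mono_set fun r hr => ⟨ha hr, hb hr⟩
  filter_upwards [ae_all_iff.2 h] with t ht x
  obtain ⟨L, hL, -⟩ := hv.bound (‖x‖ + 1)
  rw [hasDerivAt_iff_isLittleO, Asymptotics.isLittleO_iff]
  intro ε hε
  set η : ℝ := min 1 (ε / (4 * (L + 1))) with hη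
  have hη0 : 0 < η := by positivity
  obtain ⟨n, hn⟩ := (TopologicalSpace.denseRange_denseSeq E).exists_dist_lt x hη0
  set d := TopologicalSpace.denseSeq E n
  have hd1 : d ∈ closedBall (0 : E) (‖x‖ + 1) := by
    rw [mem_closedBall_zero_iff]
    have h1 := norm_sub_norm_le d x
    rw [dist_comm, dist_eq_norm] at hn
    have := hn.trans_le (min_le_left _ _)
    linarith
  have hx1 : x ∈ closedBall (0 : E) (‖x‖ + 1) := by simp
  have hclose : ∀ r, ‖v r x - v r d‖ ≤ ε / 4 := fun r => by
    have h1 := (hL r).dist_le_mul x hx1 d hd1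
    rw [dist_eq_norm] at h1
    have h2 : dist x d ≤ ε / (4 * (L + 1)) := hn.le.trans (min_le_right _ _)
    calc ‖v r x - v r d‖ ≤ L * (ε / (4 * (L + 1))) := h1.trans (by gcongr)
      _ ≤ (L + 1) * (ε / (4 * (L + 1))) := by gcongr; linarith
      _ = ε / 4 := by field_simp
  have hder := ht n t
  rw [hasDerivAt_iff_isLittleO, Asymptotics.isLittleO_iff] at hder
  filter_upwards [hder (half_pos hε)] with s hs
  simp only [intervalIntegral.integral_same, sub_zero] at hs ⊢
  have hdiff : ‖∫ r in t..s, (v r x - v r d)‖ ≤ ε / 4 * |s - t| :=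
    intervalIntegral.norm_integral_le_of_norm_le_const fun r _ => hclose r
  rw [intervalIntegral.integral_sub (hv.intervalIntegrable_const x t s)
    (hv.intervalIntegrable_const d t s)] at hdiff
  calc ‖(∫ r in t..s, v r x) - (s - t) • v t x‖
      = ‖((∫ r in t..s, v r x) - ∫ r in t..s, v r d) + ((∫ r in t..s, v r d) - (s - t) • v t d)
          - (s - t) • (v t x - v t d)‖ := by
        congr 1; rw [smul_sub]; abel
    _ ≤ ε / 4 * |s - t| + ε / 2 * ‖s - t‖ + |s - t| * (ε / 4) := by
        refine (norm_sub_le _ _).trans (add_le_add ((norm_add_le _ _).trans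
          (add_le_add hdiff hs)) ?_)
        rw [norm_smul, Real.norm_eq_abs]
        gcongr
        exact hclose t
    _ = ε * ‖s - t‖ := by rw [Real.norm_eq_abs]; ring

/-- At a Lebesgue point of `v(·, z(t))`, the primitive of `v(·, z(·))` has the right derivative
`v(t, z(t))`. -/
theorem IsCaratheodory.hasDerivWithinAt_integral_comp {v : ℝ → E → F} (hv : IsCaratheodory v)
    {t T : ℝ} (htT : t < T) {z : ℝ → E} (hz : ContinuousOn z (Icc t T))
    (ht : HasDerivAt (fun s => ∫ r in t..s, v r (z t)) (v t (z t)) t) :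
    HasDerivWithinAt (fun s => ∫ r in t..s, v r (z r)) (v t (z t)) (Ici t) t := by
  obtain ⟨R, hR⟩ := isCompact_Icc.exists_bound_of_continuousOn hz
  obtain ⟨L, hL, -⟩ := hv.bound R
  have htm : t ∈ Icc t T := ⟨le_rfl, htT.le⟩
  have hder := ht.hasDerivWithinAt (s := Ici t)
  rw [hasDerivWithinAt_iff_isLittleO, Asymptotics.isLittleO_iff] at hder ⊢
  intro ε hε
  have hzt := Metric.continuousOn_iff.1 hz t htm (ε / (2 * (L + 1))) (by positivity)
  obtain ⟨δ, hδ, hzδ⟩ := hzt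
  have hT' : ∀ᶠ s in 𝓝[Ici t] t, s < T := nhdsWithin_le_nhds (Iio_mem_nhds htT)
  have hδ' : ∀ᶠ s in 𝓝[Ici t] t, s < t + δ := nhdsWithin_le_nhds (Iio_mem_nhds (by linarith))
  filter_upwards [hder (half_pos hε), hT', hδ', self_mem_nhdsWithin] with s hs hsT hsδ hst
  simp only [intervalIntegral.integral_same, sub_zero] at hs ⊢
  have hst' : t ≤ s := hst
  have hsub : Icc t s ⊆ Icc t T := Icc_subset_Icc_right hsT.le
  have hdiff : ‖∫ r in t..s, (v r (z r) - v r (z t))‖ ≤ ε / 2 * |s - t| := by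
    refine intervalIntegral.norm_integral_le_of_norm_le_const fun r hr => ?_
    rw [uIoc_of_le hst'] at hr
    have hrm : r ∈ Icc t T := hsub ⟨hr.1.le, hr.2⟩
    have h1 := (hL r).dist_le_mul (z r) (by simpa using hR r hrm) (z t) (by simpa using hR t htm)
    have h2 : dist (z r) (z t) < ε / (2 * (L + 1)) := hzδ r hrm (by
      rw [Real.dist_eq, abs_of_nonneg (by linarith [hr.1])]
      linarith [hr.2])
    rw [dist_eq_norm] at h1
    calc ‖v r (z r) - v r (z t)‖ ≤ L * (ε / (2 * (L + 1))) := h1.trans (by gcongr)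
      _ ≤ (L + 1) * (ε / (2 * (L + 1))) := by gcongr; linarith
      _ = ε / 2 := by field_simp
  rw [intervalIntegral.integral_sub (hv.intervalIntegrable_comp hst' (hz.mono hsub))
    (hv.intervalIntegrable_const _ t s)] at hdiff
  calc ‖(∫ r in t..s, v r (z r)) - (s - t) • v t (z t)‖
      = ‖((∫ r in t..s, v r (z r)) - ∫ r in t..s, v r (z t))
          + ((∫ r in t..s, v r (z t)) - (s - t) • v t (z t))‖ := by congr 1; abel
    _ ≤ ε / 2 * |s - t| + ε / 2 * ‖s - t‖ := (norm_add_le _ _).trans (add_le_add hdiff hs)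
    _ = ε * ‖s - t‖ := by rw [Real.norm_eq_abs]; ring

end LebesguePoints

/-! ### The Hamilton–Jacobi–Bellman equation -/

section HJB

variable {N m : ℕ} {T : ℝ}

/-- Along the closed loop trajectories the value function satisfies its transport equation. -/
theorem fderiv_extValue_apply_field {v : ℝ → Vec N → Vec N} {l : ℝ → Vec N → ℝ} {g : Vec N → ℝ}
    {X : ℝ → Vec N → ℝ → Vec N} (hv : IsCaratheodory v) (hl : IsCaratheodory l)
    (hX : ∀ t ∈ Icc 0 T, ∀ y, IsTrajectory T v t y (X t y)) {t : ℝ} {x : Vec N}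
    (ht : t ∈ Ioo 0 T) (hvt : HasDerivAt (fun s => ∫ r in t..s, v r x) (v t x) t)
    (hlt : HasDerivAt (fun s => ∫ r in t..s, l r x) (l t x) t)
    (hd : DifferentiableAt ℝ (extValue T l g X) (t, x)) :
    fderiv ℝ (extValue T l g X) (t, x) (1, v t x) + l t x = 0 := by
  have htm : t ∈ Icc 0 T := ⟨ht.1.le, ht.2.le⟩
  have hXt := hX t htm x
  have hx : X t x t = x := hXt.apply_self ht.2.le
  have h1 : HasDerivWithinAt (X t x) (v t x) (Ici t) t := by
    have := hv.hasDerivWithinAt_integral_comp ht.2 hXt.1 (by rwa [hx])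
    rw [hx] at this
    refine (this.const_add x).congr_of_eventuallyEq ?_ (by simp [hx])
    filter_upwards [nhdsWithin_le_nhds (Iio_mem_nhds ht.2), self_mem_nhdsWithin] with s hs hs'
    exact hXt.2 s ⟨hs', le_of_lt hs⟩
  have h2 : HasDerivWithinAt (fun s => ∫ r in t..s, l r (X t x r)) (l t x) (Ici t) t := by
    have := hl.hasDerivWithinAt_integral_comp ht.2 hXt.1 (by rwa [hx])
    rwa [hx] at this
  have h3 : HasDerivWithinAt (fun s => (s, X t x s)) ((1 : ℝ), v t x) (Ici t) t :=
    (hasDerivWithinAt_id t _).prodMk h1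
  have hd' : HasFDerivAt (extValue T l g X) (fderiv ℝ (extValue T l g X) (t, x)) (t, X t x t) := by
    rw [hx]
    exact hd.hasFDerivAt
  have h4 : HasDerivWithinAt (fun s => (∫ r in t..s, l r (X t x r))
      + extValue T l g X (s, X t x s))
      (l t x + fderiv ℝ (extValue T l g X) (t, x) (1, v t x)) (Ici t) t :=
    h2.add (hd'.comp_hasDerivWithinAt (f := fun s => (s, X t x s)) t h3)
  have h5 : HasDerivWithinAt (fun s => (∫ r in t..s, l r (X t x r))
      + extValue T l g X (s, X t x s)) 0 (Ici t) t := by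
    refine (hasDerivWithinAt_const t (Ici t) (valueFn T l g X t x)).congr_of_eventuallyEq ?_ ?_
    · filter_upwards [nhdsWithin_le_nhds (Iio_mem_nhds ht.2), self_mem_nhdsWithin] with s hs hs'
      rw [extValue_of_mem ⟨ht.1.le.trans hs', le_of_lt hs⟩]
      exact (valueFn_eq hv hl hX htm ⟨hs', le_of_lt hs⟩ x).symm
    · simp [hx, extValue_of_mem htm]
  have := (uniqueDiffOn_Ici t t self_mem_Ici).eq_deriv _ h4 h5
  linarith

/-- A feedback map which is feasible for all times, Lipschitz in space, and jointly measurable. -/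
structure IsRegularFeedback (K : Set (Vec m)) (u : ℝ → Vec N → Vec m) : Prop where
  mem : ∀ t x, u t x ∈ K
  lipschitz : ∃ L : NNReal, ∀ t, LipschitzWith L (u t)
  stronglyMeasurable : StronglyMeasurable fun q : ℝ × Vec N => u q.1 q.2

/-- Composing a `C¹` function with a regular feedback map gives a Carathéodory field. -/
theorem IsRegularFeedback.isCaratheodory {F : Type*} [NormedAddCommGroup F] [NormedSpace ℝ F]
    {K : Set (Vec m)} (hK : IsCompact K) (hKc : Convex ℝ K) {u : ℝ → Vec N → Vec m}
    (hu : IsRegularFeedback K u) {h : Vec N → Vec m → F}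
    (hh : ContDiff ℝ 1 fun q : Vec N × Vec m => h q.1 q.2) :
    IsCaratheodory fun t x => h x (u t x) where
  stronglyMeasurable := hh.continuous.comp_stronglyMeasurable
    (measurable_snd.stronglyMeasurable.prodMk hu.stronglyMeasurable)
  bound R := by
    have hcomp : IsCompact (closedBall (0 : Vec N) R ×ˢ K) := (isCompact_closedBall 0 R).prod hK
    obtain ⟨C, hC⟩ := hh.contDiffOn.exists_lipschitzOnWith (s := closedBall (0 : Vec N) R ×ˢ K)
      one_ne_zero ((convex_closedBall _ _).prod hKc) hcomp
    obtain ⟨M, hM⟩ := hcomp.exists_bound_of_continuousOn hh.continuous.continuousOn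
    obtain ⟨L, hL⟩ := hu.lipschitz
    refine ⟨max (C * max 1 L) M.toNNReal, fun t => ?_, fun t x hx => ?_⟩
    · have hg : LipschitzOnWith (max 1 L) (fun x => (x, u t x)) (closedBall 0 R) :=
        (LipschitzWith.id.prodMk (hL t)).lipschitzOnWith
      exact (hC.comp hg fun y hy => ⟨hy, hu.mem t y⟩).weaken (le_max_left _ _)
    · refine (hM (x, u t x) ⟨hx, hu.mem t x⟩).trans ((Real.le_coe_toNNReal M).trans ?_)
      exact_mod_cast le_max_right _ _

/-- Every feasible map agrees at almost all times with a regular feedback map. -/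
theorem IsFeasible.exists_isRegularFeedback (hT : 0 < T) {K : Set (Vec m)}
    {u : ℝ → Vec N → Vec m} (hu : IsFeasible T K u) :
    ∃ u', IsRegularFeedback K u' ∧ ∀ᵐ t ∂volume.restrict (Icc 0 T), u' t = u t := by
  classical
  obtain ⟨L, hL⟩ := hu.lipschitz
  have hk : u 0 0 ∈ K := hu.mem 0 ⟨le_rfl, hT.le⟩ 0
  set d := TopologicalSpace.denseSeq (Vec N)
  have hd : DenseRange d := TopologicalSpace.denseRange_denseSeq _
  -- the times at which the measurable representatives are correct on the dense sequence
  have hae : ∀ᵐ t ∂volume.restrict (Icc 0 T), t ∈ Icc 0 T ∧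
      ∀ n, u t (d n) = (hu.aemeasurable (d n)).mk _ t :=
    (ae_restrict_mem measurableSet_Icc).and (ae_all_iff.2 fun n => (hu.aemeasurable (d n)).ae_eq_mk)
  obtain ⟨B, hB, hBm, hB0⟩ := exists_measurable_superset_of_null (ae_iff.1 hae)
  have hS : ∀ t ∉ B, t ∈ Icc 0 T ∧ ∀ n, u t (d n) = (hu.aemeasurable (d n)).mk _ t :=
    fun t ht => by
      by_contra h
      exact ht (hB h)
  set u' : ℝ → Vec N → Vec m := fun t x => if t ∈ B then u 0 0 else u t x with hu'
  have hLip : ∀ t, LipschitzWith L (u' t) := fun t => by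
    by_cases ht : t ∈ B
    · simpa [hu', ht] using (LipschitzWith.const (u 0 0)).weaken (zero_le : 0 ≤ L)
    · simpa [hu', ht] using hL t (hS t ht).1
  have hmd : ∀ n, Measurable fun t => u' t (d n) := fun n => by
    have : (fun t => u' t (d n))
        = fun t => if t ∈ B then u 0 0 else (hu.aemeasurable (d n)).mk _ t := by
      funext t
      by_cases ht : t ∈ B
      · simp [hu', ht]
      · simp [hu', ht, (hS t ht).2 n]
    rw [this]
    exact Measurable.ite hBm measurable_const (hu.aemeasurable (d n)).measurable_mk
  have hm : ∀ x, Measurable fun t => u' t x := fun x => by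
    obtain ⟨y, hy, hyx⟩ := mem_closure_iff_seq_limit.1 (hd x)
    choose n hn using hy
    refine measurable_of_tendsto_metrizable (f := fun k t => u' t (y k)) (fun k => ?_)
      (tendsto_pi_nhds.2 fun t => ((hLip t).continuous.tendsto x).comp hyx)
    simpa only [hn] using hmd (n k)
  refine ⟨u', ⟨fun t x => ?_, ⟨L, hLip⟩, ?_⟩, ?_⟩
  · by_cases ht : t ∈ B
    · simpa [hu', ht] using hk
    · simpa [hu', ht] using hu.mem t (hS t ht).1 x
  · have h1 : StronglyMeasurable (Function.uncurry fun x t => u' t x) :=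
      stronglyMeasurable_uncurry_of_continuous_of_stronglyMeasurable
        (fun t => (hLip t).continuous) fun x => (hm x).stronglyMeasurable
    exact h1.comp_measurable measurable_swap
  · have : ∀ᵐ t ∂volume.restrict (Icc 0 T), t ∉ B := by
      rw [ae_iff]
      simpa using hB0
    filter_upwards [this] with t ht
    funext x
    simp [hu', ht]

/-- Following the constant control `k ∈ K` for a short time and the optimal feedback map
afterwards does not lower the value. -/
theorem valueFn_le_of_const_control {K : Set (Vec m)} {F : Vec N → Vec m → ℝ}
    {f : Vec N → Vec m → Vec N} {g : Vec N → ℝ} {u : ℝ → Vec N → Vec m}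
    (hu : IsRegularFeedback K u) (hF : Continuous fun q : Vec N × Vec m => F q.1 q.2)
    (hf : Continuous fun q : Vec N × Vec m => f q.1 q.2)
    (hv : IsCaratheodory fun t x => f x (u t x)) (hl : IsCaratheodory fun t x => F x (u t x))
    {X : ℝ → Vec N → ℝ → Vec N} (hX : ∀ t ∈ Icc 0 T, ∀ y, IsState T f u t y (X t y))
    (hopt : ∀ t ∈ Icc 0 T, ∀ y, ∀ (V : ℝ → Vec N → Vec m) (z : ℝ → Vec N),
      IsFeasible T K V → IsState T f V t y z → cost T F g u t (X t y) ≤ cost T F g V t z)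
    {k : Vec m} (hk : k ∈ K) {t s : ℝ} (ht : 0 ≤ t) (hts : t ≤ s) (hsT : s ≤ T)
    {α : ℝ → Vec N} (hα : ContinuousOn α (Icc t s))
    (hαd : ∀ r ∈ Ioo t s, HasDerivAt α (f (α r) k) r) :
    valueFn T (fun t x => F x (u t x)) g X t (α t)
      ≤ (∫ r in t..s, F (α r) k) + valueFn T (fun t x => F x (u t x)) g X s (α s) := by
  classical
  have hs0 : s ∈ Icc 0 T := ⟨ht.trans hts, hsT⟩
  have ht0 : t ∈ Icc 0 T := ⟨ht, hts.trans hsT⟩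
  set V : ℝ → Vec N → Vec m := fun r x => if r < s then k else u r x with hV
  set ξ := X s (α s) with hξ
  have hξX : IsState T f u s (α s) ξ := hX s hs0 _
  have hξs : ξ s = α s := by simpa using hξX.2 s ⟨le_rfl, hsT⟩
  set z : ℝ → Vec N := fun r => if r < s then α r else ξ r with hz
  have hz1 : ∀ r ∈ Icc t s, z r = α r := fun r hr => by
    rcases hr.2.lt_or_eq with h | h
    · simp [hz, h]
    · simp [hz, h, hξs]
  have hz2 : ∀ r ∈ Icc s T, z r = ξ r := fun r hr => by simp [hz, hr.1.not_gt]
  have hVf : IsFeasible T K V := by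
    refine ⟨fun r _ x => ?_, ?_, fun x => ?_⟩
    · by_cases h : r < s
      · simpa [hV, h] using hk
      · simpa [hV, h] using hu.mem r x
    · obtain ⟨L, hL⟩ := hu.lipschitz
      refine ⟨L, fun r _ => ?_⟩
      by_cases h : r < s
      · simpa [hV, h] using (LipschitzWith.const k).weaken (zero_le : 0 ≤ L)
      · simpa [hV, h] using hL r
    · exact (Measurable.ite measurableSet_Iio measurable_const
        (hu.stronglyMeasurable.measurable.comp
          (measurable_id.prodMk measurable_const))).aemeasurable
  -- integrals along the concatenated trajectory
  have hI1 : ∀ {G : Type} [NormedAddCommGroup G] [NormedSpace ℝ G] (h : Vec N → Vec m → G),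
      ∀ r ∈ Icc t s, ∫ q in t..r, h (z q) (V q (z q)) = ∫ q in t..r, h (α q) k := by
    intro G _ _ h r hr
    refine intervalIntegral.integral_congr_ae ?_
    have hne : ∀ᵐ q : ℝ, q ≠ s := by simp [ae_iff, measure_singleton]
    filter_upwards [hne] with q hq hqm
    rw [uIoc_of_le hr.1] at hqm
    have hqs : q < s := lt_of_le_of_ne (hqm.2.trans hr.2) hq
    simp [hz, hV, hqs]
  have hI2 : ∀ {G : Type} [NormedAddCommGroup G] [NormedSpace ℝ G] (h : Vec N → Vec m → G),
      ∀ r ∈ Icc s T, ∫ q in s..r, h (z q) (V q (z q)) = ∫ q in s..r, h (ξ q) (u q (ξ q)) := by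
    intro G _ _ h r hr
    refine intervalIntegral.integral_congr fun q hq => ?_
    rw [uIcc_of_le hr.1] at hq
    simp [hz, hV, hq.1.not_gt]
  have hcα : ∀ {G : Type} [NormedAddCommGroup G] [NormedSpace ℝ G] (h : Vec N → Vec m → G),
      (Continuous fun q : Vec N × Vec m => h q.1 q.2) →
      ContinuousOn (fun q => h (α q) k) (Icc t s) := by
    intro G _ _ h hh
    exact hh.comp_continuousOn (hα.prodMk continuousOn_const)
  have hint1 : ∀ {G : Type} [NormedAddCommGroup G] [NormedSpace ℝ G] (h : Vec N → Vec m → G),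
      (Continuous fun q : Vec N × Vec m => h q.1 q.2) →
      IntervalIntegrable (fun q => h (z q) (V q (z q))) volume t s := by
    intro G _ _ h hh
    have h1 : IntervalIntegrable (fun q => h (α q) k) volume t s :=
      ContinuousOn.intervalIntegrable (by rw [uIcc_of_le hts]; exact hcα h hh)
    refine h1.congr_ae ?_
    have hne : ∀ᵐ q ∂(volume.restrict (uIoc t s)), q ≠ s :=
      ae_restrict_of_ae (by simp [ae_iff, measure_singleton])
    filter_upwards [hne, ae_restrict_mem measurableSet_uIoc] with q hq hqm
    rw [uIoc_of_le hts] at hqm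
    have hqs : q < s := lt_of_le_of_ne hqm.2 hq
    simp [hz, hV, hqs]
  have hint2 : ∀ {G : Type} [NormedAddCommGroup G] [NormedSpace ℝ G] (h : Vec N → Vec m → G),
      (IsCaratheodory fun t x => h x (u t x)) → ∀ r ∈ Icc s T,
      IntervalIntegrable (fun q => h (z q) (V q (z q))) volume s r := by
    intro G _ _ h hh r hr
    have h1 : IntervalIntegrable (fun q => h (ξ q) (u q (ξ q))) volume s r :=
      hh.intervalIntegrable_comp hr.1 (hξX.1.mono (Icc_subset_Icc_right hr.2))
    refine h1.congr fun q hq => ?_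
    rw [uIoc_of_le hr.1] at hq
    simp [hz, hV, hq.1.le.not_gt]
  have hαint : ∀ r ∈ Icc t s, α r = α t + ∫ q in t..r, f (α q) k := fun r hr => by
    have h1 : ContinuousOn (fun q => f (α q) k) (Icc t r) :=
      (hcα f hf).mono (Icc_subset_Icc_right hr.2)
    rw [intervalIntegral.integral_eq_sub_of_hasDerivAt_of_le hr.1
      (hα.mono (Icc_subset_Icc_right hr.2)) (fun q hq => hαd q ⟨hq.1, hq.2.trans_le hr.2⟩)
      (ContinuousOn.intervalIntegrable (by rwa [uIcc_of_le hr.1]))]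
    abel
  have hzst : IsState T f V t (α t) z := by
    refine ⟨?_, fun r hr => ?_⟩
    · rw [← Icc_union_Icc_eq_Icc hts hsT]
      exact (hα.congr hz1).union_of_isClosed (hξX.1.congr hz2) isClosed_Icc isClosed_Icc
    · rcases le_total r s with h | h
      · rw [hz1 r ⟨hr.1, h⟩, hI1 f r ⟨hr.1, h⟩]
        exact hαint r ⟨hr.1, h⟩
      · rw [← intervalIntegral.integral_add_adjacent_intervals (hint1 f hf)
          (hint2 f hv r ⟨h, hr.2⟩), hI1 f s ⟨hts, le_rfl⟩, hI2 f r ⟨h, hr.2⟩, ← add_assoc,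
          ← hαint s ⟨hts, le_rfl⟩, hz2 r ⟨h, hr.2⟩]
        exact hξX.2 r ⟨h, hr.2⟩
  have hmain := hopt t ht0 (α t) V z hVf hzst
  have hc : cost T F g V t z = (∫ r in t..s, F (α r) k)
      + valueFn T (fun t x => F x (u t x)) g X s (α s) := by
    rw [cost, ← intervalIntegral.integral_add_adjacent_intervals (hint1 F hF)
      (hint2 F hl T ⟨hsT, le_rfl⟩), hI1 F s ⟨hts, le_rfl⟩, hI2 F T ⟨hsT, le_rfl⟩,
      hz2 T ⟨hsT, le_rfl⟩, valueFn, add_assoc]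
  rw [← hc]
  exact hmain

/-- The Hamilton–Jacobi–Bellman inequality at points of differentiability. -/
theorem fderiv_extValue_apply_const_control {K : Set (Vec m)} {F : Vec N → Vec m → ℝ}
    {f : Vec N → Vec m → Vec N} {g : Vec N → ℝ} {u : ℝ → Vec N → Vec m}
    (hu : IsRegularFeedback K u) (hF : Continuous fun q : Vec N × Vec m => F q.1 q.2)
    (hf : ContDiff ℝ 1 fun q : Vec N × Vec m => f q.1 q.2)
    (hv : IsCaratheodory fun t x => f x (u t x)) (hl : IsCaratheodory fun t x => F x (u t x))
    {X : ℝ → Vec N → ℝ → Vec N} (hX : ∀ t ∈ Icc 0 T, ∀ y, IsState T f u t y (X t y))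
    (hopt : ∀ t ∈ Icc 0 T, ∀ y, ∀ (V : ℝ → Vec N → Vec m) (z : ℝ → Vec N),
      IsFeasible T K V → IsState T f V t y z → cost T F g u t (X t y) ≤ cost T F g V t z)
    {k : Vec m} (hk : k ∈ K) {t : ℝ} {x : Vec N} (ht : t ∈ Ioo 0 T)
    (hd : DifferentiableAt ℝ (extValue T (fun t x => F x (u t x)) g X) (t, x)) :
    0 ≤ fderiv ℝ (extValue T (fun t x => F x (u t x)) g X) (t, x) (1, f x k) + F x k := by
  set w := extValue T (fun t x => F x (u t x)) g X with hw
  have hfk : ContDiff ℝ 1 fun x => f x k := hf.comp (contDiff_id.prodMk contDiff_const)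
  obtain ⟨α, hα0, ε, hε, hα⟩ :=
    (hfk.contDiffAt (x := x)).exists_forall_mem_closedBall_exists_eq_forall_mem_Ioo_hasDerivAt₀ t
  have hαt : HasDerivAt α (f x k) t := by
    have := hα t ⟨by linarith, by linarith⟩
    rwa [hα0] at this
  have hFα : HasDerivWithinAt (fun s => ∫ r in t..s, F (α r) k) (F x k) (Ici t) t := by
    have hc : ContinuousOn (fun r => F (α r) k) (Ioo (t - ε) (t + ε)) := fun r hr =>
      (hF.continuousAt.comp (f := fun r => (α r, k))
        ((hα r hr).continuousAt.prodMk continuousAt_const)).continuousWithinAt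
    have hnhds : Ioo (t - ε) (t + ε) ∈ 𝓝 t := Ioo_mem_nhds (by linarith) (by linarith)
    have := intervalIntegral.integral_hasDerivAt_right (f := fun r => F (α r) k) (a := t) (b := t)
      (by simp) (hc.stronglyMeasurableAtFilter isOpen_Ioo t (mem_of_mem_nhds hnhds))
      (hc.continuousAt hnhds)
    rw [hα0] at this
    exact this.hasDerivWithinAt
  have hd' : HasFDerivAt w (fderiv ℝ w (t, x)) (t, α t) := by
    rw [hα0]
    exact hd.hasFDerivAt
  have h4 : HasDerivWithinAt (fun s => (∫ r in t..s, F (α r) k) + w (s, α s))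
      (F x k + fderiv ℝ w (t, x) (1, f x k)) (Ici t) t :=
    hFα.add (hd'.comp_hasDerivWithinAt (f := fun s => (s, α s)) t
      ((hasDerivWithinAt_id t _).prodMk hαt.hasDerivWithinAt))
  have hmin : ∀ᶠ s in 𝓝[>] t, w (t, x) ≤ (∫ r in t..s, F (α r) k) + w (s, α s) := by
    filter_upwards [nhdsWithin_le_nhds (Iio_mem_nhds ht.2), self_mem_nhdsWithin,
      nhdsWithin_le_nhds (Iio_mem_nhds (show t < t + ε by linarith))] with s hsT hts hsε
    have hsT' : s < T := hsT
    have hts' : t < s := hts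
    have hsε' : s < t + ε := hsε
    have := valueFn_le_of_const_control hu hF hf.continuous hv hl hX hopt hk ht.1.le hts'.le
      hsT'.le (α := α)
      (fun r hr => (hα r ⟨by linarith [hr.1], by linarith [hr.2]⟩).continuousAt.continuousWithinAt)
      (fun r hr => hα r ⟨by linarith [hr.1], by linarith [hr.2]⟩)
    rw [hw, extValue_of_mem ⟨ht.1.le, ht.2.le⟩, extValue_of_mem ⟨ht.1.le.trans hts'.le, hsT'.le⟩]
    rwa [hα0] at this
  have hslope := (hasDerivWithinAt_iff_tendsto_slope' self_notMem_Ioi).1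
    (h4.mono Ioi_subset_Ici_self)
  have := ge_of_tendsto hslope (b := 0) (by
    filter_upwards [hmin, self_mem_nhdsWithin] with s hs hts
    rw [slope_def_field]
    refine div_nonneg ?_ (sub_nonneg.2 (le_of_lt hts))
    simp only [intervalIntegral.integral_same, hα0, zero_add]
    linarith)
  linarith

end HJB

/-! ### Commutation of derivatives and the transport identity -/

section SecondDerivatives

variable {E : Type*} [NormedAddCommGroup E] [NormedSpace ℝ E] [FiniteDimensional ℝ E]
  [MeasurableSpace E] [BorelSpace E] {μ : Measure E} [μ.IsAddHaarMeasure]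

/-- A locally Lipschitz function agrees on a given ball with a compactly supported one. -/
theorem _root_.LocallyLipschitz.exists_hasCompactSupport {a : E → ℝ} (ha : LocallyLipschitz a)
    (R : ℝ) : ∃ a' : E → ℝ, LocallyLipschitz a' ∧ HasCompactSupport a' ∧
      ∀ x, ‖x‖ ≤ R → a' x = a x := by
  have : ProperSpace E := FiniteDimensional.proper ℝ E
  let η : ContDiffBump (0 : E) := ⟨max R 1, max R 1 + 1, by positivity, by linarith⟩
  refine ⟨fun x => η x * a x, (ContDiff.locallyLipschitz (η.contDiff (n := 1))).mul_real ha,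
    η.hasCompactSupport.mul_right, fun x hx => ?_⟩
  have : x ∈ closedBall (0 : E) η.rIn := by
    rw [mem_closedBall_zero_iff]
    exact hx.trans (le_max_left _ _)
  simp only [η.one_of_mem_closedBall this, one_mul]

theorem fderiv_eq_of_eq_on_ball {a a' : E → ℝ} {R : ℝ} (h : ∀ x, ‖x‖ ≤ R → a' x = a x) {x : E}
    (hx : ‖x‖ < R) : fderiv ℝ a' x = fderiv ℝ a x := by
  refine Filter.EventuallyEq.fderiv_eq ?_
  filter_upwards [isOpen_ball.mem_nhds (show x ∈ ball (0 : E) R by simpa using hx)] with z hz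
  exact h z (by simpa using (mem_ball_zero_iff.1 hz).le)

/-- Second derivatives commute in the weak sense: both sides are minus the integral of `a` against
the mixed second derivative of `k`. As `k` is only Lipschitz, one of the two derivatives is
replaced by a difference quotient. -/
theorem integral_fderiv_mul_fderiv_comm_of_hasCompactSupport {a k : E → ℝ}
    (ha : LocallyLipschitz a) (hac : HasCompactSupport a) (hk : LocallyLipschitz k)
    (hkc : HasCompactSupport k) (e e' : E) :
    ∫ x, fderiv ℝ a x e * fderiv ℝ k x e' ∂μ = ∫ x, fderiv ℝ a x e' * fderiv ℝ k x e ∂μ := by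
  obtain ⟨A, hA⟩ := ha.exists_lipschitzWith hac
  obtain ⟨C, hC⟩ := hk.exists_lipschitzWith hkc
  have hcs : ∀ {h : E → ℝ}, LocallyLipschitz h → HasCompactSupport h → ∀ c,
      Integrable (fun x => fderiv ℝ h x c) μ := fun {h} hh hhc c => by
    refine (integrableOn_iff_integrable_of_support_subset
      (subset_tsupport (fun x => fderiv ℝ h x c))).1 ?_
    exact (hh.locallyIntegrable_fderiv_apply c).integrableOn_isCompact
      (hhc.fderiv_apply (𝕜 := ℝ) c).isCompact
  have h1 := hC.integral_inv_smul_sub_mul_tendsto_integral_lineDeriv_mul (hcs ha hac e) e'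
  have h2 := hA.integral_inv_smul_sub_mul_tendsto_integral_lineDeriv_mul (hcs hk hkc e) (-e')
  have key : ∀ t : ℝ, ∫ x, (t⁻¹ • (k (x + t • e') - k x)) * fderiv ℝ a x e ∂μ
      = - ∫ x, (t⁻¹ • (a (x + t • (-e')) - a x)) * fderiv ℝ k x e ∂μ := fun t => by
    have htrans : LocallyLipschitz fun x : E => k (x + t • e') :=
      hk.comp ((LipschitzWith.id.add (LipschitzWith.const _)).locallyLipschitz)
    have htc : HasCompactSupport fun x : E => k (x + t • e') :=
      hkc.comp_homeomorph (Homeomorph.addRight (t • e'))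
    have e1 := integral_fderiv_mul_eq_neg (μ := μ) ha htrans htc e
    have e2 := integral_fderiv_mul_eq_neg (μ := μ) ha hk hkc e
    have e3 : ∀ x, fderiv ℝ (fun x => k (x + t • e')) x e = fderiv ℝ k (x + t • e') e := fun x => by
      rw [fderiv_comp_add_right]
    simp only [e3] at e1
    have e4 : ∫ x, a x * fderiv ℝ k (x + t • e') e ∂μ
        = ∫ x, a (x + t • (-e')) * fderiv ℝ k x e ∂μ := by
      rw [← integral_add_right_eq_self (fun x => a (x + t • (-e')) * fderiv ℝ k x e) (t • e')]
      simp
    have i1 : Integrable (fun x => k (x + t • e') * fderiv ℝ a x e) μ :=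
      (hcs ha hac e).bdd_mul htrans.continuous.aestronglyMeasurable
        (.of_forall (Classical.choose_spec (htc.exists_bound_of_continuous htrans.continuous)))
    have i2 : Integrable (fun x => k x * fderiv ℝ a x e) μ :=
      (hcs ha hac e).bdd_mul hk.continuous.aestronglyMeasurable
        (.of_forall (Classical.choose_spec (hkc.exists_bound_of_continuous hk.continuous)))
    have hat : Continuous fun x => a (x + t • (-e')) := ha.continuous.comp (by fun_prop)
    have hatc : HasCompactSupport fun x : E => a (x + t • (-e')) :=
      hac.comp_homeomorph (Homeomorph.addRight (t • (-e')))
    have i3 : Integrable (fun x => a (x + t • (-e')) * fderiv ℝ k x e) μ :=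
      (hcs hk hkc e).bdd_mul hat.aestronglyMeasurable
        (.of_forall (Classical.choose_spec (hatc.exists_bound_of_continuous hat)))
    have i4 : Integrable (fun x => a x * fderiv ℝ k x e) μ :=
      (hcs hk hkc e).bdd_mul ha.continuous.aestronglyMeasurable
        (.of_forall (Classical.choose_spec (hac.exists_bound_of_continuous ha.continuous)))
    simp only [smul_eq_mul, mul_assoc, sub_mul]
    rw [integral_const_mul, integral_const_mul, integral_sub i1 i2, integral_sub i3 i4]
    simp only [mul_comm (k _)]
    rw [e1, e2, e4]
    ring
  have h3 : Tendsto (fun t : ℝ => ∫ x, (t⁻¹ • (k (x + t • e') - k x)) * fderiv ℝ a x e ∂μ)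
      (𝓝[>] 0) (𝓝 (- ∫ x, lineDeriv ℝ a x (-e') * fderiv ℝ k x e ∂μ)) := by
    simp only [key]
    exact h2.neg
  have h4 := tendsto_nhds_unique h1 h3
  have e5 : ∫ x, lineDeriv ℝ k x e' * fderiv ℝ a x e ∂μ
      = ∫ x, fderiv ℝ a x e * fderiv ℝ k x e' ∂μ := by
    refine integral_congr_ae ?_
    filter_upwards [hk.ae_differentiableAt μ] with x hx
    rw [hx.lineDeriv_eq_fderiv, mul_comm]
  have e6 : - ∫ x, lineDeriv ℝ a x (-e') * fderiv ℝ k x e ∂μ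
      = ∫ x, fderiv ℝ a x e' * fderiv ℝ k x e ∂μ := by
    rw [← integral_neg]
    refine integral_congr_ae ?_
    filter_upwards [ha.ae_differentiableAt μ] with x hx
    rw [hx.lineDeriv_eq_fderiv, map_neg, neg_mul, neg_neg]
  rw [← e5, h4, e6]

/-- Only one of the two functions needs to have compact support: the other one is cut off. -/
theorem integral_fderiv_mul_fderiv_comm {a k : E → ℝ} (ha : LocallyLipschitz a)
    (hk : LocallyLipschitz k) (hkc : HasCompactSupport k) (e e' : E) :
    ∫ x, fderiv ℝ a x e * fderiv ℝ k x e' ∂μ = ∫ x, fderiv ℝ a x e' * fderiv ℝ k x e ∂μ := by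
  obtain ⟨R, hR⟩ := hkc.isCompact.isBounded.subset_closedBall 0
  obtain ⟨a', ha', hac', haa'⟩ := ha.exists_hasCompactSupport (R + 1)
  have h : ∀ c c' x, fderiv ℝ a' x c * fderiv ℝ k x c' = fderiv ℝ a x c * fderiv ℝ k x c' :=
    fun c c' x => by
      rcases lt_or_ge ‖x‖ (R + 1) with hx | hx
      · rw [fderiv_eq_of_eq_on_ball haa' hx]
      · have : fderiv ℝ k x = 0 := by
          by_contra hne
          have h1 := hR (tsupport_fderiv_subset ℝ (subset_tsupport _ hne))
          rw [mem_closedBall_zero_iff] at h1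
          linarith
        simp [this]
  have := integral_fderiv_mul_fderiv_comm_of_hasCompactSupport (μ := μ) ha' hac' hk hkc e e'
  simpa only [h] using this

end SecondDerivatives

section Transport

variable {N : ℕ}

theorem sum_smul_single (y : Vec N) : ∑ i, y i • EuclideanSpace.single i (1 : ℝ) = y := by
  simpa using (EuclideanSpace.basisFun (Fin N) ℝ).sum_repr y

theorem fderiv_component {v : Vec N → Vec N} {x : Vec N} (hv : DifferentiableAt ℝ v x) (j : Fin N)
    (e : Vec N) : fderiv ℝ (fun x => v x j) x e = fderiv ℝ v x e j := by
  have : HasFDerivAt (fun x => v x j)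
      ((EuclideanSpace.proj (𝕜 := ℝ) j).comp (fderiv ℝ v x)) x :=
    (EuclideanSpace.proj (𝕜 := ℝ) j).hasFDerivAt.comp x hv.hasFDerivAt
  rw [this.fderiv]
  rfl

theorem locallyLipschitz_component {v : Vec N → Vec N} (hv : LocallyLipschitz v) (j : Fin N) :
    LocallyLipschitz fun x => v x j :=
  (EuclideanSpace.proj (𝕜 := ℝ) (ι := Fin N) j).lipschitz.locallyLipschitz.comp hv

/-- The weak form of `∂ₑ(∇a v) = ∇(∂ₑa) v + ∇a ∂ₑv`. -/
theorem integral_transport_eq {a ψ : Vec N → ℝ} {v : Vec N → Vec N} (ha : LocallyLipschitz a)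
    (hv : LocallyLipschitz v) (hψ : ContDiff ℝ 1 ψ) (hψc : HasCompactSupport ψ) (e : Vec N) :
    ∫ x, fderiv ℝ a x (v x) * fderiv ℝ ψ x e
      = ∫ x, (fderiv ℝ a x e * (fderiv ℝ ψ x (v x) + ψ x * divergence v x)
        - ψ x * fderiv ℝ a x (fderiv ℝ v x e)) := by
  set b : Fin N → Vec N := fun j => EuclideanSpace.single j 1 with hb
  have hvj := locallyLipschitz_component hv
  have hψl : LocallyLipschitz ψ := hψ.locallyLipschitz
  have hk : ∀ j, LocallyLipschitz fun x => v x j * ψ x := fun j => (hvj j).mul_real hψl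
  have hkc : ∀ j, HasCompactSupport fun x => v x j * ψ x := fun j => hψc.mul_left
  have hint : ∀ j c c', Integrable fun x => fderiv ℝ a x c * fderiv ℝ (fun x => v x j * ψ x) x c' :=
    fun j c c' => by
      obtain ⟨R, hR⟩ := (hkc j).isCompact.isBounded.subset_closedBall 0
      obtain ⟨C, hC⟩ := ha.exists_norm_fderiv_le R
      obtain ⟨D, hD⟩ := (hk j).exists_norm_fderiv_le R
      refine integrable_of_bound_of_support
        ((measurable_fderiv_apply_const ℝ _ c).mul
          (measurable_fderiv_apply_const ℝ _ c')).aestronglyMeasurable R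
        ((C * ‖c‖) * (D * ‖c'‖)) (fun x hx => ?_) fun x hx => ?_
      · have h1 : ‖fderiv ℝ a x c‖ ≤ C * ‖c‖ :=
          ((fderiv ℝ a x).le_opNorm c).trans (by gcongr; exact hC x hx)
        have h2 : ‖fderiv ℝ (fun x => v x j * ψ x) x c'‖ ≤ D * ‖c'‖ :=
          ((fderiv ℝ _ x).le_opNorm c').trans (by gcongr; exact hD x hx)
        rw [norm_mul]
        exact mul_le_mul h1 h2 (norm_nonneg _) ((norm_nonneg _).trans h1)
      · have : fderiv ℝ (fun x => v x j * ψ x) x = 0 := by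
          by_contra hne
          have h1 := hR (tsupport_fderiv_subset ℝ (subset_tsupport _ hne))
          rw [mem_closedBall_zero_iff] at h1
          linarith
        simp [this]
  have hsum : ∑ j, ∫ x, fderiv ℝ a x (b j) * fderiv ℝ (fun x => v x j * ψ x) x e
      = ∑ j, ∫ x, fderiv ℝ a x e * fderiv ℝ (fun x => v x j * ψ x) x (b j) :=
    Finset.sum_congr rfl fun j _ =>
      integral_fderiv_mul_fderiv_comm ha (hk j) (hkc j) (b j) e
  rw [← integral_finsetSum _ fun j _ => hint j _ _,
    ← integral_finsetSum _ fun j _ => hint j _ _] at hsum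
  have hfd : ∀ᵐ x, ∀ j c, fderiv ℝ (fun x => v x j * ψ x) x c
      = v x j * fderiv ℝ ψ x c + ψ x * fderiv ℝ v x c j := by
    filter_upwards [hv.ae_differentiableAt volume] with x hx j c
    have h1 : DifferentiableAt ℝ (fun x => v x j) x :=
      (EuclideanSpace.proj (𝕜 := ℝ) j).differentiableAt.comp x hx
    rw [fderiv_fun_mul h1 (hψ.differentiable one_ne_zero x)]
    simp [fderiv_component hx]
  have hav : ∀ (x y : Vec N), ∑ j, fderiv ℝ a x (b j) * y j = fderiv ℝ a x y := fun x y => by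
    conv_rhs => rw [← sum_smul_single y]
    simp [hb, mul_comm]
  have hψv : ∀ (x y : Vec N), ∑ j, y j * fderiv ℝ ψ x (b j) = fderiv ℝ ψ x y := fun x y => by
    conv_rhs => rw [← sum_smul_single y]
    simp [hb]
  have hL : ∀ᵐ x, ∑ j, fderiv ℝ a x (b j) * fderiv ℝ (fun x => v x j * ψ x) x e
      = fderiv ℝ a x (v x) * fderiv ℝ ψ x e + ψ x * fderiv ℝ a x (fderiv ℝ v x e) := by
    filter_upwards [hfd] with x hx
    rw [← hav x (v x), ← hav x (fderiv ℝ v x e), Finset.sum_mul, Finset.mul_sum,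
      ← Finset.sum_add_distrib]
    refine Finset.sum_congr rfl fun j _ => ?_
    rw [hx]
    ring
  have hR : ∀ᵐ x, ∑ j, fderiv ℝ a x e * fderiv ℝ (fun x => v x j * ψ x) x (b j)
      = fderiv ℝ a x e * (fderiv ℝ ψ x (v x) + ψ x * divergence v x) := by
    filter_upwards [hfd] with x hx
    have hdiv : ψ x * divergence v x = ∑ j, ψ x * fderiv ℝ v x (b j) j := Finset.mul_sum _ _ _
    rw [← Finset.mul_sum, ← hψv x (v x), hdiv, ← Finset.sum_add_distrib]
    congr 1
    exact Finset.sum_congr rfl fun j _ => hx j _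
  rw [integral_congr_ae hL, integral_congr_ae hR] at hsum
  have hA : Integrable fun x => fderiv ℝ a x (v x) * fderiv ℝ ψ x e := by
    have : (fun x => fderiv ℝ a x (v x) * fderiv ℝ ψ x e)
        = fun x => ∑ j, fderiv ℝ a x (b j) * (v x j * fderiv ℝ ψ x e) := by
      funext x
      rw [← hav x (v x), Finset.sum_mul]
      exact Finset.sum_congr rfl fun j _ => mul_assoc _ _ _
    rw [this]
    exact integrable_finsetSum _ fun j _ => integrable_mul_of_hasCompactSupport
      (ha.locallyIntegrable_fderiv_apply _)
      ((hvj j).continuous.mul ((hψ.continuous_fderiv one_ne_zero).clm_apply continuous_const))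
      (hψc.fderiv_apply (𝕜 := ℝ) e).mul_left
  have hAB : Integrable fun x => fderiv ℝ a x (v x) * fderiv ℝ ψ x e
      + ψ x * fderiv ℝ a x (fderiv ℝ v x e) :=
    (integrable_finsetSum Finset.univ fun j _ => hint j (b j) e).congr hL
  have hB : Integrable fun x => ψ x * fderiv ℝ a x (fderiv ℝ v x e) := by
    refine (hAB.sub hA).congr (.of_forall fun x => ?_)
    simp
  have hC : Integrable fun x =>
      fderiv ℝ a x e * (fderiv ℝ ψ x (v x) + ψ x * divergence v x) :=
    (integrable_finsetSum Finset.univ fun j _ => hint j e (b j)).congr hR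
  rw [integral_add hA hB] at hsum
  rw [integral_sub hC hB]
  linarith

end Transport

/-! ### Measurable, locally bounded fields -/

section LocBdd

variable {N : ℕ} {F G : Type*} [NormedAddCommGroup F] [NormedSpace ℝ F]
  [NormedAddCommGroup G] [NormedSpace ℝ G]

/-- A time dependent field which is bounded on balls, uniformly in time, and which has a jointly
measurable modification (in the sense that at every time, it changes the field on a null set). -/
structure IsLocBdd (h : ℝ → Vec N → F) : Prop where
  exists_modification : ∃ H : ℝ × Vec N → F, StronglyMeasurable H ∧
    ∀ s, ∀ᵐ x, h s x = H (s, x)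
  bound : ∀ R : ℝ, ∃ C : ℝ, ∀ s x, ‖x‖ ≤ R → ‖h s x‖ ≤ C

theorem IsCaratheodory.isLocBdd {v : ℝ → Vec N → F} (hv : IsCaratheodory v) : IsLocBdd v where
  exists_modification := ⟨_, hv.stronglyMeasurable, fun _ => .of_forall fun _ => rfl⟩
  bound R := by
    obtain ⟨L, -, hL⟩ := hv.bound R
    exact ⟨L, fun s x hx => hL s x (by simpa using hx)⟩

theorem isLocBdd_of_continuous {h : Vec N → F} (hh : Continuous h) : IsLocBdd fun _ : ℝ => h where
  exists_modification := ⟨fun q => h q.2, hh.stronglyMeasurable.comp_measurable measurable_snd,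
    fun _ => .of_forall fun _ => rfl⟩
  bound R := by
    obtain ⟨C, hC⟩ := (isCompact_closedBall (0 : Vec N) R).exists_bound_of_continuousOn
      hh.continuousOn
    exact ⟨C, fun _ x hx => hC x (by simpa using hx)⟩

theorem IsLocBdd.add {h k : ℝ → Vec N → F} (hh : IsLocBdd h) (hk : IsLocBdd k) :
    IsLocBdd fun s x => h s x + k s x where
  exists_modification := by
    obtain ⟨H, hH, hhH⟩ := hh.exists_modification
    obtain ⟨K, hK, hkK⟩ := hk.exists_modification
    refine ⟨_, hH.add hK, fun s => ?_⟩
    filter_upwards [hhH s, hkK s] with x h1 h2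
    simp [h1, h2]
  bound R := by
    obtain ⟨C, hC⟩ := hh.bound R
    obtain ⟨D, hD⟩ := hk.bound R
    exact ⟨C + D, fun s x hx => (norm_add_le _ _).trans (add_le_add (hC s x hx) (hD s x hx))⟩

theorem IsLocBdd.clm_comp {h : ℝ → Vec N → F} (hh : IsLocBdd h) (A : F →L[ℝ] G) :
    IsLocBdd fun s x => A (h s x) where
  exists_modification := by
    obtain ⟨H, hH, hhH⟩ := hh.exists_modification
    refine ⟨_, A.continuous.comp_stronglyMeasurable hH, fun s => ?_⟩
    filter_upwards [hhH s] with x h1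
    simp [h1]
  bound R := by
    obtain ⟨C, hC⟩ := hh.bound R
    exact ⟨‖A‖ * C, fun s x hx => (A.le_opNorm _).trans (by gcongr; exact hC s x hx)⟩

theorem IsLocBdd.neg {h : ℝ → Vec N → F} (hh : IsLocBdd h) : IsLocBdd fun s x => -h s x := by
  simpa using hh.clm_comp (-ContinuousLinearMap.id ℝ F)

theorem IsLocBdd.sub {h k : ℝ → Vec N → F} (hh : IsLocBdd h) (hk : IsLocBdd k) :
    IsLocBdd fun s x => h s x - k s x := by
  simpa [sub_eq_add_neg] using hh.add hk.neg

theorem IsLocBdd.clm_apply {h : ℝ → Vec N → F →L[ℝ] G} {k : ℝ → Vec N → F} (hh : IsLocBdd h)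
    (hk : IsLocBdd k) : IsLocBdd fun s x => h s x (k s x) where
  exists_modification := by
    obtain ⟨H, hH, hhH⟩ := hh.exists_modification
    obtain ⟨K, hK, hkK⟩ := hk.exists_modification
    refine ⟨fun q => H q (K q), (isBoundedBilinearMap_apply (𝕜 := ℝ) (E := F)
      (F := G)).continuous.comp_stronglyMeasurable (hH.prodMk hK), fun s => ?_⟩
    filter_upwards [hhH s, hkK s] with x h1 h2
    simp [h1, h2]
  bound R := by
    obtain ⟨C, hC⟩ := hh.bound R
    obtain ⟨D, hD⟩ := hk.bound R
    refine ⟨C * D, fun s x hx => ((h s x).le_opNorm _).trans ?_⟩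
    exact mul_le_mul (hC s x hx) (hD s x hx) (norm_nonneg _) ((norm_nonneg _).trans (hC s x hx))

theorem IsLocBdd.mul {h k : ℝ → Vec N → ℝ} (hh : IsLocBdd h) (hk : IsLocBdd k) :
    IsLocBdd fun s x => h s x * k s x :=
  (hh.clm_comp (ContinuousLinearMap.mul ℝ ℝ)).clm_apply hk

theorem IsLocBdd.inner_real {h k : ℝ → Vec N → Vec N} (hh : IsLocBdd h) (hk : IsLocBdd k) :
    IsLocBdd fun s x => (inner ℝ (h s x) (k s x) : ℝ) :=
  (hh.clm_comp (innerSL ℝ)).clm_apply hk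

theorem IsLocBdd.inner_const {h : ℝ → Vec N → Vec N} (hh : IsLocBdd h) (e : Vec N) :
    IsLocBdd fun s x => (inner ℝ (h s x) e : ℝ) :=
  hh.inner_real (isLocBdd_of_continuous continuous_const)

theorem IsLocBdd.sum {ι : Type*} (S : Finset ι) {h : ι → ℝ → Vec N → F}
    (hh : ∀ i, IsLocBdd (h i)) : IsLocBdd fun s x => ∑ i ∈ S, h i s x := by
  classical
  induction S using Finset.induction_on with
  | empty => simpa using isLocBdd_of_continuous (N := N) (continuous_const (y := (0 : F)))
  | insert a S ha ih => simpa [Finset.sum_insert ha] using (hh a).add ih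

/-- Directional derivatives of a Carathéodory field have a jointly measurable modification: the
limit of difference quotients. -/
theorem IsCaratheodory.isLocBdd_fderiv [FiniteDimensional ℝ F] {v : ℝ → Vec N → F}
    (hv : IsCaratheodory v) (e : Vec N) : IsLocBdd fun s x => fderiv ℝ (v s) x e where
  exists_modification := by
    have : CompleteSpace F := FiniteDimensional.complete ℝ F
    set d : ℕ → ℝ × Vec N → F := fun n q =>
      ((n : ℝ) + 1) • (v q.1 (q.2 + ((n : ℝ) + 1)⁻¹ • e) - v q.1 q.2) with hd
    have hdm : ∀ n, StronglyMeasurable (d n) := fun n => by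
      refine StronglyMeasurable.const_smul (StronglyMeasurable.sub ?_ hv.stronglyMeasurable) _
      exact hv.stronglyMeasurable.comp_measurable
        (measurable_fst.prodMk (measurable_snd.add_const (((n : ℝ) + 1)⁻¹ • e)))
    refine ⟨fun q => limUnder atTop fun n => d n q, StronglyMeasurable.limUnder hdm, fun s => ?_⟩
    filter_upwards [(hv.locallyLipschitz s).ae_differentiableAt volume] with x hx
    refine (Tendsto.limUnder_eq ?_).symm
    have h1 := (hx.hasFDerivAt.hasLineDerivAt e).tendsto_slope_zero_right
    have h2 : Tendsto (fun n : ℕ => ((n : ℝ) + 1)⁻¹) atTop (𝓝[>] 0) := by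
      refine tendsto_nhdsWithin_iff.2 ⟨?_, .of_forall fun n => by
        simp only [mem_Ioi]; positivity⟩
      simpa using tendsto_one_div_add_atTop_nhds_zero_nat (𝕜 := ℝ)
    refine (h1.comp h2).congr fun n => ?_
    simp [hd]
  bound R := by
    obtain ⟨L, hL, -⟩ := hv.bound (R + 1)
    refine ⟨L * ‖e‖, fun s x hx => ((fderiv ℝ (v s) x).le_opNorm e).trans ?_⟩
    gcongr
    exact norm_fderiv_le_of_lipschitzOnWith (hL s) (by linarith)

theorem IsCaratheodory.isLocBdd_divergence {v : ℝ → Vec N → Vec N} (hv : IsCaratheodory v) :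
    IsLocBdd fun s x => divergence (v s) x :=
  IsLocBdd.sum Finset.univ fun i =>
    (hv.isLocBdd_fderiv (EuclideanSpace.single i 1)).clm_comp (EuclideanSpace.proj (𝕜 := ℝ) i)

section Integral

variable [FiniteDimensional ℝ F]

theorem IsLocBdd.aestronglyMeasurable {h : ℝ → Vec N → F} (hh : IsLocBdd h) (s : ℝ) :
    AEStronglyMeasurable (h s) := by
  obtain ⟨H, hH, hhH⟩ := hh.exists_modification
  exact (hH.comp_measurable measurable_prodMk_left).aestronglyMeasurable.congr
    (Filter.EventuallyEq.symm (hhH s))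

theorem IsLocBdd.locallyIntegrable {h : ℝ → Vec N → F} (hh : IsLocBdd h) (s : ℝ) :
    LocallyIntegrable (h s) :=
  locallyIntegrable_of_bound (hh.aestronglyMeasurable s) fun R =>
    (hh.bound R).imp fun _ hC => .of_forall fun x hx => hC s x hx

theorem IsLocBdd.integrable {h : ℝ → Vec N → F} (hh : IsLocBdd h) {R : ℝ}
    (hR : ∀ s x, R < ‖x‖ → h s x = 0) (s : ℝ) : Integrable (h s) := by
  obtain ⟨C, hC⟩ := hh.bound R
  exact integrable_of_bound_of_support (hh.aestronglyMeasurable s) R C (hC s) (hR s)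

theorem IsLocBdd.stronglyMeasurable_integral {h : ℝ → Vec N → F} (hh : IsLocBdd h) :
    StronglyMeasurable fun s => ∫ x, h s x := by
  obtain ⟨H, hH, hhH⟩ := hh.exists_modification
  have : (fun s => ∫ x, h s x) = fun s => ∫ x, H (s, x) :=
    funext fun s => integral_congr_ae (hhH s)
  rw [this]
  exact hH.integral_prod_right'

theorem IsLocBdd.exists_norm_integral_le {h : ℝ → Vec N → F} (hh : IsLocBdd h) {R : ℝ}
    (hR : ∀ s x, R < ‖x‖ → h s x = 0) : ∃ C, ∀ s, ‖∫ x, h s x‖ ≤ C := by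
  obtain ⟨C, hC⟩ := hh.bound R
  refine ⟨∫ x, indicator (closedBall (0 : Vec N) R) (fun _ => C) x, fun s => ?_⟩
  refine norm_integral_le_of_norm_le ((integrable_indicator_iff
    isClosed_closedBall.measurableSet).2 (integrableOn_const
      (isCompact_closedBall _ _).measure_lt_top.ne)) (.of_forall fun x => ?_)
  by_cases hx : x ∈ closedBall (0 : Vec N) R
  · rw [indicator_of_mem hx]
    exact hC s x (by simpa using hx)
  · rw [indicator_of_notMem hx, hR s x (by simpa using hx), norm_zero]

theorem intervalIntegrable_of_bound {h : ℝ → F} (hm : StronglyMeasurable h) {C : ℝ}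
    (hC : ∀ s, ‖h s‖ ≤ C) (a b : ℝ) : IntervalIntegrable h volume a b :=
  (intervalIntegrable_const (c := C)).mono_fun' hm.aestronglyMeasurable
    (.of_forall hC)

theorem IsLocBdd.intervalIntegrable_integral {h : ℝ → Vec N → F} (hh : IsLocBdd h) {R : ℝ}
    (hR : ∀ s x, R < ‖x‖ → h s x = 0) (a b : ℝ) :
    IntervalIntegrable (fun s => ∫ x, h s x) volume a b := by
  obtain ⟨C, hC⟩ := hh.exists_norm_integral_le hR
  exact intervalIntegrable_of_bound hh.stronglyMeasurable_integral hC a b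

end Integral

theorem exists_eq_zero_of_hasCompactSupport {ψ : Vec N → F} (hψc : HasCompactSupport ψ) :
    ∃ R : ℝ, ∀ x, R < ‖x‖ → ψ x = 0 := by
  obtain ⟨R, hR⟩ := hψc.isCompact.isBounded.subset_closedBall 0
  refine ⟨R, fun x hx => ?_⟩
  by_contra hne
  have h1 := hR (subset_tsupport _ hne)
  rw [mem_closedBall_zero_iff] at h1
  linarith

/-- The weak form of the zeroth order and transport terms of the costate system, tested with a
function `ψ` of the space variable, in the direction `e`. -/
noncomputable def transportIntegrand (v q : ℝ → Vec N → Vec N) (e : Vec N) (ψ : Vec N → ℝ) (s : ℝ)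
    (x : Vec N) : ℝ :=
  inner ℝ (q s x) e * (fderiv ℝ ψ x (v s x) + ψ x * divergence (v s) x)
    - ψ x * inner ℝ (q s x) (fderiv ℝ (v s) x e)

theorem isLocBdd_transportIntegrand {v q : ℝ → Vec N → Vec N} (hv : IsCaratheodory v)
    (hq : IsLocBdd q) (e : Vec N) {ψ : Vec N → ℝ} (hψ : ContDiff ℝ 1 ψ) :
    IsLocBdd (transportIntegrand v q e ψ) :=
  ((hq.inner_const e).mul
    (((isLocBdd_of_continuous (hψ.continuous_fderiv one_ne_zero)).clm_apply hv.isLocBdd).add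
      ((isLocBdd_of_continuous hψ.continuous).mul hv.isLocBdd_divergence))).sub
    ((isLocBdd_of_continuous hψ.continuous).mul (hq.inner_real (hv.isLocBdd_fderiv e)))

theorem exists_transportIntegrand_eq_zero (v q : ℝ → Vec N → Vec N) (e : Vec N) {ψ : Vec N → ℝ}
    (hψc : HasCompactSupport ψ) :
    ∃ R : ℝ, ∀ s x, R < ‖x‖ → transportIntegrand v q e ψ s x = 0 := by
  obtain ⟨R, hR⟩ := exists_eq_zero_of_hasCompactSupport hψc
  obtain ⟨R', hR'⟩ := exists_eq_zero_of_hasCompactSupport (hψc.fderiv (𝕜 := ℝ))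
  refine ⟨max R R', fun s x hx => ?_⟩
  simp [transportIntegrand, hR x ((le_max_left _ _).trans_lt hx),
    hR' x ((le_max_right _ _).trans_lt hx)]

end LocBdd

/-! ### The gradient of the value function solves the homogeneous transport system -/

section ValueGradient

variable {N : ℕ} {T : ℝ}

/-- A measurable function which is bounded on `[a, b] × ℝᴺ` and vanishes there outside the ball of
radius `R`. -/
structure IsTubeBounded (a b R : ℝ) (h : ℝ → Vec N → ℝ) : Prop where
  stronglyMeasurable : StronglyMeasurable fun q : ℝ × Vec N => h q.1 q.2
  bound : ∃ C : ℝ, ∀ s ∈ Icc a b, ∀ x, ‖x‖ ≤ R → ‖h s x‖ ≤ C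
  eq_zero : ∀ s ∈ Icc a b, ∀ x, R < ‖x‖ → h s x = 0

namespace IsTubeBounded

variable {a b R : ℝ} {h k : ℝ → Vec N → ℝ}

theorem mono (hh : IsTubeBounded a b R h) {c d : ℝ} (hac : a ≤ c) (hdb : d ≤ b) :
    IsTubeBounded c d R h where
  stronglyMeasurable := hh.stronglyMeasurable
  bound := hh.bound.imp fun _ hC s hs => hC s ⟨hac.trans hs.1, hs.2.trans hdb⟩
  eq_zero s hs := hh.eq_zero s ⟨hac.trans hs.1, hs.2.trans hdb⟩

theorem add (hh : IsTubeBounded a b R h) (hk : IsTubeBounded a b R k) :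
    IsTubeBounded a b R fun s x => h s x + k s x where
  stronglyMeasurable := hh.stronglyMeasurable.add hk.stronglyMeasurable
  bound := by
    obtain ⟨C, hC⟩ := hh.bound
    obtain ⟨D, hD⟩ := hk.bound
    exact ⟨C + D, fun s hs x hx => (norm_add_le _ _).trans
      (add_le_add (hC s hs x hx) (hD s hs x hx))⟩
  eq_zero s hs x hx := by rw [hh.eq_zero s hs x hx, hk.eq_zero s hs x hx, add_zero]

theorem mul (hh : IsTubeBounded a b R h)
    (hk : StronglyMeasurable fun q : ℝ × Vec N => k q.1 q.2)
    (hkb : ∃ C : ℝ, ∀ s ∈ Icc a b, ∀ x, ‖x‖ ≤ R → ‖k s x‖ ≤ C) :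
    IsTubeBounded a b R fun s x => k s x * h s x where
  stronglyMeasurable := hk.mul hh.stronglyMeasurable
  bound := by
    obtain ⟨C, hC⟩ := hh.bound
    obtain ⟨D, hD⟩ := hkb
    refine ⟨D * C, fun s hs x hx => ?_⟩
    rw [norm_mul]
    exact mul_le_mul (hD s hs x hx) (hC s hs x hx) (norm_nonneg _)
      ((norm_nonneg _).trans (hD s hs x hx))
  eq_zero s hs x hx := by rw [hh.eq_zero s hs x hx, mul_zero]

theorem const_mul (hh : IsTubeBounded a b R h) (c : ℝ) :
    IsTubeBounded a b R fun s x => c * h s x :=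
  hh.mul (k := fun _ _ => c) stronglyMeasurable_const ⟨‖c‖, fun _ _ _ _ => le_rfl⟩

theorem integrable_prod (hh : IsTubeBounded a b R h) :
    Integrable (Function.uncurry h) ((volume.restrict (Icc a b)).prod volume) := by
  obtain ⟨C, hC⟩ := hh.bound
  have hfin : ((volume : Measure ℝ).prod (volume : Measure (Vec N)))
      (Icc a b ×ˢ closedBall (0 : Vec N) R) ≠ ⊤ := by
    rw [Measure.prod_prod]
    exact ENNReal.mul_ne_top (by simp) (isCompact_closedBall _ _).measure_lt_top.ne
  have h1 : IntegrableOn (Function.uncurry h) (Icc a b ×ˢ closedBall (0 : Vec N) R)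
      ((volume : Measure ℝ).prod volume) := by
    refine Measure.integrableOn_of_bounded (M := C) hfin
      hh.stronglyMeasurable.aestronglyMeasurable ?_
    rw [ae_restrict_iff' (measurableSet_Icc.prod isClosed_closedBall.measurableSet)]
    exact .of_forall fun q hq => hC q.1 hq.1 q.2 (by simpa using hq.2)
  have h2 := h1.of_forall_sdiff_eq_zero (t := Icc a b ×ˢ univ)
    (measurableSet_Icc.prod MeasurableSet.univ) fun q hq => by
      refine hh.eq_zero q.1 hq.1.1 q.2 ?_
      by_contra hx
      exact hq.2 ⟨hq.1.1, by simpa using hx⟩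
  rwa [IntegrableOn, ← Measure.prod_restrict, Measure.restrict_univ] at h2

theorem integral_swap (hh : IsTubeBounded a b R h) (hab : a ≤ b) :
    ∫ s in a..b, ∫ x, h s x = ∫ x, ∫ s in a..b, h s x := by
  refine intervalIntegral_integral_swap ?_
  rw [uIoc_of_le hab, restrict_Ioc_eq_restrict_Icc]
  exact hh.integrable_prod

theorem integrable (hh : IsTubeBounded a b R h) {s : ℝ} (hs : s ∈ Icc a b) :
    Integrable (h s) := by
  obtain ⟨C, hC⟩ := hh.bound
  exact integrable_of_bound_of_support
    (hh.stronglyMeasurable.comp_measurable measurable_prodMk_left).aestronglyMeasurable R C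
    (hC s hs) (hh.eq_zero s hs)

theorem intervalIntegrable_integral (hh : IsTubeBounded a b R h) (hab : a ≤ b) :
    IntervalIntegrable (fun s => ∫ x, h s x) volume a b := by
  rw [intervalIntegrable_iff_integrableOn_Icc_of_le hab]
  exact hh.integrable_prod.integral_prod_left

end IsTubeBounded

/-- The gradient in space of a time dependent function. -/
noncomputable def spaceGrad (w : ℝ → Vec N → ℝ) (s : ℝ) (x : Vec N) : Vec N :=
  gradient (w s) x

theorem inner_spaceGrad (w : ℝ → Vec N → ℝ) (s : ℝ) (x e : Vec N) :
    inner ℝ (spaceGrad w s x) e = fderiv ℝ (w s) x e := by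
  simp [spaceGrad, gradient]

theorem stronglyMeasurable_spaceGrad {w : ℝ → Vec N → ℝ}
    (hw : Continuous fun q : ℝ × Vec N => w q.1 q.2) :
    StronglyMeasurable fun q : ℝ × Vec N => spaceGrad w q.1 q.2 :=
  ((InnerProductSpace.toDual ℝ (Vec N)).symm.continuous.measurable.comp
    (measurable_fderiv_with_param ℝ hw)).stronglyMeasurable

theorem exists_norm_spaceGrad_le {w : ℝ → Vec N → ℝ} (hw : IsCaratheodory w) (R : ℝ) :
    ∃ C : ℝ, ∀ s x, ‖x‖ ≤ R → ‖spaceGrad w s x‖ ≤ C := by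
  obtain ⟨L, hL, -⟩ := hw.bound (R + 1)
  refine ⟨L, fun s x hx => ?_⟩
  rw [spaceGrad, gradient, LinearIsometryEquiv.norm_map]
  exact norm_fderiv_le_of_lipschitzOnWith (hL s) (by linarith)

/-- A locally Lipschitz solution `w` of `w_t + ∇w v + l = 0`: its gradient satisfies the linear
transport system, in a form which is integrated in time and weak in space. -/
theorem integral_mul_spaceGrad_eq {w : ℝ → Vec N → ℝ} {v : ℝ → Vec N → Vec N}
    {l : ℝ → Vec N → ℝ} (hw : LocallyLipschitz fun q : ℝ × Vec N => w q.1 q.2)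
    (hwc : IsCaratheodory w) (hv : IsCaratheodory v) (hl : IsCaratheodory l)
    (hd : ∀ᵐ q : ℝ × Vec N, DifferentiableAt ℝ (fun q : ℝ × Vec N => w q.1 q.2) q)
    (heq : ∀ᵐ s ∂volume.restrict (Icc 0 T), ∀ᵐ x,
      fderiv ℝ (fun q : ℝ × Vec N => w q.1 q.2) (s, x) (1, 0)
        + fderiv ℝ (w s) x (v s x) + l s x = 0)
    {ψ : Vec N → ℝ} (hψ : ContDiff ℝ ∞ ψ) (hψc : HasCompactSupport ψ) (e : Vec N) {t : ℝ}
    (ht : t ∈ Icc 0 T) :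
    ∫ x, ψ x * inner ℝ (spaceGrad w t x) e
      = (∫ x, ψ x * fderiv ℝ (w T) x e)
        - ∫ s in t..T, ((∫ x, transportIntegrand v (spaceGrad w) e ψ s x)
          - ∫ x, ψ x * fderiv ℝ (l s) x e) := by
  have hψ1 : ContDiff ℝ 1 ψ := hψ.of_le (by exact_mod_cast le_top)
  have hψl : LocallyLipschitz ψ := hψ1.locallyLipschitz
  have hψe : ContDiff ℝ 1 fun x => fderiv ℝ ψ x e :=
    (hψ.fderiv_right (m := 1) (by norm_cast)).clm_apply contDiff_const
  have hψec : HasCompactSupport fun x => fderiv ℝ ψ x e := hψc.fderiv_apply (𝕜 := ℝ) e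
  set W : ℝ × Vec N → ℝ := fun q => w q.1 q.2 with hW
  obtain ⟨R, hR⟩ := exists_eq_zero_of_hasCompactSupport hψec
  -- the increments of `w` in time are integrals of the time derivative
  have hinc : ∀ᵐ x, w T x - w t x = ∫ s in t..T, fderiv ℝ W (s, x) (1, 0) := by
    have hd' : ∀ᵐ x : Vec N, ∀ᵐ s : ℝ, DifferentiableAt ℝ W (s, x) := by
      refine Measure.ae_ae_of_ae_prod (μ := (volume : Measure (Vec N))) (ν := volume)
        (p := fun q => DifferentiableAt ℝ W (q.2, q.1)) ?_
      have := (Measure.measurePreserving_swap (μ := (volume : Measure (Vec N)))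
        (ν := (volume : Measure ℝ))).quasiMeasurePreserving.ae hd
      exact this
    filter_upwards [hd'] with x hx
    have hlip : LocallyLipschitz fun s => w s x :=
      hw.comp (f := W) (g := fun s => (s, x)) (LocallyLipschitz.id.prodMk (LocallyLipschitz.const x))
    obtain ⟨C, hC⟩ := (hlip.locallyLipschitzOn (s := uIcc t T)).exists_lipschitzOnWith_of_compact
      isCompact_uIcc
    rw [← hC.absolutelyContinuousOnInterval.integral_deriv_eq_sub]
    refine intervalIntegral.integral_congr_ae ?_
    filter_upwards [hx] with s hs _
    have h1 : HasDerivAt (fun s : ℝ => (s, x)) ((1 : ℝ), (0 : Vec N)) s :=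
      (hasDerivAt_id s).prodMk (hasDerivAt_const s x)
    exact (hs.hasFDerivAt.comp_hasDerivAt s h1).deriv
  have hIBP : ∀ a : Vec N → ℝ, LocallyLipschitz a →
      ∫ x, ψ x * fderiv ℝ a x e = -∫ x, a x * fderiv ℝ ψ x e := fun a ha => by
    rw [← integral_fderiv_mul_eq_neg ha hψl hψc e]
    simp [mul_comm]
  have hint : ∀ s, Integrable fun x => w s x * fderiv ℝ ψ x e := fun s =>
    integrable_mul_of_hasCompactSupport (hwc.locallyLipschitz s).continuous.locallyIntegrable
      hψe.continuous hψec
  have h1 : (∫ x, ψ x * fderiv ℝ (w T) x e) - ∫ x, ψ x * fderiv ℝ (w t) x e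
      = -∫ x, ∫ s in t..T, fderiv ℝ W (s, x) (1, 0) * fderiv ℝ ψ x e := by
    rw [hIBP _ (hwc.locallyLipschitz T), hIBP _ (hwc.locallyLipschitz t), sub_neg_eq_add,
      neg_add_eq_sub, ← neg_sub, ← integral_sub (hint T) (hint t), neg_inj]
    refine integral_congr_ae ?_
    filter_upwards [hinc] with x hx
    rw [intervalIntegral.integral_mul_const, ← hx, sub_mul]
  have h2 : ∫ s in t..T, ∫ x, fderiv ℝ W (s, x) (1, 0) * fderiv ℝ ψ x e
      = ∫ x, ∫ s in t..T, fderiv ℝ W (s, x) (1, 0) * fderiv ℝ ψ x e := by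
    obtain ⟨C, hC⟩ := hw.exists_norm_fderiv_le (max (|t| + |T|) R)
    obtain ⟨D, hD⟩ := hψec.exists_bound_of_continuous hψe.continuous
    have hC' : ∀ s ∈ Icc t T, ∀ x : Vec N, ‖x‖ ≤ R →
        ‖fderiv ℝ W (s, x) (1, 0) * fderiv ℝ ψ x e‖ ≤ C * D := fun s hs x hx => by
      have hs' : |s| ≤ |t| + |T| := by
        rw [abs_le]
        constructor <;> linarith [neg_abs_le t, le_abs_self T, abs_nonneg t, abs_nonneg T,
          hs.1, hs.2]
      have hq : ‖fderiv ℝ W (s, x)‖ ≤ C := hC _ (by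
        rw [Prod.norm_def]
        exact max_le_max hs' hx)
      rw [norm_mul]
      refine mul_le_mul ?_ (hD x) (norm_nonneg _) ((norm_nonneg _).trans hq)
      refine ((fderiv ℝ W (s, x)).le_opNorm _).trans ?_
      simpa [Prod.norm_def] using hq
    refine IsTubeBounded.integral_swap ⟨?_, ⟨_, hC'⟩, fun s _ x hx => by simp [hR x hx]⟩ ht.2
    exact ((measurable_fderiv_apply_const ℝ W (1, 0)).mul
      (hψe.continuous.measurable.comp measurable_snd)).stronglyMeasurable
  have h3 : ∫ s in t..T, ∫ x, fderiv ℝ W (s, x) (1, 0) * fderiv ℝ ψ x e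
      = -∫ s in t..T, ((∫ x, transportIntegrand v (spaceGrad w) e ψ s x)
          - ∫ x, ψ x * fderiv ℝ (l s) x e) := by
    rw [← intervalIntegral.integral_neg]
    have heq' := (ae_restrict_iff' measurableSet_Icc).1 heq
    refine intervalIntegral.integral_congr_ae ?_
    filter_upwards [heq'] with s hs hst
    rw [uIoc_of_le ht.2] at hst
    have hs := hs ⟨ht.1.trans hst.1.le, hst.2⟩
    have e1 : ∫ x, transportIntegrand v (spaceGrad w) e ψ s x
        = ∫ x, fderiv ℝ (w s) x (v s x) * fderiv ℝ ψ x e := by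
      rw [integral_transport_eq (hwc.locallyLipschitz s) (hv.locallyLipschitz s) hψ1 hψc e]
      simp [transportIntegrand, inner_spaceGrad]
    have hi1 : Integrable fun x => fderiv ℝ (w s) x (v s x) * fderiv ℝ ψ x e := by
      have h := ((isLocBdd_of_continuous hψe.continuous).mul
        ((IsLocBdd.inner_real (h := spaceGrad w) ⟨⟨_, stronglyMeasurable_spaceGrad hw.continuous,
          fun s => .of_forall fun x => rfl⟩, exists_norm_spaceGrad_le hwc⟩ hv.isLocBdd))).integrable
          (R := R) (fun s x hx => by simp [hR x hx]) s
      simpa [inner_spaceGrad, mul_comm] using h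
    have hi2 : Integrable fun x => l s x * fderiv ℝ ψ x e :=
      integrable_mul_of_hasCompactSupport (hl.locallyLipschitz s).continuous.locallyIntegrable
        hψe.continuous hψec
    rw [e1, hIBP _ (hl.locallyLipschitz s), sub_neg_eq_add, ← integral_add hi1 hi2,
      ← integral_neg]
    refine integral_congr_ae ?_
    filter_upwards [hs] with x hx
    linear_combination (fderiv ℝ ψ x e) * hx
  have h4 : ∫ x, ψ x * inner ℝ (spaceGrad w t x) e = ∫ x, ψ x * fderiv ℝ (w t) x e := by
    simp [inner_spaceGrad]
  rw [h4]
  linarith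

end ValueGradient

/-! ### The costate system, integrated in time -/

section Costate

variable {N m : ℕ} {T : ℝ}

/-- A primitive of a smooth function compactly supported in `(0, T)`, cut off beyond `T`. -/
theorem exists_smooth_primitive (hT : 0 < T) {b : ℝ → ℝ} (hb : ContDiff ℝ ∞ b)
    (hbT : tsupport b ⊆ Ioo 0 T) : ∃ a : ℝ → ℝ, ContDiff ℝ ∞ a ∧ HasCompactSupport a ∧
      tsupport a ⊆ Ioi 0 ∧ a 0 = 0 ∧ ∀ t ∈ Icc 0 T, HasDerivAt a (b t) t := by
  obtain ⟨ε, hε, hεb⟩ : ∃ ε > 0, ∀ t < ε, b t = 0 := by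
    by_cases hne : (tsupport b).Nonempty
    · have hc : IsCompact (tsupport b) := isCompact_of_isClosed_isBounded (isClosed_tsupport b)
        ((isBounded_Ioo 0 T).subset hbT)
      obtain ⟨t₀, ht₀, hmin⟩ := hc.exists_isMinOn hne continuousOn_id
      refine ⟨t₀, (hbT ht₀).1, fun t ht => ?_⟩
      by_contra hbt
      exact absurd (hmin (subset_tsupport _ hbt)) (by simpa using ht)
    · refine ⟨1, one_pos, fun t _ => ?_⟩
      by_contra hbt
      exact hne ⟨t, subset_tsupport _ hbt⟩
  set A : ℝ → ℝ := fun t => ∫ s in (0 : ℝ)..t, b s with hA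
  have hAd : ∀ t, HasDerivAt A (b t) t := fun t =>
    intervalIntegral.integral_hasDerivAt_right (hb.continuous.intervalIntegrable _ _)
      (hb.continuous.stronglyMeasurableAtFilter _ _) hb.continuous.continuousAt
  have hAs : ContDiff ℝ ∞ A := by
    rw [contDiff_infty_iff_deriv]
    refine ⟨fun t => (hAd t).differentiableAt, ?_⟩
    rwa [show deriv A = b from funext fun t => (hAd t).deriv]
  have hA0 : ∀ t < ε, A t = 0 := fun t ht => by
    refine intervalIntegral.integral_zero_ae ?_
    refine .of_forall fun s hs => hεb s ?_
    exact (uIoc_subset_uIcc hs).2.trans_lt (max_lt hε ht)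
  set η : ContDiffBump (0 : ℝ) := ⟨T + 1, T + 2, by linarith, by linarith⟩
  refine ⟨fun t => A t * η t, hAs.mul η.contDiff, η.hasCompactSupport.mul_left, ?_, ?_, ?_⟩
  · refine (closure_minimal (t := Ici ε) (fun t ht => ?_) isClosed_Ici).trans
      fun t ht => hε.trans_le ht
    by_contra hlt
    exact ht (by simp [hA0 t (by simpa using hlt)])
  · simp [hA]
  · intro t ht
    have hη : η =ᶠ[𝓝 t] fun _ => 1 := by
      refine η.eventuallyEq_one_of_mem_ball ?_
      rw [mem_ball_zero_iff, Real.norm_eq_abs, abs_of_nonneg ht.1]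
      change t < T + 1
      linarith [ht.2]
    refine (hAd t).congr_of_eventuallyEq ?_
    filter_upwards [hη] with s hs
    simp [hs]

/-- A function of time `μ` such that `∫ a' μ = ∫ a h + a(T) γ` for all test functions is
`γ + ∫_t^T h`. -/
theorem ae_eq_of_forall_integral_deriv (hT : 0 < T) {μ h : ℝ → ℝ} {γ : ℝ}
    (hμ : IntervalIntegrable μ volume 0 T) (hh : IntervalIntegrable h volume 0 T)
    (H : ∀ a : ℝ → ℝ, ContDiff ℝ ∞ a → HasCompactSupport a → tsupport a ⊆ Ioi 0 →
      ∫ t in (0 : ℝ)..T, deriv a t * μ t = (∫ t in (0 : ℝ)..T, a t * h t) + a T * γ) :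
    ∀ᵐ t ∂volume.restrict (Icc 0 T), μ t = γ + ∫ s in t..T, h s := by
  set J : ℝ → ℝ := fun t => γ + ∫ s in t..T, h s with hJ
  have hprim : AbsolutelyContinuousOnInterval (fun t => ∫ s in T..t, h s) 0 T :=
    hh.absolutelyContinuousOnInterval_intervalIntegral (by simp)
  have hJc : ContinuousOn J (Icc 0 T) := by
    have := hprim.continuousOn.neg
    rw [uIcc_of_le hT.le] at this
    refine ((continuousOn_const (c := γ)).add this).congr fun t _ => ?_
    simp [hJ, intervalIntegral.integral_symm t T]
  have hJi : IntervalIntegrable J volume 0 T :=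
    ContinuousOn.intervalIntegrable (by rwa [uIcc_of_le hT.le])
  have hzero : ∀ᵐ t, t ∈ Ioo 0 T → μ t - J t = 0 := by
    refine isOpen_Ioo.ae_eq_zero_of_integral_contDiff_smul_eq_zero ?_ fun b hb hbc hbT => ?_
    · refine IntegrableOn.locallyIntegrableOn ?_
      have := (hμ.sub hJi)
      rw [intervalIntegrable_iff_integrableOn_Ioc_of_le hT.le] at this
      exact this.mono_set Ioo_subset_Ioc_self
    · obtain ⟨a, ha, hac, haT, ha0, had⟩ := exists_smooth_primitive hT hb hbT
      have hsub : Function.support (fun t => b t • (μ t - J t)) ⊆ Ioc 0 T := fun t ht =>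
        Ioo_subset_Ioc_self (hbT (subset_tsupport _ fun h0 => ht (by simp [h0])))
      rw [← setIntegral_eq_integral_of_forall_compl_eq_zero (s := Ioc 0 T) (fun t ht => by
        by_contra hne
        exact ht (hsub hne)), ← intervalIntegral.integral_of_le hT.le]
      have hda : ∀ t ∈ uIcc 0 T, deriv a t = b t := fun t ht =>
        (had t (by rwa [uIcc_of_le hT.le] at ht)).deriv
      have e1 := H a ha hac haT
      rw [intervalIntegral.integral_congr (g := fun t => b t * μ t)
        fun t ht => by simp [hda t ht]] at e1
      -- integration by parts moves the derivative from `a` to the primitive of `h`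
      obtain ⟨C, hC⟩ := ((ha.of_le (m := 1) (by exact_mod_cast le_top)).locallyLipschitz
        |>.locallyLipschitzOn (s := uIcc 0 T)).exists_lipschitzOnWith_of_compact isCompact_uIcc
      have e2 := hC.absolutelyContinuousOnInterval.integral_mul_deriv_eq_deriv_mul hprim
      have e3 : ∫ t in (0 : ℝ)..T, a t * deriv (fun t => ∫ s in T..t, h s) t
          = ∫ t in (0 : ℝ)..T, a t * h t := by
        refine intervalIntegral.integral_congr_ae ?_
        filter_upwards [hh.ae_hasDerivAt_integral] with t ht htm
        rw [(ht (uIoc_subset_uIcc htm) T (by simp)).deriv]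
      have e4 : ∫ t in (0 : ℝ)..T, deriv a t * ∫ s in T..t, h s
          = -∫ t in (0 : ℝ)..T, b t * ∫ s in t..T, h s := by
        rw [← intervalIntegral.integral_neg]
        refine intervalIntegral.integral_congr fun t ht => ?_
        simp only [hda t ht, intervalIntegral.integral_symm t T, mul_neg]
      have e5 : ∫ t in (0 : ℝ)..T, b t = a T := by
        have := intervalIntegral.integral_eq_sub_of_hasDerivAt
          (fun t ht => had t (by rwa [uIcc_of_le hT.le] at ht))
          (hb.continuous.intervalIntegrable 0 T)
        rw [this, ha0, sub_zero]
      have hbh : IntervalIntegrable (fun t => b t * ∫ s in t..T, h s) volume 0 T := by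
        refine ContinuousOn.intervalIntegrable ?_
        rw [uIcc_of_le hT.le]
        refine hb.continuous.continuousOn.mul ?_
        refine (hJc.sub (continuousOn_const (c := γ))).congr fun t _ => ?_
        simp [hJ]
      have e6 : ∫ t in (0 : ℝ)..T, b t * J t = a T * γ + ∫ t in (0 : ℝ)..T, b t * ∫ s in t..T, h s
          := by
        rw [← e5, ← intervalIntegral.integral_mul_const, ← intervalIntegral.integral_add
          (Continuous.intervalIntegrable (by fun_prop) _ _) hbh]
        exact intervalIntegral.integral_congr fun t _ => mul_add _ _ _
      simp only [smul_eq_mul, mul_sub]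
      rw [intervalIntegral.integral_sub (hμ.continuousOn_mul hb.continuous.continuousOn)
        (hJi.continuousOn_mul hb.continuous.continuousOn), e1, e6]
      rw [e3, e4] at e2
      simp only [intervalIntegral.integral_same, mul_zero, ha0, zero_mul, sub_zero] at e2
      linarith
  rw [ae_restrict_iff' measurableSet_Icc]
  have hne : ∀ c : ℝ, ∀ᵐ t, t ≠ c := fun c => by simp [ae_iff, measure_singleton]
  filter_upwards [hzero, hne 0, hne T] with t ht h0 h1 hm
  exact sub_eq_zero.1 (ht ⟨lt_of_le_of_ne hm.1 h0.symm, lt_of_le_of_ne hm.2 h1⟩)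

/-- A costate has a modification that is measurable and bounded on bounded sets everywhere. -/
theorem IsCostate.exists_modification {F : Vec N → Vec m → ℝ} {f : Vec N → Vec m → Vec N}
    {g : Vec N → ℝ} {u : ℝ → Vec N → Vec m} {p : ℝ → Vec N → Vec N} (hp : IsCostate T F f g u p) :
    ∃ p' : ℝ → Vec N → Vec N, StronglyMeasurable (fun q : ℝ × Vec N => p' q.1 q.2) ∧
      (∀ R : ℝ, ∃ C : ℝ, ∀ s x, ‖x‖ ≤ R → ‖p' s x‖ ≤ C) ∧
      ∀ᵐ t ∂volume.restrict (Icc 0 T), ∀ᵐ x, p' t x = p t x := by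
  classical
  obtain ⟨P, hP, hPp⟩ := hp.aestronglyMeasurable
  choose C hC using fun n : ℕ => hp.locallyBounded n
  set D : ℕ → ℝ := fun n => ∑ k ∈ Finset.range (n + 1), |C k| with hD
  have hDmono : Monotone D := fun i j hij =>
    Finset.sum_le_sum_of_subset_of_nonneg (Finset.range_subset_range.2 (by omega))
      fun _ _ _ => abs_nonneg _
  have hCD : ∀ n, C n ≤ D n := fun n => (le_abs_self _).trans
    (Finset.single_le_sum (f := fun k => |C k|) (fun _ _ => abs_nonneg _)
      (Finset.self_mem_range_succ n))
  set S : Set (ℝ × Vec N) := {q | ‖P q‖ ≤ D ⌈‖q.2‖⌉₊} with hS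
  have hSm : MeasurableSet S := by
    refine measurableSet_le hP.measurable.norm ?_
    exact (measurable_from_nat (f := D)).comp (Nat.measurable_ceil.comp measurable_snd.norm)
  refine ⟨fun s x => S.indicator P (s, x), hP.indicator hSm, fun R => ⟨D ⌈R⌉₊, fun s x hx => ?_⟩,
    ?_⟩
  · change ‖S.indicator P (s, x)‖ ≤ _
    by_cases hq : (s, x) ∈ S
    · rw [indicator_of_mem hq]
      exact hq.trans (hDmono (Nat.ceil_mono hx))
    · rw [indicator_of_notMem hq, norm_zero]
      exact Finset.sum_nonneg fun _ _ => abs_nonneg _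
  · refine Measure.ae_ae_of_ae_prod (p := fun q => S.indicator P q = p q.1 q.2) ?_
    filter_upwards [hPp, ae_all_iff.2 hC] with q hq hqC
    rw [indicator_of_mem, ← hq]
    rw [hS, mem_ofPred_eq, ← hq]
    exact (hqC _ (Nat.le_ceil _)).trans (hCD _)

theorem integrable_transportIntegrand {v q : ℝ → Vec N → Vec N} (hv : IsCaratheodory v)
    (hq : IsLocBdd q) (e : Vec N) {ψ : Vec N → ℝ} (hψ : ContDiff ℝ 1 ψ) (hψc : HasCompactSupport ψ)
    (s : ℝ) : Integrable (transportIntegrand v q e ψ s) := by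
  obtain ⟨R, hR⟩ := exists_transportIntegrand_eq_zero v q e hψc
  exact (isLocBdd_transportIntegrand hv hq e hψ).integrable hR s

theorem intervalIntegrable_transportIntegrand {v q : ℝ → Vec N → Vec N} (hv : IsCaratheodory v)
    (hq : IsLocBdd q) (e : Vec N) {ψ : Vec N → ℝ} (hψ : ContDiff ℝ 1 ψ) (hψc : HasCompactSupport ψ)
    (a b : ℝ) :
    IntervalIntegrable (fun s => ∫ x, transportIntegrand v q e ψ s x) volume a b := by
  obtain ⟨R, hR⟩ := exists_transportIntegrand_eq_zero v q e hψc
  exact (isLocBdd_transportIntegrand hv hq e hψ).intervalIntegrable_integral hR a b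

theorem IsLocBdd.intervalIntegrable_integral_mul {h : ℝ → Vec N → ℝ} (hh : IsLocBdd h)
    {ψ : Vec N → ℝ} (hψ : Continuous ψ) (hψc : HasCompactSupport ψ) (a b : ℝ) :
    IntervalIntegrable (fun s => ∫ x, ψ x * h s x) volume a b := by
  obtain ⟨R, hR⟩ := exists_eq_zero_of_hasCompactSupport hψc
  exact ((isLocBdd_of_continuous hψ).mul hh).intervalIntegrable_integral
    (R := R) (fun s x hx => by simp [hR x hx]) a b

/-- The costate system in a form which is integrated in time and weak in space. -/
theorem IsCostate.ae_integral_mul_eq (hT : 0 < T) {F : Vec N → Vec m → ℝ}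
    {f : Vec N → Vec m → Vec N} {g : Vec N → ℝ} {u u' : ℝ → Vec N → Vec m}
    {p p' : ℝ → Vec N → Vec N} (hp : IsCostate T F f g u p)
    (hu' : ∀ᵐ t ∂volume.restrict (Icc 0 T), u' t = u t)
    (hp' : ∀ᵐ t ∂volume.restrict (Icc 0 T), ∀ᵐ x, p' t x = p t x) (hp'b : IsLocBdd p')
    (hv : IsCaratheodory fun t x => f x (u' t x)) (hl : IsCaratheodory fun t x => F x (u' t x))
    {ψ : Vec N → ℝ} (hψ : ContDiff ℝ ∞ ψ) (hψc : HasCompactSupport ψ) (e : Vec N) :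
    ∀ᵐ t ∂volume.restrict (Icc 0 T), ∫ x, ψ x * inner ℝ (p' t x) e
      = -(∫ x, ψ x * fderiv ℝ g x e)
        + ∫ s in t..T, -((∫ x, transportIntegrand (fun t x => f x (u' t x)) p' e ψ s x)
          + ∫ x, ψ x * fderiv ℝ (fun y => F y (u' s y)) x e) := by
  have hψ1 : ContDiff ℝ 1 ψ := hψ.of_le (by exact_mod_cast le_top)
  have hμi := (hp'b.inner_const e).intervalIntegrable_integral_mul hψ.continuous hψc 0 T
  have hβi := intervalIntegrable_transportIntegrand hv hp'b e hψ1 hψc 0 T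
  have hσi := (hl.isLocBdd_fderiv e).intervalIntegrable_integral_mul hψ.continuous hψc 0 T
  refine ae_eq_of_forall_integral_deriv hT hμi (hβi.add hσi).neg fun a ha hac ha0 => ?_
  have hsupp : tsupport (fun q : ℝ × Vec N => a q.1 * ψ q.2) ⊆ {q | 0 < q.1} := by
    refine (tsupport_mul_subset_left (f := fun q : ℝ × Vec N => a q.1)).trans ?_
    exact (tsupport_comp_subset_preimage a continuous_fst).trans fun q hq => ha0 hq
  have hcomp : HasCompactSupport fun q : ℝ × Vec N => a q.1 * ψ q.2 := by
    refine HasCompactSupport.intro (hac.isCompact.prod hψc.isCompact) fun q hq => ?_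
    by_contra hne
    exact hq ⟨subset_tsupport _ (left_ne_zero_of_mul hne),
      subset_tsupport _ (right_ne_zero_of_mul hne)⟩
  have hw := hp.weak_eq (fun t x => a t * ψ x)
    ((ha.comp contDiff_fst).mul (hψ.comp contDiff_snd)) hcomp hsupp e
  have hda : Differentiable ℝ a := ha.differentiable (by simp)
  have e1 : ∫ t in (0 : ℝ)..T, ∫ x,
        (- inner ℝ (p t x) e *
            (deriv (fun s => a s * ψ x) t
              + fderiv ℝ (fun x => a t * ψ x) x (f x (u t x))
              + (a t * ψ x) * divergence (fun y => f y (u t y)) x)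
          + (a t * ψ x) * inner ℝ (p t x) (fderiv ℝ (fun y => f y (u t y)) x e))
      = ∫ t in (0 : ℝ)..T, (-(deriv a t * ∫ x, ψ x * inner ℝ (p' t x) e)
          - a t * ∫ x, transportIntegrand (fun t x => f x (u' t x)) p' e ψ t x) := by
    refine intervalIntegral.integral_congr_ae ?_
    filter_upwards [(ae_restrict_iff' measurableSet_Icc).1 hu',
      (ae_restrict_iff' measurableSet_Icc).1 hp'] with t hut hpt ht
    rw [uIoc_of_le hT.le] at ht
    have hut := hut (Ioc_subset_Icc_self ht)
    have hpt := hpt (Ioc_subset_Icc_self ht)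
    have hi1 : Integrable fun x => ψ x * inner ℝ (p' t x) e := by
      have := integrable_mul_of_hasCompactSupport ((hp'b.inner_const e).locallyIntegrable t)
        hψ.continuous hψc
      simpa only [mul_comm] using this
    have hi2 : Integrable fun x => -(deriv a t * (ψ x * inner ℝ (p' t x) e)) :=
      (hi1.const_mul _).neg
    rw [← integral_const_mul, ← integral_neg, ← integral_const_mul, ← integral_sub hi2
      ((integrable_transportIntegrand hv hp'b e hψ1 hψc t).const_mul _)]
    refine integral_congr_ae ?_
    filter_upwards [hpt] with x hx
    rw [deriv_mul_const hda.differentiableAt,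
      fderiv_const_mul (hψ1.differentiable one_ne_zero).differentiableAt, ← hx, ← hut]
    simp only [_root_.smul_apply, smul_eq_mul, transportIntegrand]
    ring
  have e2 : ∫ t in (0 : ℝ)..T, ∫ x, (a t * ψ x) * fderiv ℝ (fun y => F y (u t y)) x e
      = ∫ t in (0 : ℝ)..T, a t * ∫ x, ψ x * fderiv ℝ (fun y => F y (u' t y)) x e := by
    refine intervalIntegral.integral_congr_ae ?_
    filter_upwards [(ae_restrict_iff' measurableSet_Icc).1 hu'] with t hut ht
    rw [uIoc_of_le hT.le] at ht
    rw [hut (Ioc_subset_Icc_self ht), ← integral_const_mul]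
    simp [mul_assoc]
  have e3 : ∫ x, (a T * ψ x) * fderiv ℝ g x e = a T * ∫ x, ψ x * fderiv ℝ g x e := by
    rw [← integral_const_mul]
    simp [mul_assoc]
  have hac' : ContinuousOn a (uIcc 0 T) := ha.continuous.continuousOn
  have hdac : ContinuousOn (deriv a) (uIcc 0 T) :=
    (ha.continuous_deriv (by simp)).continuousOn
  have hμn : IntervalIntegrable (fun t => -(deriv a t * ∫ x, ψ x * inner ℝ (p' t x) e))
      volume 0 T := (hμi.continuousOn_mul hdac).neg
  rw [e1, e2, e3, intervalIntegral.integral_sub hμn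
    (hβi.continuousOn_mul hac'), intervalIntegral.integral_neg] at hw
  have e4 : ∫ t in (0 : ℝ)..T, a t * -((∫ x, transportIntegrand (fun t x => f x (u' t x)) p' e ψ t x)
          + ∫ x, ψ x * fderiv ℝ (fun y => F y (u' t y)) x e)
      = -((∫ t in (0 : ℝ)..T, a t * ∫ x, transportIntegrand (fun t x => f x (u' t x)) p' e ψ t x)
        + ∫ t in (0 : ℝ)..T, a t * ∫ x, ψ x * fderiv ℝ (fun y => F y (u' t y)) x e) := by
    rw [← intervalIntegral.integral_add (hβi.continuousOn_mul hac') (hσi.continuousOn_mul hac'),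
      ← intervalIntegral.integral_neg]
    simp [mul_add]
  rw [e4]
  linarith

/-- The transport system without source and with zero terminal value, for the field `v`, in a form
which is integrated in time and weak in space. -/
def IsTransported (T : ℝ) (v q : ℝ → Vec N → Vec N) : Prop :=
  ∀ ψ : Vec N → ℝ, ContDiff ℝ ∞ ψ → HasCompactSupport ψ → ∀ e : Vec N,
    ∀ᵐ t ∂volume.restrict (Icc 0 T), ∫ x, ψ x * inner ℝ (q t x) e
      = -∫ s in t..T, ∫ x, transportIntegrand v q e ψ s x

/-- If `w` solves `w_t + ∇w v + l = 0`, `w(T) = g`, then `p + ∇w` solves the transport system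
without source and with zero terminal value. -/
theorem IsCostate.isTransported_add_spaceGrad (hT : 0 < T) {F : Vec N → Vec m → ℝ}
    {f : Vec N → Vec m → Vec N} {g : Vec N → ℝ} {u u' : ℝ → Vec N → Vec m}
    {p p' : ℝ → Vec N → Vec N} (hp : IsCostate T F f g u p)
    (hu' : ∀ᵐ t ∂volume.restrict (Icc 0 T), u' t = u t)
    (hp' : ∀ᵐ t ∂volume.restrict (Icc 0 T), ∀ᵐ x, p' t x = p t x) (hp'b : IsLocBdd p')
    (hv : IsCaratheodory fun t x => f x (u' t x)) (hl : IsCaratheodory fun t x => F x (u' t x))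
    {w : ℝ → Vec N → ℝ} (hw : LocallyLipschitz fun q : ℝ × Vec N => w q.1 q.2)
    (hwc : IsCaratheodory w) (hwT : w T = g)
    (hd : ∀ᵐ q : ℝ × Vec N, DifferentiableAt ℝ (fun q : ℝ × Vec N => w q.1 q.2) q)
    (heq : ∀ᵐ s ∂volume.restrict (Icc 0 T), ∀ᵐ x,
      fderiv ℝ (fun q : ℝ × Vec N => w q.1 q.2) (s, x) (1, 0)
        + fderiv ℝ (w s) x (f x (u' s x)) + F x (u' s x) = 0) :
    IsTransported T (fun t x => f x (u' t x)) fun t x => p' t x + spaceGrad w t x := by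
  intro ψ hψ hψc e
  have hψ1 : ContDiff ℝ 1 ψ := hψ.of_le (by exact_mod_cast le_top)
  have hwb : IsLocBdd (spaceGrad w) := ⟨⟨_, stronglyMeasurable_spaceGrad hw.continuous,
    fun s => .of_forall fun x => rfl⟩, exists_norm_spaceGrad_le hwc⟩
  have hint : ∀ {h : ℝ → Vec N → Vec N}, IsLocBdd h → ∀ t,
      Integrable fun x => ψ x * inner ℝ (h t x) e := fun hh t => by
    have := integrable_mul_of_hasCompactSupport ((hh.inner_const e).locallyIntegrable t)
      hψ.continuous hψc
    simpa only [mul_comm] using this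
  filter_upwards [hp.ae_integral_mul_eq hT hu' hp' hp'b hv hl hψ hψc e,
    ae_restrict_mem measurableSet_Icc] with t h1 ht
  have h2 := integral_mul_spaceGrad_eq hw hwc hv hl hd heq hψ hψc e ht
  have e1 : ∫ x, ψ x * inner ℝ (p' t x + spaceGrad w t x) e
      = (∫ x, ψ x * inner ℝ (p' t x) e) + ∫ x, ψ x * inner ℝ (spaceGrad w t x) e := by
    rw [← integral_add (hint hp'b t) (hint hwb t)]
    simp [inner_add_left, mul_add]
  have e2 : ∀ s, ∫ x, transportIntegrand (fun t x => f x (u' t x))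
        (fun t x => p' t x + spaceGrad w t x) e ψ s x
      = (∫ x, transportIntegrand (fun t x => f x (u' t x)) p' e ψ s x)
        + ∫ x, transportIntegrand (fun t x => f x (u' t x)) (spaceGrad w) e ψ s x := fun s => by
    rw [← integral_add (integrable_transportIntegrand hv hp'b e hψ1 hψc s)
      (integrable_transportIntegrand hv hwb e hψ1 hψc s)]
    refine integral_congr_ae (.of_forall fun x => ?_)
    simp only [transportIntegrand, inner_add_left]
    ring
  have hβ1 := intervalIntegrable_transportIntegrand hv hp'b e hψ1 hψc t T
  have hβ2 := intervalIntegrable_transportIntegrand hv hwb e hψ1 hψc t T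
  have hσ := (hl.isLocBdd_fderiv e).intervalIntegrable_integral_mul hψ.continuous hψc t T
  simp only [e2]
  rw [e1, h1, h2, hwT, intervalIntegral.integral_neg, intervalIntegral.integral_add hβ1 hσ,
    intervalIntegral.integral_sub hβ2 hσ, intervalIntegral.integral_add hβ1 hβ2]
  ring

end Costate

/-! ### Mollification and the commutator estimate -/

section Mollifier

variable {N : ℕ}

/-- `ρ` is a mollifier at scale `δ`: smooth, of integral `1`, supported in the ball of radius `δ`,
with the bounds of the scaling `δ^{-N} ρ₁(z / δ)` in terms of the volume of the ball. -/
structure IsMollifier (C δ : ℝ) (ρ : Vec N → ℝ) : Prop where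
  contDiff : ContDiff ℝ ∞ ρ
  eq_zero : ∀ z, δ < ‖z‖ → ρ z = 0
  integral_eq : ∫ z, ρ z = 1
  abs_le : ∀ z, |ρ z| ≤ C * (volume.real (closedBall (0 : Vec N) δ))⁻¹
  norm_fderiv_le : ∀ z, ‖fderiv ℝ ρ z‖ ≤ C * δ⁻¹ * (volume.real (closedBall (0 : Vec N) δ))⁻¹

/-- Mollifiers exist at all scales, with a constant that does not depend on the scale. -/
theorem exists_isMollifier (N : ℕ) :
    ∃ C : ℝ, ∀ δ : ℝ, 0 < δ → ∃ ρ : Vec N → ℝ, IsMollifier C δ ρ := by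
  set η : ContDiffBump (0 : Vec N) := ⟨1 / 2, 1, by norm_num, by norm_num⟩
  set ρ₁ : Vec N → ℝ := η.normed volume with hρ₁
  have hs : ContDiff ℝ ∞ ρ₁ := η.contDiff_normed
  have hc : HasCompactSupport ρ₁ := η.hasCompactSupport_normed
  obtain ⟨A, hA⟩ := hc.exists_bound_of_continuous hs.continuous
  obtain ⟨D, hD⟩ := (hc.fderiv (𝕜 := ℝ)).exists_bound_of_continuous
    (hs.continuous_fderiv (by simp))
  set V := volume.real (closedBall (0 : Vec N) 1) with hV
  have hV0 : 0 < V := ENNReal.toReal_pos (measure_closedBall_pos _ _ one_pos).ne'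
    (isCompact_closedBall _ _).measure_lt_top.ne
  have hVδ : ∀ δ : ℝ, 0 < δ → volume.real (closedBall (0 : Vec N) δ) = δ ^ N * V := fun δ hδ => by
    rw [Measure.real, Measure.addHaar_closedBall' _ _ hδ.le, ENNReal.toReal_mul,
      ENNReal.toReal_ofReal (by positivity), finrank_euclideanSpace_fin]
    rfl
  refine ⟨max A D * V, fun δ hδ => ⟨fun z => (δ ^ N)⁻¹ * ρ₁ (δ⁻¹ • z), ?_, ?_, ?_, ?_, ?_⟩⟩
  · exact contDiff_const.mul (hs.comp (contDiff_const_smul _))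
  · intro z hz
    have : ρ₁ (δ⁻¹ • z) = 0 := by
      by_contra hne
      have h1 : δ⁻¹ • z ∈ Function.support ρ₁ := hne
      rw [hρ₁, η.support_normed_eq, mem_ball_zero_iff, norm_smul, norm_inv, Real.norm_eq_abs,
        abs_of_pos hδ, inv_mul_lt_iff₀ hδ] at h1
      change ‖z‖ < δ * 1 at h1
      linarith
    rw [this, mul_zero]
  · rw [integral_const_mul, Measure.integral_comp_smul, hρ₁, η.integral_normed,
      finrank_euclideanSpace_fin]
    have : 0 < δ ^ N := by positivity
    simp [abs_of_pos, hδ, this.ne']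
  · intro z
    rw [hVδ δ hδ, abs_mul, abs_of_pos (by positivity), mul_inv]
    calc (δ ^ N)⁻¹ * |ρ₁ (δ⁻¹ • z)| ≤ (δ ^ N)⁻¹ * max A D := by
          gcongr
          exact (hA _).trans (le_max_left _ _)
      _ = max A D * V * ((δ ^ N)⁻¹ * V⁻¹) := by field_simp
  · intro z
    have hd : HasFDerivAt (fun z => (δ ^ N)⁻¹ * ρ₁ (δ⁻¹ • z))
        ((δ ^ N)⁻¹ • ((fderiv ℝ ρ₁ (δ⁻¹ • z)).comp
          (δ⁻¹ • ContinuousLinearMap.id ℝ (Vec N)))) z := by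
      have h1 : HasFDerivAt (fun z : Vec N => δ⁻¹ • z) (δ⁻¹ • ContinuousLinearMap.id ℝ (Vec N)) z :=
        (hasFDerivAt_id z).const_smul δ⁻¹
      exact (((hs.differentiable (by simp)) _).hasFDerivAt.comp z h1).const_mul _
    rw [hd.fderiv, hVδ δ hδ, ContinuousLinearMap.comp_smul, ContinuousLinearMap.comp_id, norm_smul,
      norm_smul, norm_inv, norm_inv, Real.norm_eq_abs, Real.norm_eq_abs, abs_of_pos hδ,
      abs_of_pos (by positivity), mul_inv]
    calc (δ ^ N)⁻¹ * (δ⁻¹ * ‖fderiv ℝ ρ₁ (δ⁻¹ • z)‖) ≤ (δ ^ N)⁻¹ * (δ⁻¹ * max A D) := by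
          gcongr
          exact (hD _).trans (le_max_right _ _)
      _ = max A D * V * δ⁻¹ * ((δ ^ N)⁻¹ * V⁻¹) := by field_simp

theorem IsMollifier.hasCompactSupport {C δ : ℝ} {ρ : Vec N → ℝ} (hρ : IsMollifier C δ ρ) :
    HasCompactSupport ρ :=
  HasCompactSupport.intro (isCompact_closedBall 0 δ) fun z hz => hρ.eq_zero z (by simpa using hz)

theorem IsMollifier.hasCompactSupport_sub {C δ : ℝ} {ρ : Vec N → ℝ} (hρ : IsMollifier C δ ρ)
    (x : Vec N) : HasCompactSupport fun z => ρ (x - z) :=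
  hρ.hasCompactSupport.comp_homeomorph (Homeomorph.subLeft x)

theorem IsMollifier.contDiff_sub {C δ : ℝ} {ρ : Vec N → ℝ} (hρ : IsMollifier C δ ρ)
    (x : Vec N) : ContDiff ℝ ∞ fun z => ρ (x - z) :=
  hρ.contDiff.comp (contDiff_const.sub contDiff_id)

theorem fderiv_comp_const_sub {ρ : Vec N → ℝ} (hρ : Differentiable ℝ ρ) (x z : Vec N) :
    fderiv ℝ (fun z => ρ (x - z)) z = -fderiv ℝ ρ (x - z) := by
  have h : HasFDerivAt (fun z => ρ (x - z))
      ((fderiv ℝ ρ (x - z)).comp (-ContinuousLinearMap.id ℝ (Vec N))) z :=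
    (hρ (x - z)).hasFDerivAt.comp z ((hasFDerivAt_id z).const_sub x)
  rw [h.fderiv, ContinuousLinearMap.comp_neg, ContinuousLinearMap.comp_id]

/-- The divergence theorem for the product of a locally Lipschitz vector field with a compactly
supported function. -/
theorem integral_fderiv_add_mul_divergence {v : Vec N → Vec N} (hv : LocallyLipschitz v)
    {ψ : Vec N → ℝ} (hψ : ContDiff ℝ 1 ψ) (hψc : HasCompactSupport ψ) :
    Integrable (fun x => fderiv ℝ ψ x (v x) + ψ x * divergence v x) ∧
      ∫ x, (fderiv ℝ ψ x (v x) + ψ x * divergence v x) = 0 := by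
  have hψl := hψ.locallyLipschitz
  set b : Fin N → Vec N := fun j => EuclideanSpace.single j 1
  have hvj := fun j => locallyLipschitz_component hv j
  have hfd : ∀ᵐ x, ∑ j, fderiv ℝ (fun x => v x j * ψ x) x (b j)
      = fderiv ℝ ψ x (v x) + ψ x * divergence v x := by
    filter_upwards [hv.ae_differentiableAt volume] with x hx
    have hdiv : ψ x * divergence v x = ∑ j, ψ x * fderiv ℝ v x (b j) j := Finset.mul_sum _ _ _
    have hψv : ∑ j, v x j * fderiv ℝ ψ x (b j) = fderiv ℝ ψ x (v x) := by
      conv_rhs => rw [← sum_smul_single (v x), map_sum]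
      simp [b]
    rw [hdiv, ← hψv, ← Finset.sum_add_distrib]
    refine Finset.sum_congr rfl fun j _ => ?_
    have h1 : DifferentiableAt ℝ (fun x => v x j) x := by fun_prop
    rw [fderiv_fun_mul h1 (hψ.differentiable one_ne_zero x), ← fderiv_component hx]
    simp
  have hi : ∀ j, Integrable fun x => fderiv ℝ (fun x => v x j * ψ x) x (b j) := fun j => by
    have h1 := ((hvj j).mul_real hψl).locallyIntegrable_fderiv_apply (μ := volume) (b j)
    have h2 : HasCompactSupport fun x => fderiv ℝ (fun x => v x j * ψ x) x (b j) :=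
      HasCompactSupport.fderiv_apply (𝕜 := ℝ) hψc.mul_left (b j)
    exact (integrableOn_iff_integrable_of_support_subset (subset_tsupport _)).1
      (h1.integrableOn_isCompact h2.isCompact)
  refine ⟨(integrable_finsetSum Finset.univ fun j _ => hi j).congr hfd, ?_⟩
  rw [← integral_congr_ae hfd, integral_finsetSum _ fun j _ => hi j]
  exact Finset.sum_eq_zero fun j _ =>
    integral_fderiv_eq_zero ((hvj j).mul_real hψl) (hψc.mul_left) _

/-- The mean oscillation of `q` about its value at the centre of a ball. -/
noncomputable def meanOsc (δ : ℝ) (q : Vec N → Vec N) (x : Vec N) : ℝ :=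
  (volume.real (closedBall (0 : Vec N) δ))⁻¹ * ∫ z in closedBall x δ, ‖q z - q x‖

theorem meanOsc_nonneg (δ : ℝ) (q : Vec N → Vec N) (x : Vec N) : 0 ≤ meanOsc δ q x :=
  mul_nonneg (inv_nonneg.2 measureReal_nonneg) (integral_nonneg fun _ => norm_nonneg _)

theorem volume_real_closedBall_pos {δ : ℝ} (hδ : 0 < δ) :
    0 < volume.real (closedBall (0 : Vec N) δ) :=
  ENNReal.toReal_pos (measure_closedBall_pos _ _ hδ).ne'
    (isCompact_closedBall _ _).measure_lt_top.ne

theorem volume_real_closedBall_eq (x : Vec N) (δ : ℝ) :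
    volume.real (closedBall x δ) = volume.real (closedBall (0 : Vec N) δ) := by
  rw [Measure.real, Measure.addHaar_closedBall_center, Measure.real]

/-- An integral over a small ball of a function of size `A |q(z) - q(x)| + B` over the volume of
the ball. -/
theorem norm_integral_le_meanOsc {δ A B : ℝ} (hδ : 0 < δ) {q : Vec N → Vec N}
    (hq : LocallyIntegrable q) {x : Vec N} {h : Vec N → ℝ}
    (h0 : ∀ z, δ < ‖x - z‖ → h z = 0)
    (hb : ∀ z, ‖x - z‖ ≤ δ → ‖h z‖ ≤
      (volume.real (closedBall (0 : Vec N) δ))⁻¹ * (A * ‖q z - q x‖ + B)) :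
    ‖∫ z, h z‖ ≤ A * meanOsc δ q x + B := by
  set V := volume.real (closedBall (0 : Vec N) δ) with hV
  have hV0 : 0 < V := volume_real_closedBall_pos hδ
  have hmem : ∀ z, z ∈ closedBall x δ ↔ ‖x - z‖ ≤ δ := fun z => by
    rw [mem_closedBall, dist_comm, dist_eq_norm]
  rw [← setIntegral_eq_integral_of_forall_compl_eq_zero (s := closedBall x δ)
    fun z hz => h0 z (by simpa using (hmem z).not.1 hz)]
  have hq1 : IntegrableOn (fun z => ‖q z - q x‖) (closedBall x δ) :=
    ((hq.integrableOn_isCompact (isCompact_closedBall _ _)).sub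
      (integrableOn_const (isCompact_closedBall _ _).measure_lt_top.ne)).norm
  have hc : IntegrableOn (fun _ : Vec N => B) (closedBall x δ) :=
    integrableOn_const (isCompact_closedBall _ _).measure_lt_top.ne
  refine (norm_integral_le_of_norm_le (((hq1.const_mul A).add hc).const_mul V⁻¹)
    ((ae_restrict_iff' isClosed_closedBall.measurableSet).2
      (.of_forall fun z hz => hb z ((hmem z).1 hz)))).trans_eq ?_
  simp only [Pi.add_apply]
  rw [integral_const_mul, integral_add (hq1.const_mul A) hc, integral_const_mul, setIntegral_const,
    volume_real_closedBall_eq, ← hV, meanOsc, ← hV, smul_eq_mul]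
  field_simp

theorem abs_divergence_le {v : Vec N → Vec N} {x : Vec N} {L : ℝ} (hL : ‖fderiv ℝ v x‖ ≤ L) :
    |divergence v x| ≤ N * L := by
  calc |divergence v x| ≤ ∑ i : Fin N, |fderiv ℝ v x (EuclideanSpace.single i 1) i| :=
        Finset.abs_sum_le_sum_abs _ _
    _ ≤ ∑ _i : Fin N, L := by
        refine Finset.sum_le_sum fun i _ => ?_
        refine (PiLp.norm_apply_le (fderiv ℝ v x (EuclideanSpace.single i 1)) i).trans ?_
        refine ((fderiv ℝ v x).le_opNorm _).trans ?_
        simpa using hL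
    _ = N * L := by simp

/-- The error of the mollification of a component of `q` is controlled by the mean oscillation. -/
theorem norm_integral_mul_sub_le {C δ : ℝ} {ρ : Vec N → ℝ} (hδ : 0 < δ) (hρ : IsMollifier C δ ρ)
    {q : Vec N → Vec N} (hq : LocallyIntegrable q) {e : Vec N} (he : ‖e‖ ≤ 1) (x : Vec N) :
    |(∫ z, ρ (x - z) * inner ℝ (q z) e) - inner ℝ (q x) e| ≤ C * meanOsc δ q x := by
  have hqe : LocallyIntegrable fun z => (inner ℝ (q z) e : ℝ) := fun z =>
    (hq z).imp fun s hs => ⟨hs.1, hs.2.inner_const e⟩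
  have h1 : Integrable fun z => ρ (x - z) * inner ℝ (q z) e := by
    simpa only [mul_comm] using integrable_mul_of_hasCompactSupport hqe
      (hρ.contDiff_sub x).continuous (hρ.hasCompactSupport_sub x)
  have h2 : Integrable fun z => ρ (x - z) * inner ℝ (q x) e :=
    ((hρ.contDiff_sub x).continuous.integrable_of_hasCompactSupport
      (hρ.hasCompactSupport_sub x)).mul_const _
  have h3 : ∫ z, ρ (x - z) * inner ℝ (q x) e = inner ℝ (q x) e := by
    rw [integral_mul_const, integral_sub_left_eq_self ρ, hρ.integral_eq, one_mul]
  rw [← h3, ← integral_sub h1 h2, ← Real.norm_eq_abs]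
  refine (norm_integral_le_meanOsc (A := C) (B := 0) hδ hq (fun z hz => ?_) fun z hz => ?_).trans_eq
    (add_zero _)
  · simp [hρ.eq_zero _ hz]
  · rw [← mul_sub, ← inner_sub_left, norm_mul, Real.norm_eq_abs, add_zero, ← mul_assoc,
      mul_comm _ C]
    refine mul_le_mul (hρ.abs_le _) ?_ (norm_nonneg _) ((abs_nonneg _).trans (hρ.abs_le (x - z)))
    exact (norm_inner_le_norm _ _).trans (mul_le_of_le_one_right (norm_nonneg _) he)

/-- The commutator of the transport operator and the mollification is controlled by the mean
oscillation. The kernel `κ` that multiplies `q(z)` is as large as the inverse volume of the ball and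
has integral zero by the divergence theorem, so that `q(z)` may be replaced by `q(z) - q(x)`. -/
theorem abs_commutator_le {C δ R : ℝ} {ρ : Vec N → ℝ} (hδ : 0 < δ) (hδ1 : δ ≤ 1)
    (hρ : IsMollifier C δ ρ) {v q : ℝ → Vec N → Vec N} {s : ℝ} {L : NNReal} (hv : LocallyLipschitz (v s))
    (hL : LipschitzOnWith L (v s) (closedBall 0 (R + 2))) (hq : LocallyIntegrable (q s))
    (hi : ∀ e ψ, ContDiff ℝ 1 ψ → HasCompactSupport ψ →
      Integrable (transportIntegrand v q e ψ s)) {e : Vec N} (he : ‖e‖ ≤ 1)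
    {x : Vec N} (hx : ‖x‖ ≤ R) :
    |(∫ z, transportIntegrand v q e (fun z => ρ (x - z)) s z)
        + fderiv ℝ (fun x => ∫ z, ρ (x - z) * inner ℝ (q s z) e) x (v s x)|
      ≤ C * L * (N + 2) * meanOsc δ (q s) x + C * L * ‖q s x‖ := by
  have hqe : LocallyIntegrable fun z => (inner ℝ (q s z) e : ℝ) := fun z =>
    (hq z).imp fun S hS => ⟨hS.1, hS.2.inner_const e⟩
  have hρ1 : ContDiff ℝ 1 ρ := hρ.contDiff.of_le (by exact_mod_cast le_top)
  have hρd : Differentiable ℝ ρ := hρ1.differentiable one_ne_zero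
  have hψ1 : ContDiff ℝ 1 fun z => ρ (x - z) :=
    (hρ.contDiff_sub x).of_le (by exact_mod_cast le_top)
  have hψc := hρ.hasCompactSupport_sub x
  set V := volume.real (closedBall (0 : Vec N) δ) with hV
  have hV0 : 0 < V := volume_real_closedBall_pos hδ
  have hC0 : 0 ≤ C := by
    have := (abs_nonneg _).trans (hρ.abs_le 0)
    exact (mul_nonneg_iff_of_pos_right (inv_pos.2 hV0)).1 this
  set κ : Vec N → ℝ := fun z => fderiv ℝ ρ (x - z) (v s x - v s z) + ρ (x - z) * divergence (v s) z with hκ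
  obtain ⟨hdi, hd0⟩ := integral_fderiv_add_mul_divergence hv hψ1 hψc
  have hce : HasCompactSupport fun z => fderiv ℝ (fun z => ρ (x - z)) z (v s x) :=
    hψc.fderiv_apply (𝕜 := ℝ) (v s x)
  have hcc : Continuous fun z => fderiv ℝ (fun z => ρ (x - z)) z (v s x) :=
    (hψ1.continuous_fderiv one_ne_zero).clm_apply continuous_const
  have hκeq : κ = fun z => (fderiv ℝ (fun z => ρ (x - z)) z (v s z)
      + ρ (x - z) * divergence (v s) z) - fderiv ℝ (fun z => ρ (x - z)) z (v s x) := by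
    funext z
    simp only [hκ, fderiv_comp_const_sub hρd, map_sub, _root_.neg_apply]
    ring
  have hκi : Integrable κ := by
    rw [hκeq]
    exact hdi.sub (hcc.integrable_of_hasCompactSupport hce)
  have hκ0 : ∫ z, κ z = 0 := by
    rw [hκeq, integral_sub hdi (hcc.integrable_of_hasCompactSupport hce), hd0,
      integral_fderiv_eq_zero hψ1.locallyLipschitz hψc, sub_zero]
  have h1 : fderiv ℝ (fun x => ∫ z, ρ (x - z) * inner ℝ (q s z) e) x (v s x)
      = ∫ z, fderiv ℝ ρ (x - z) (v s x) * inner ℝ (q s z) e :=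
    fderiv_integral_sub_mul_apply hρ1 hρ.hasCompactSupport hqe x (v s x)
  have h1i : Integrable fun z => fderiv ℝ ρ (x - z) (v s x) * inner ℝ (q s z) e := by
    have := (integrable_mul_of_hasCompactSupport hqe hcc hce).neg
    refine this.congr (.of_forall fun z => ?_)
    simp only [Pi.neg_apply, fderiv_comp_const_sub hρd, _root_.neg_apply]
    ring
  have h2i : Integrable fun z => inner ℝ (q s x) e * κ z := hκi.const_mul _
  have h2 : ∫ z, inner ℝ (q s x) e * κ z = 0 := by rw [integral_const_mul, hκ0, mul_zero]
  have hti := hi e _ hψ1 hψc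
  have h3 : (∫ z, transportIntegrand v q e (fun z => ρ (x - z)) s z)
        + fderiv ℝ (fun x => ∫ z, ρ (x - z) * inner ℝ (q s z) e) x (v s x)
      = ∫ z, (transportIntegrand v q e (fun z => ρ (x - z)) s z
          + fderiv ℝ ρ (x - z) (v s x) * inner ℝ (q s z) e - inner ℝ (q s x) e * κ z) := by
    refine Eq.trans ?_ (integral_sub (hti.add h1i) h2i).symm
    rw [h2, sub_zero, h1, ← integral_add hti h1i]
    rfl
  rw [h3, ← Real.norm_eq_abs]
  refine norm_integral_le_meanOsc hδ hq (fun z hz => ?_) fun z hz => ?_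
  · have e1 : ρ (x - z) = 0 := hρ.eq_zero _ hz
    have e2 : fderiv ℝ ρ (x - z) = 0 := by
      have : ρ =ᶠ[𝓝 (x - z)] fun _ => 0 := by
        filter_upwards [(isOpen_lt continuous_const continuous_norm).mem_nhds hz] with y hy
        exact hρ.eq_zero y hy
      rw [this.fderiv_eq, fderiv_const_apply]
    simp [transportIntegrand, hκ, fderiv_comp_const_sub hρd, e1, e2]
  · have hxz : ‖z‖ ≤ R + 1 := by
      calc ‖z‖ = ‖x - (x - z)‖ := by rw [sub_sub_cancel]
        _ ≤ ‖x‖ + ‖x - z‖ := norm_sub_le _ _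
        _ ≤ R + 1 := by linarith
    have hfd : ‖fderiv ℝ (v s) z‖ ≤ L := norm_fderiv_le_of_lipschitzOnWith hL (by linarith)
    have hvv : ‖v s x - v s z‖ ≤ L * δ := by
      refine (hL.norm_sub_le (by simp; linarith) (by simp; linarith)).trans ?_
      gcongr
    have hκb : |κ z| ≤ V⁻¹ * (C * L * (N + 1)) := by
      calc |κ z| ≤ |fderiv ℝ ρ (x - z) (v s x - v s z)| + |ρ (x - z) * divergence (v s) z| :=
            abs_add_le _ _
        _ ≤ (C * δ⁻¹ * V⁻¹) * (L * δ) + (C * V⁻¹) * (N * L) := by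
            rw [abs_mul]
            refine add_le_add ?_ (mul_le_mul (hρ.abs_le _) (abs_divergence_le hfd) (abs_nonneg _)
              (by positivity))
            exact ((fderiv ℝ ρ (x - z)).le_opNorm _).trans
              (mul_le_mul (hρ.norm_fderiv_le _) hvv (norm_nonneg _) (by positivity))
        _ = V⁻¹ * (C * L * (N + 1)) := by field_simp; ring
    have hfe : ‖fderiv ℝ (v s) z e‖ ≤ L := ((fderiv ℝ (v s) z).le_opNorm e).trans
      (by nlinarith [norm_nonneg e, L.coe_nonneg, norm_nonneg (fderiv ℝ (v s) z)])
    have hqz : ‖q s z‖ ≤ ‖q s z - q s x‖ + ‖q s x‖ := by simpa using norm_add_le (q s z - q s x) (q s x)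
    have hsplit : transportIntegrand v q e (fun z => ρ (x - z)) s z
          + fderiv ℝ ρ (x - z) (v s x) * inner ℝ (q s z) e - inner ℝ (q s x) e * κ z
        = inner ℝ (q s z - q s x) e * κ z - ρ (x - z) * inner ℝ (q s z) (fderiv ℝ (v s) z e) := by
      simp only [transportIntegrand, hκ, fderiv_comp_const_sub hρd, map_sub,
        _root_.neg_apply, inner_sub_left]
      ring
    rw [hsplit]
    calc ‖inner ℝ (q s z - q s x) e * κ z - ρ (x - z) * inner ℝ (q s z) (fderiv ℝ (v s) z e)‖
        ≤ ‖inner ℝ (q s z - q s x) e * κ z‖ + ‖ρ (x - z) * inner ℝ (q s z) (fderiv ℝ (v s) z e)‖ :=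
          norm_sub_le _ _
      _ ≤ ‖q s z - q s x‖ * (V⁻¹ * (C * L * (N + 1)))
          + (C * V⁻¹) * ((‖q s z - q s x‖ + ‖q s x‖) * L) := by
          rw [norm_mul, norm_mul, Real.norm_eq_abs (κ z), Real.norm_eq_abs (ρ _)]
          refine add_le_add (mul_le_mul ?_ hκb (abs_nonneg _) (norm_nonneg _))
            (mul_le_mul (hρ.abs_le _) ?_ (norm_nonneg _) (by positivity))
          · exact (norm_inner_le_norm _ _).trans (mul_le_of_le_one_right (norm_nonneg _) he)
          · exact (norm_inner_le_norm _ _).trans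
              (mul_le_mul hqz hfe (norm_nonneg _) (by positivity))
      _ = V⁻¹ * (C * L * (N + 2) * ‖q s z - q s x‖ + C * L * ‖q s x‖) := by ring

end Mollifier

/-! ### Measurability of mollified fields -/

section MollifiedFields

variable {N : ℕ}

theorem IsLocBdd.integrable_sub_mul {h : ℝ → Vec N → ℝ} (hh : IsLocBdd h) {k : Vec N → ℝ}
    (hk : Continuous k) (hkc : HasCompactSupport k) (s : ℝ) (x : Vec N) :
    Integrable fun z => k (x - z) * h s z := by
  have hk' : Continuous fun z => k (x - z) := by fun_prop
  simpa only [mul_comm] using integrable_mul_of_hasCompactSupport (hh.locallyIntegrable s)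
    hk' (hkc.comp_homeomorph (Homeomorph.subLeft x))

theorem IsLocBdd.stronglyMeasurable_integral_sub_mul {h : ℝ → Vec N → ℝ} (hh : IsLocBdd h)
    {k : Vec N → ℝ} (hk : Continuous k) :
    StronglyMeasurable fun q : ℝ × Vec N => ∫ z, k (q.2 - z) * h q.1 z := by
  obtain ⟨H, hH, hhH⟩ := hh.exists_modification
  have : (fun q : ℝ × Vec N => ∫ z, k (q.2 - z) * h q.1 z)
      = fun q : ℝ × Vec N => ∫ z, k (q.2 - z) * H (q.1, z) := by
    funext q
    refine integral_congr_ae ?_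
    filter_upwards [hhH q.1] with z hz
    rw [hz]
  rw [this]
  refine StronglyMeasurable.integral_prod_right'
    (f := fun r : (ℝ × Vec N) × Vec N => k (r.1.2 - r.2) * H (r.1.1, r.2)) ?_
  refine StronglyMeasurable.mul (Continuous.stronglyMeasurable (by fun_prop)) ?_
  exact hH.comp_measurable (by fun_prop)

theorem IsLocBdd.exists_norm_integral_sub_mul_le {h : ℝ → Vec N → ℝ} (hh : IsLocBdd h)
    {k : Vec N → ℝ} (hk : Continuous k) (hkc : HasCompactSupport k) (R : ℝ) :
    ∃ C : ℝ, ∀ s x, ‖x‖ ≤ R → ‖∫ z, k (x - z) * h s z‖ ≤ C := by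
  obtain ⟨r, hr⟩ := exists_eq_zero_of_hasCompactSupport hkc
  obtain ⟨C, hC⟩ := hh.bound (R + r)
  refine ⟨∫ z, ‖k z‖ * C, fun s x hx => ?_⟩
  rw [← integral_sub_left_eq_self (fun z => ‖k z‖ * C) volume x]
  have hi : Integrable fun z => ‖k z‖ * C :=
    (hk.integrable_of_hasCompactSupport hkc).norm.mul_const C
  refine norm_integral_le_of_norm_le (hi.comp_sub_left x) (.of_forall fun z => ?_)
  rw [norm_mul]
  rcases le_or_gt ‖x - z‖ r with hz | hz
  · gcongr
    refine hC s z ?_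
    calc ‖z‖ = ‖x - (x - z)‖ := by rw [sub_sub_cancel]
      _ ≤ ‖x‖ + ‖x - z‖ := norm_sub_le _ _
      _ ≤ R + r := add_le_add hx hz
  · simp [hr _ hz]

theorem IsLocBdd.contDiff_integral_sub_mul {h : ℝ → Vec N → ℝ} (hh : IsLocBdd h)
    {k : Vec N → ℝ} (hk : ContDiff ℝ 1 k) (hkc : HasCompactSupport k) (s : ℝ) :
    ContDiff ℝ 1 fun x => ∫ z, k (x - z) * h s z := by
  have : (fun x => ∫ z, k (x - z) * h s z)
      = convolution k (h s) (ContinuousLinearMap.mul ℝ ℝ) volume := by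
    funext y
    exact convolution_mul_swap.symm
  rw [this]
  exact_mod_cast hkc.contDiff_convolution_left (n := 1) (ContinuousLinearMap.mul ℝ ℝ)
    (by exact_mod_cast hk) (hh.locallyIntegrable s)

/-- The transport terms, tested with the translates of a mollifier, as a sum of mollified fields. -/
theorem integral_transportIntegrand_sub {v q : ℝ → Vec N → Vec N} (hv : IsCaratheodory v)
    (hq : IsLocBdd q) (e : Vec N) {ρ : Vec N → ℝ} (hρ : ContDiff ℝ 1 ρ) (hρc : HasCompactSupport ρ)
    (s : ℝ) (x : Vec N) :
    ∫ z, transportIntegrand v q e (fun z => ρ (x - z)) s z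
      = -(∑ j, ∫ z, fderiv ℝ ρ (x - z) (EuclideanSpace.single j 1) * (inner ℝ (q s z) e * v s z j))
        + ∫ z, ρ (x - z) * (inner ℝ (q s z) e * divergence (v s) z
            - inner ℝ (q s z) (fderiv ℝ (v s) z e)) := by
  have h1 : ∀ j, Integrable fun z => fderiv ℝ ρ (x - z) (EuclideanSpace.single j 1)
      * (inner ℝ (q s z) e * v s z j) := fun j =>
    ((hq.inner_const e).mul
      (hv.isLocBdd.clm_comp (EuclideanSpace.proj (𝕜 := ℝ) j))).integrable_sub_mul
      (k := fun z => fderiv ℝ ρ z (EuclideanSpace.single j 1))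
      ((hρ.continuous_fderiv one_ne_zero).clm_apply continuous_const)
      (hρc.fderiv_apply (𝕜 := ℝ) _) s x
  have h2 : Integrable fun z => ρ (x - z) * (inner ℝ (q s z) e * divergence (v s) z
            - inner ℝ (q s z) (fderiv ℝ (v s) z e)) :=
    (((hq.inner_const e).mul hv.isLocBdd_divergence).sub
      (hq.inner_real (hv.isLocBdd_fderiv e))).integrable_sub_mul hρ.continuous hρc s x
  have h3 : Integrable fun z => -∑ j, fderiv ℝ ρ (x - z) (EuclideanSpace.single j 1)
      * (inner ℝ (q s z) e * v s z j) := (integrable_finsetSum _ fun j _ => h1 j).neg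
  rw [← integral_finsetSum _ fun j _ => h1 j, ← integral_neg, ← integral_add h3 h2]
  refine integral_congr_ae (.of_forall fun z => ?_)
  have hsum : ∑ j, fderiv ℝ ρ (x - z) (EuclideanSpace.single j 1) * (inner ℝ (q s z) e * v s z j)
      = inner ℝ (q s z) e * fderiv ℝ ρ (x - z) (v s z) := by
    conv_rhs => rw [← sum_smul_single (v s z), map_sum, Finset.mul_sum]
    refine Finset.sum_congr rfl fun j _ => ?_
    simp only [map_smul, smul_eq_mul]
    ring
  simp only [transportIntegrand, fderiv_comp_const_sub (hρ.differentiable one_ne_zero),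
    _root_.neg_apply, hsum]
  ring

theorem stronglyMeasurable_integral_transportIntegrand {v q : ℝ → Vec N → Vec N}
    (hv : IsCaratheodory v) (hq : IsLocBdd q) (e : Vec N) {ρ : Vec N → ℝ} (hρ : ContDiff ℝ 1 ρ)
    (hρc : HasCompactSupport ρ) :
    StronglyMeasurable fun r : ℝ × Vec N =>
      ∫ z, transportIntegrand v q e (fun z => ρ (r.2 - z)) r.1 z := by
  simp only [integral_transportIntegrand_sub hv hq e hρ hρc]
  refine (StronglyMeasurable.neg (Finset.stronglyMeasurable_fun_sum _ fun j _ => ?_)).add ?_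
  · exact ((hq.inner_const e).mul
      (hv.isLocBdd.clm_comp (EuclideanSpace.proj (𝕜 := ℝ) j))).stronglyMeasurable_integral_sub_mul
      (k := fun z => fderiv ℝ ρ z (EuclideanSpace.single j 1))
      ((hρ.continuous_fderiv one_ne_zero).clm_apply continuous_const)
  · exact (((hq.inner_const e).mul hv.isLocBdd_divergence).sub
      (hq.inner_real (hv.isLocBdd_fderiv e))).stronglyMeasurable_integral_sub_mul hρ.continuous

theorem exists_norm_integral_transportIntegrand_le {v q : ℝ → Vec N → Vec N}
    (hv : IsCaratheodory v) (hq : IsLocBdd q) (e : Vec N) {ρ : Vec N → ℝ} (hρ : ContDiff ℝ 1 ρ)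
    (hρc : HasCompactSupport ρ) (R : ℝ) :
    ∃ C : ℝ, ∀ s x, ‖x‖ ≤ R →
      ‖∫ z, transportIntegrand v q e (fun z => ρ (x - z)) s z‖ ≤ C := by
  choose C hC using fun j => ((hq.inner_const e).mul
      (hv.isLocBdd.clm_comp (EuclideanSpace.proj (𝕜 := ℝ) j))).exists_norm_integral_sub_mul_le
      (k := fun z => fderiv ℝ ρ z (EuclideanSpace.single j 1))
      ((hρ.continuous_fderiv one_ne_zero).clm_apply continuous_const)
      (hρc.fderiv_apply (𝕜 := ℝ) _) R
  obtain ⟨D, hD⟩ := (((hq.inner_const e).mul hv.isLocBdd_divergence).sub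
      (hq.inner_real (hv.isLocBdd_fderiv e))).exists_norm_integral_sub_mul_le hρ.continuous hρc R
  refine ⟨(∑ j, C j) + D, fun s x hx => ?_⟩
  rw [integral_transportIntegrand_sub hv hq e hρ hρc]
  refine (norm_add_le _ _).trans (add_le_add ?_ (hD s x hx))
  rw [norm_neg]
  exact (norm_sum_le _ _).trans (Finset.sum_le_sum fun j _ => hC j s x hx)

theorem stronglyMeasurable_meanOsc {q : ℝ → Vec N → Vec N}
    (hq : StronglyMeasurable fun r : ℝ × Vec N => q r.1 r.2) (δ : ℝ) :
    StronglyMeasurable fun r : ℝ × Vec N => meanOsc δ (q r.1) r.2 := by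
  have h : ∀ r : ℝ × Vec N, meanOsc δ (q r.1) r.2 = (volume.real (closedBall (0 : Vec N) δ))⁻¹ *
      ∫ z, {w : (ℝ × Vec N) × Vec N | dist w.2 w.1.2 ≤ δ}.indicator
        (fun w => ‖q w.1.1 w.2 - q w.1.1 w.1.2‖) (r, z) := fun r => by
    rw [meanOsc, ← integral_indicator isClosed_closedBall.measurableSet]
    rfl
  simp only [h]
  refine StronglyMeasurable.const_mul (StronglyMeasurable.integral_prod_right' ?_) _
  refine StronglyMeasurable.indicator ?_ (measurableSet_le (by fun_prop) measurable_const)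
  exact ((hq.comp_measurable (g := fun w : (ℝ × Vec N) × Vec N => (w.1.1, w.2)) (by fun_prop)).sub
    (hq.comp_measurable (g := fun w : (ℝ × Vec N) × Vec N => (w.1.1, w.1.2)) (by fun_prop))).norm

theorem meanOsc_le {q : Vec N → Vec N} {R C δ : ℝ} (hδ : 0 < δ) (hδ1 : δ ≤ 1)
    (hq : ∀ x, ‖x‖ ≤ R + 1 → ‖q x‖ ≤ C) {x : Vec N} (hx : ‖x‖ ≤ R) : meanOsc δ q x ≤ 2 * C := by
  have hV0 : 0 < volume.real (closedBall (0 : Vec N) δ) := volume_real_closedBall_pos hδ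
  rw [meanOsc, inv_mul_le_iff₀ hV0, ← volume_real_closedBall_eq x, mul_comm]
  refine (Real.le_norm_self _).trans (norm_setIntegral_le_of_norm_le_const
    (isCompact_closedBall _ _).measure_lt_top fun z hz => ?_)
  rw [norm_norm]
  have hz' : ‖z‖ ≤ R + 1 := by
    calc ‖z‖ = ‖x + (z - x)‖ := by rw [add_sub_cancel]
      _ ≤ ‖x‖ + ‖z - x‖ := norm_add_le _ _
      _ ≤ R + 1 := add_le_add hx ((mem_closedBall_iff_norm.1 hz).trans hδ1)
  calc ‖q z - q x‖ ≤ ‖q z‖ + ‖q x‖ := norm_sub_le _ _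
    _ ≤ 2 * C := by linarith [hq z hz', hq x (by linarith)]

theorem ae_tendsto_meanOsc {q : Vec N → Vec N} (hq : LocallyIntegrable q) {δ : ℕ → ℝ}
    (hδ : Tendsto δ atTop (𝓝[>] 0)) :
    ∀ᵐ x, Tendsto (fun n => meanOsc (δ n) q x) atTop (𝓝 0) := by
  filter_upwards [IsUnifLocDoublingMeasure.ae_tendsto_average_norm_sub volume hq 1] with x hx
  have hpos : ∀ᶠ n in atTop, 0 < δ n := (tendsto_nhdsWithin_iff.1 hδ).2
  refine (hx (fun _ => x) δ hδ (hpos.mono fun n hn => by simp [hn.le])).congr fun n => ?_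
  rw [setAverage_eq, volume_real_closedBall_eq, smul_eq_mul, meanOsc]

end MollifiedFields

/-! ### The energy estimate for the transport system -/

section Energy

variable {N : ℕ} {T : ℝ}

/-- A weight `χ` with time derivative `χ'`, supported in a ball, which increases along the flow of
the field `v`. -/
structure IsWeight (t₀ T R : ℝ) (v : ℝ → Vec N → Vec N) (χ χ' : ℝ → Vec N → ℝ) : Prop where
  contDiff : ∀ s, ContDiff ℝ 1 (χ s)
  nonneg : ∀ s x, 0 ≤ χ s x
  isTubeBounded : IsTubeBounded t₀ T R χ
  isTubeBounded_deriv : IsTubeBounded t₀ T R χ'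
  absolutelyContinuous : ∀ x, AbsolutelyContinuousOnInterval (fun s => χ s x) t₀ T
  hasDerivAt : ∀ x, ∀ᵐ s, s ∈ Icc t₀ T → HasDerivAt (fun s => χ s x) (χ' s x) s
  supersolution : ∀ s ∈ Icc t₀ T, ∀ x, ‖x‖ ≤ R → 0 ≤ χ' s x + fderiv ℝ (χ s) x (v s x)

theorem IsWeight.hasCompactSupport {t₀ R : ℝ} {v : ℝ → Vec N → Vec N} {χ χ' : ℝ → Vec N → ℝ}
    (hχ : IsWeight t₀ T R v χ χ') {s : ℝ} (hs : s ∈ Icc t₀ T) : HasCompactSupport (χ s) :=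
  HasCompactSupport.intro (isCompact_closedBall 0 R) fun x hx =>
    hχ.isTubeBounded.eq_zero s hs x (by simpa using hx)

/-- The square of a primitive of `B`, multiplied by an absolutely continuous function. -/
theorem sq_mul_eq_neg_integral {t₀ t : ℝ} (ht : t ∈ Icc t₀ T) {B Q c c' : ℝ → ℝ}
    (hB : IntervalIntegrable B volume t₀ T)
    (hQ : ∀ᵐ s, s ∈ Icc t₀ T → Q s = -∫ r in s..T, B r)
    (hc : AbsolutelyContinuousOnInterval c t₀ T)
    (hc' : ∀ᵐ s, s ∈ Icc t₀ T → HasDerivAt c (c' s) s) :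
    (-∫ r in t..T, B r) ^ 2 * c t = -∫ s in t..T, (2 * (Q s * B s) * c s + Q s ^ 2 * c' s) := by
  set P : ℝ → ℝ := fun s => ∫ r in T..s, B r with hP
  have hPeq : ∀ s, -∫ r in s..T, B r = P s := fun s => by
    rw [hP, intervalIntegral.integral_symm]
    simp
  have hsub : uIcc t T ⊆ uIcc t₀ T := by
    rw [uIcc_of_le ht.2, uIcc_of_le (ht.1.trans ht.2)]
    exact Icc_subset_Icc_left ht.1
  have hPac : AbsolutelyContinuousOnInterval P t T :=
    (hB.absolutelyContinuousOnInterval_intervalIntegral (by simp)).mono hsub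
  have hac := (hPac.fun_mul hPac).fun_mul (hc.mono hsub)
  have h1 := hac.integral_deriv_eq_sub
  have h2 : ∫ s in t..T, deriv (fun s => P s * P s * c s) s
      = ∫ s in t..T, (2 * (Q s * B s) * c s + Q s ^ 2 * c' s) := by
    refine intervalIntegral.integral_congr_ae ?_
    filter_upwards [hB.ae_hasDerivAt_integral, hQ, hc'] with s hs1 hs2 hs3 hsm
    rw [uIoc_of_le ht.2] at hsm
    have hm : s ∈ Icc t₀ T := ⟨ht.1.trans hsm.1.le, hsm.2⟩
    have hd1 : HasDerivAt P (B s) s := hs1 (by rwa [uIcc_of_le (ht.1.trans ht.2)]) T (by simp)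
    have hd2 : HasDerivAt (fun s => P s * P s * c s)
        ((B s * P s + P s * B s) * c s + P s * P s * c' s) s := (hd1.mul hd1).mul (hs3 hm)
    rw [hd2.deriv, hs2 hm, hPeq]
    ring
  rw [hPeq, ← h2, h1]
  simp only [hP, intervalIntegral.integral_same]
  ring

/-- The system tested with the translates of `ρ`, whose exceptional times depend on the translate: by
Fubini's theorem, at almost every time the identity also holds for almost all translates. -/
theorem IsTransported.ae_ae_eq {v q : ℝ → Vec N → Vec N} (hqT : IsTransported T v q)
    (hv : IsCaratheodory v) (hq : IsLocBdd q) (e : Vec N) {ρ : Vec N → ℝ} (hρ : ContDiff ℝ ∞ ρ)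
    (hρc : HasCompactSupport ρ) :
    (∀ x, ∀ᵐ t ∂volume.restrict (Icc 0 T), ∫ z, ρ (x - z) * inner ℝ (q t z) e
        = -∫ s in t..T, ∫ z, transportIntegrand v q e (fun z => ρ (x - z)) s z) ∧
      ∀ᵐ t ∂volume.restrict (Icc 0 T), ∀ᵐ x, ∫ z, ρ (x - z) * inner ℝ (q t z) e
        = -∫ s in t..T, ∫ z, transportIntegrand v q e (fun z => ρ (x - z)) s z := by
  have hρ1 : ContDiff ℝ 1 ρ := hρ.of_le (by exact_mod_cast le_top)
  have h1 : ∀ x, ∀ᵐ t ∂volume.restrict (Icc 0 T), ∫ z, ρ (x - z) * inner ℝ (q t z) e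
        = -∫ s in t..T, ∫ z, transportIntegrand v q e (fun z => ρ (x - z)) s z := fun x =>
    hqT (fun z => ρ (x - z)) (hρ.comp (contDiff_const.sub contDiff_id))
      (hρc.comp_homeomorph (Homeomorph.subLeft x)) e
  refine ⟨h1, ?_⟩
  set B : ℝ × Vec N → ℝ := fun r => ∫ z, transportIntegrand v q e (fun z => ρ (r.2 - z)) r.1 z
  have hB : StronglyMeasurable B :=
    stronglyMeasurable_integral_transportIntegrand hv hq e hρ1 hρc
  have hQ : StronglyMeasurable fun r : ℝ × Vec N => ∫ z, ρ (r.2 - z) * inner ℝ (q r.1 z) e :=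
    (hq.inner_const e).stronglyMeasurable_integral_sub_mul hρ.continuous
  have hP : StronglyMeasurable fun r : ℝ × Vec N => ∫ s,
      {w : (ℝ × Vec N) × ℝ | w.1.1 < w.2 ∧ w.2 ≤ T}.indicator (fun w => B (w.2, w.1.2)) (r, s) := by
    refine StronglyMeasurable.integral_prod_right' (StronglyMeasurable.indicator ?_ ?_)
    · exact hB.comp_measurable (by fun_prop)
    · exact (measurableSet_lt (measurable_fst.comp measurable_fst) measurable_snd).inter
        (measurableSet_le measurable_snd measurable_const)
  have hPeq : ∀ t ∈ Icc 0 T, ∀ x, ∫ s in t..T, B (s, x) = ∫ s,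
      {w : (ℝ × Vec N) × ℝ | w.1.1 < w.2 ∧ w.2 ≤ T}.indicator (fun w => B (w.2, w.1.2))
        ((t, x), s) := fun t ht x => by
    rw [intervalIntegral.integral_of_le ht.2, ← integral_indicator measurableSet_Ioc]
    rfl
  set G : Set (ℝ × Vec N) := {r | ∫ z, ρ (r.2 - z) * inner ℝ (q r.1 z) e
    = -∫ s, {w : (ℝ × Vec N) × ℝ | w.1.1 < w.2 ∧ w.2 ≤ T}.indicator
      (fun w => B (w.2, w.1.2)) (r, s)}
  have hG : MeasurableSet G := measurableSet_eq_fun hQ.measurable hP.neg.measurable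
  have h2 : ∀ᵐ x : Vec N, ∀ᵐ t ∂volume.restrict (Icc 0 T), (t, x) ∈ G := .of_forall fun x => by
    filter_upwards [h1 x, ae_restrict_mem measurableSet_Icc] with t ht htm
    exact ht.trans (congrArg Neg.neg (hPeq t htm x))
  have h3 := (Measure.ae_ae_comm (p := fun x t => (t, x) ∈ G) (measurable_swap hG)).1 h2
  filter_upwards [h3, ae_restrict_mem measurableSet_Icc] with t ht htm
  filter_upwards [ht] with x hx
  exact hx.trans (congrArg Neg.neg (hPeq t htm x).symm)

/-- The weighted energy of a mollified solution of the transport system. -/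
theorem IsTransported.integral_sq_mul_le {v q : ℝ → Vec N → Vec N} (hqT : IsTransported T v q)
    (hv : IsCaratheodory v) (hqm : StronglyMeasurable fun r : ℝ × Vec N => q r.1 r.2)
    (hq : IsLocBdd q) {t₀ R : ℝ} (ht₀ : 0 ≤ t₀) {χ χ' : ℝ → Vec N → ℝ}
    (hχ : IsWeight t₀ T R v χ χ') {L : NNReal}
    (hL : ∀ t, LipschitzOnWith L (v t) (closedBall 0 (R + 2))) {C δ : ℝ} (hC : 1 ≤ C)
    {ρ : Vec N → ℝ} (hδ : 0 < δ) (hδ1 : δ ≤ 1) (hρ : IsMollifier C δ ρ) {e : Vec N}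
    (he : ‖e‖ ≤ 1) :
    ∀ᵐ t ∂volume.restrict (Icc t₀ T),
      ∫ x, (∫ z, ρ (x - z) * inner ℝ (q t z) e) ^ 2 * χ t x
        ≤ ∫ s in t..T, ∫ x, 2 * (C ^ 2 * L * (3 * N + 4)) *
          ((‖q s x‖ ^ 2 + meanOsc δ (q s) x ^ 2) * χ s x) := by
  have hρ1 : ContDiff ℝ 1 ρ := hρ.contDiff.of_le (by exact_mod_cast le_top)
  have hρc := hρ.hasCompactSupport
  set Q : ℝ → Vec N → ℝ := fun s x => ∫ z, ρ (x - z) * inner ℝ (q s z) e with hQ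
  set B : ℝ → Vec N → ℝ := fun s x =>
    ∫ z, transportIntegrand v q e (fun z => ρ (x - z)) s z with hB
  have hBm : StronglyMeasurable fun r : ℝ × Vec N => B r.1 r.2 :=
    stronglyMeasurable_integral_transportIntegrand hv hq e hρ1 hρc
  have hBb := exists_norm_integral_transportIntegrand_le hv hq e hρ1 hρc
  have hQm : StronglyMeasurable fun r : ℝ × Vec N => Q r.1 r.2 :=
    (hq.inner_const e).stronglyMeasurable_integral_sub_mul hρ1.continuous
  have hQb := (hq.inner_const e).exists_norm_integral_sub_mul_le hρ1.continuous hρc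
  have hQ1 : ∀ s, ContDiff ℝ 1 (Q s) := (hq.inner_const e).contDiff_integral_sub_mul hρ1 hρc
  set D : ℝ → Vec N → ℝ := fun s x => 2 * (Q s x * B s x) * χ s x + Q s x ^ 2 * χ' s x with hD
  have hDt : IsTubeBounded t₀ T R D := by
    obtain ⟨C₁, hC₁⟩ := hQb R
    obtain ⟨C₂, hC₂⟩ := hBb R
    have h1 := ((hχ.isTubeBounded.mul hBm ⟨C₂, fun s _ => hC₂ s⟩).mul hQm
      ⟨C₁, fun s _ => hC₁ s⟩).const_mul 2
    have h2 := (hχ.isTubeBounded_deriv.mul hQm ⟨C₁, fun s _ => hC₁ s⟩).mul hQm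
      ⟨C₁, fun s _ => hC₁ s⟩
    have h3 := h1.add h2
    refine (funext fun s => funext fun x => ?_ : _ = D) ▸ h3
    simp only [hD]
    ring
  set M : ℝ := 2 * (C ^ 2 * L * (3 * N + 4)) with hM
  set S : ℝ → Vec N → ℝ := fun s x => M * ((‖q s x‖ ^ 2 + meanOsc δ (q s) x ^ 2) * χ s x) with hS
  have hSt : IsTubeBounded t₀ T R S := by
    obtain ⟨C₁, hC₁⟩ := hq.bound (R + 1)
    refine (hχ.isTubeBounded.mul (k := fun s x => ‖q s x‖ ^ 2 + meanOsc δ (q s) x ^ 2)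
      ((hqm.norm.pow 2).add ((stronglyMeasurable_meanOsc hqm δ).pow 2))
      ⟨C₁ ^ 2 + (2 * C₁) ^ 2, fun s _ x hx => ?_⟩).const_mul M
    rw [Real.norm_eq_abs, abs_of_nonneg (by positivity)]
    have h1 := hC₁ s x (by linarith)
    have h2 := meanOsc_le hδ hδ1 (hC₁ s) hx
    gcongr
    exact meanOsc_nonneg _ _ _
  -- at a fixed time, the divergence theorem
  have hfix : ∀ s ∈ Icc t₀ T, -∫ x, D s x ≤ ∫ x, S s x := fun s hs => by
    have hψ : ContDiff ℝ 1 fun x => Q s x ^ 2 * χ s x := ((hQ1 s).pow 2).mul (hχ.contDiff s)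
    have hψc : HasCompactSupport fun x => Q s x ^ 2 * χ s x := (hχ.hasCompactSupport hs).mul_left
    obtain ⟨hdi, hd0⟩ := integral_fderiv_add_mul_divergence (hv.locallyLipschitz s) hψ hψc
    have hDn : Integrable fun x => -D s x := (hDt.integrable hs).neg
    have h1 : -∫ x, D s x = ∫ x, (-D s x - (fderiv ℝ (fun x => Q s x ^ 2 * χ s x) x (v s x)
        + Q s x ^ 2 * χ s x * divergence (v s) x)) := by
      rw [integral_sub hDn hdi, hd0, sub_zero, integral_neg]
    rw [h1]
    refine integral_mono (hDn.sub hdi) (hSt.integrable hs) fun x => ?_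
    have hfd : fderiv ℝ (fun x => Q s x ^ 2 * χ s x) x (v s x)
        = 2 * Q s x * fderiv ℝ (Q s) x (v s x) * χ s x + Q s x ^ 2 * fderiv ℝ (χ s) x (v s x) := by
      have e1 := ((hQ1 s).differentiable one_ne_zero x).hasFDerivAt
      have e2 := ((hχ.contDiff s).differentiable one_ne_zero x).hasFDerivAt
      have e3 : HasFDerivAt (fun x => Q s x ^ 2 * χ s x) _ x := (e1.pow 2).mul e2
      rw [e3.fderiv]
      simp
      ring
    rcases lt_or_ge R ‖x‖ with hx | hx
    · have e0 : χ s =ᶠ[𝓝 x] fun _ => 0 := by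
        filter_upwards [(isOpen_lt continuous_const continuous_norm).mem_nhds hx] with y hy
        exact hχ.isTubeBounded.eq_zero s hs y hy
      simp only [hfd, hS, hDt.eq_zero s hs x hx, hχ.isTubeBounded.eq_zero s hs x hx, e0.fderiv_eq,
        fderiv_const_apply]
      simp
    · set A := meanOsc δ (q s) x with hA
      have hA0 : 0 ≤ A := meanOsc_nonneg _ _ _
      set n := ‖q s x‖ with hn
      have hn0 : 0 ≤ n := norm_nonneg _
      set r := B s x + fderiv ℝ (Q s) x (v s x) with hr
      have hrb : |r| ≤ C * L * (N + 2) * (A + n) := by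
        have h3 : |r| ≤ C * L * (N + 2) * A + C * L * n :=
          abs_commutator_le hδ hδ1 hρ (hv.locallyLipschitz s) (hL s) (hq.locallyIntegrable s)
            (fun e ψ hψ hψc => integrable_transportIntegrand hv hq e hψ hψc s) he hx
        have h4 : C * L * n ≤ C * L * (N + 2) * n := by
          have : C * L ≤ C * L * (N + 2) :=
            le_mul_of_one_le_right (by positivity) (by linarith [Nat.cast_nonneg (α := ℝ) N])
          gcongr
        linarith
      have hQx : |Q s x| ≤ C * (A + n) := by
        have h3 := norm_integral_mul_sub_le hδ hρ (hq.locallyIntegrable s) he x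
        have h4 : |inner ℝ (q s x) e| ≤ n :=
          (abs_real_inner_le_norm _ _).trans (mul_le_of_le_one_right hn0 he)
        have h5 : |Q s x| ≤ |Q s x - inner ℝ (q s x) e| + |inner ℝ (q s x) e| := by
          simpa using abs_add_le (Q s x - inner ℝ (q s x) e) (inner ℝ (q s x) e)
        have h6 : n ≤ C * n := le_mul_of_one_le_left hn0 hC
        rw [mul_add]
        exact h5.trans (add_le_add h3 (h4.trans h6))
      have hdiv : |divergence (v s) x| ≤ N * L := abs_divergence_le
        (norm_fderiv_le_of_lipschitzOnWith (hL s) (by linarith))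
      have hsup := hχ.supersolution s hs x hx
      have hχ0 := hχ.nonneg s x
      have hQr : -(2 * (Q s x * r)) ≤ 2 * ((C * (A + n)) * (C * L * (N + 2) * (A + n))) := by
        have : |Q s x * r| ≤ (C * (A + n)) * (C * L * (N + 2) * (A + n)) := by
          rw [abs_mul]
          exact mul_le_mul hQx hrb (abs_nonneg _) (by positivity)
        linarith [neg_abs_le (Q s x * r)]
      have hQd : -(Q s x ^ 2 * divergence (v s) x) ≤ (C * (A + n)) ^ 2 * (N * L) := by
        have : |Q s x ^ 2 * divergence (v s) x| ≤ (C * (A + n)) ^ 2 * (N * L) := by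
          rw [abs_mul, abs_pow]
          exact mul_le_mul (pow_le_pow_left₀ (abs_nonneg _) hQx 2) hdiv (abs_nonneg _)
            (by positivity)
        linarith [neg_abs_le (Q s x ^ 2 * divergence (v s) x)]
      have hsq : (A + n) ^ 2 ≤ 2 * (n ^ 2 + A ^ 2) := by nlinarith [sq_nonneg (A - n)]
      rw [hfd]
      calc -D s x - (2 * Q s x * fderiv ℝ (Q s) x (v s x) * χ s x
              + Q s x ^ 2 * fderiv ℝ (χ s) x (v s x) + Q s x ^ 2 * χ s x * divergence (v s) x)
          = (-(2 * (Q s x * r)) + -(Q s x ^ 2 * divergence (v s) x)) * χ s x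
            - Q s x ^ 2 * (χ' s x + fderiv ℝ (χ s) x (v s x)) := by
            simp only [hD, hr]
            ring
        _ ≤ (-(2 * (Q s x * r)) + -(Q s x ^ 2 * divergence (v s) x)) * χ s x :=
            sub_le_self _ (mul_nonneg (sq_nonneg _) hsup)
        _ ≤ (2 * ((C * (A + n)) * (C * L * (N + 2) * (A + n)))
              + (C * (A + n)) ^ 2 * (N * L)) * χ s x := by gcongr
        _ = (C ^ 2 * L * (3 * N + 4)) * (A + n) ^ 2 * χ s x := by ring
        _ ≤ (C ^ 2 * L * (3 * N + 4)) * (2 * (n ^ 2 + A ^ 2)) * χ s x := by gcongr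
        _ = S s x := by
            simp only [hS, hM]
            ring
  obtain ⟨hx_t, ht_x⟩ := hqT.ae_ae_eq hv hq e hρ.contDiff hρc
  have hsub : Icc t₀ T ⊆ Icc 0 T := Icc_subset_Icc_left ht₀
  filter_upwards [ae_restrict_of_ae_restrict_of_subset hsub ht_x,
    ae_restrict_mem measurableSet_Icc] with t ht htm
  have h1 : ∫ x, Q t x ^ 2 * χ t x = ∫ x, -∫ s in t..T, D s x := by
    refine integral_congr_ae ?_
    filter_upwards [ht] with x hx
    have hx' : Q t x = -∫ s in t..T, B s x := hx
    rw [hx']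
    obtain ⟨C₂, hC₂⟩ := hBb ‖x‖
    refine sq_mul_eq_neg_integral htm (B := fun s => B s x) (Q := fun s => Q s x) ?_ ?_
      (hχ.absolutelyContinuous x) (hχ.hasDerivAt x)
    · exact intervalIntegrable_of_bound (hBm.comp_measurable measurable_prodMk_right)
        (fun s => hC₂ s x le_rfl) _ _
    · exact (ae_restrict_iff' measurableSet_Icc).1
        (ae_restrict_of_ae_restrict_of_subset hsub (hx_t x))
  have hDt' := hDt.mono htm.1 le_rfl
  have hSt' := hSt.mono htm.1 le_rfl
  rw [h1, integral_neg, ← hDt'.integral_swap htm.2, ← intervalIntegral.integral_neg]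
  exact intervalIntegral.integral_mono_on htm.2 (hDt'.intervalIntegrable_integral htm.2).neg
    (hSt'.intervalIntegrable_integral htm.2) fun s hs => hfix s ⟨htm.1.trans hs.1, hs.2⟩

end Energy

/-! ### Uniqueness for the transport system -/

section Uniqueness

variable {N : ℕ} {T : ℝ}

theorem IsMollifier.mono {C C' δ : ℝ} {ρ : Vec N → ℝ} (hρ : IsMollifier C δ ρ) (h : C ≤ C')
    (hδ : 0 < δ) : IsMollifier C' δ ρ where
  contDiff := hρ.contDiff
  eq_zero := hρ.eq_zero
  integral_eq := hρ.integral_eq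
  abs_le z := (hρ.abs_le z).trans (by gcongr)
  norm_fderiv_le z := (hρ.norm_fderiv_le z).trans (by gcongr)

/-- Letting the scale of the mollification tend to zero in the energy estimate. -/
theorem IsTransported.integral_norm_sq_mul_le {v q : ℝ → Vec N → Vec N}
    (hqT : IsTransported T v q) (hv : IsCaratheodory v)
    (hqm : StronglyMeasurable fun r : ℝ × Vec N => q r.1 r.2) (hq : IsLocBdd q) {t₀ R : ℝ}
    (ht₀ : 0 ≤ t₀) {χ χ' : ℝ → Vec N → ℝ} (hχ : IsWeight t₀ T R v χ χ') :
    ∃ M : ℝ, 0 ≤ M ∧ ∀ᵐ t ∂volume.restrict (Icc t₀ T),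
      ∫ x, ‖q t x‖ ^ 2 * χ t x ≤ M * ∫ s in t..T, ∫ x, ‖q s x‖ ^ 2 * χ s x := by
  obtain ⟨C₀, hC₀⟩ := exists_isMollifier N
  obtain ⟨L, hL, -⟩ := hv.bound (R + 2)
  obtain ⟨K, hK⟩ := hq.bound (R + 1)
  set C : ℝ := max 1 C₀ with hC
  have hC1 : 1 ≤ C := le_max_left _ _
  set δ : ℕ → ℝ := fun n => ((n : ℝ) + 1)⁻¹ with hδ
  have hδ0 : ∀ n, 0 < δ n := fun n => by positivity
  have hδ1 : ∀ n, δ n ≤ 1 := fun n => inv_le_one_of_one_le₀ (by linarith [n.cast_nonneg (α := ℝ)])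
  have hδlim : Tendsto δ atTop (𝓝[>] 0) := by
    refine tendsto_nhdsWithin_iff.2 ⟨?_, .of_forall hδ0⟩
    simpa using tendsto_one_div_add_atTop_nhds_zero_nat (𝕜 := ℝ)
  choose ρ hρ₀ using fun n => hC₀ (δ n) (hδ0 n)
  have hρ : ∀ n, IsMollifier C (δ n) (ρ n) := fun n => (hρ₀ n).mono (le_max_right _ _) (hδ0 n)
  set M : ℝ := 2 * (C ^ 2 * L * (3 * N + 4)) with hM
  have hM0 : 0 ≤ M := by positivity
  have he : ∀ i : Fin N, ‖EuclideanSpace.single i (1 : ℝ)‖ ≤ 1 := fun i => by simp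
  have hin : ∀ s x (i : Fin N), inner ℝ (q s x) (EuclideanSpace.single i (1 : ℝ)) = q s x i :=
    fun s x i => by rw [EuclideanSpace.inner_single_right]; simp
  have hae : ∀ᵐ t ∂volume.restrict (Icc t₀ T), ∀ n i,
      ∫ x, (∫ z, ρ n (x - z) * inner ℝ (q t z) (EuclideanSpace.single i (1 : ℝ))) ^ 2 * χ t x
        ≤ ∫ s in t..T, ∫ x, M * ((‖q s x‖ ^ 2 + meanOsc (δ n) (q s) x ^ 2) * χ s x) :=
    ae_all_iff.2 fun n => ae_all_iff.2 fun i =>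
      hqT.integral_sq_mul_le hv hqm hq ht₀ hχ hL hC1 (hδ0 n) (hδ1 n) (hρ n) (he i)
  have hq2t : IsTubeBounded t₀ T R fun s x => ‖q s x‖ ^ 2 * χ s x :=
    hχ.isTubeBounded.mul (hqm.norm.pow 2) ⟨K ^ 2, fun s _ x hx => by
      rw [norm_pow, norm_norm]
      exact pow_le_pow_left₀ (norm_nonneg _) (hK s x (by linarith)) 2⟩
  have hχm : ∀ s, AEStronglyMeasurable (χ s) := fun s =>
    (hχ.contDiff s).continuous.aestronglyMeasurable
  have hqsm : ∀ s, AEStronglyMeasurable (q s) := fun s => hq.aestronglyMeasurable s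
  have hoscm : ∀ n s, AEStronglyMeasurable fun x => meanOsc (δ n) (q s) x := fun n s =>
    ((stronglyMeasurable_meanOsc hqm (δ n)).comp_measurable
      measurable_prodMk_left).aestronglyMeasurable
  -- convergence of the energies of the components
  have hlim1 : ∀ t ∈ Icc t₀ T, ∀ i, Tendsto (fun n => ∫ x,
      (∫ z, ρ n (x - z) * inner ℝ (q t z) (EuclideanSpace.single i (1 : ℝ))) ^ 2 * χ t x)
      atTop (𝓝 (∫ x, q t x i ^ 2 * χ t x)) := fun t ht i => by
    have hdiff : ∀ n x,
        |(∫ z, ρ n (x - z) * inner ℝ (q t z) (EuclideanSpace.single i (1 : ℝ))) - q t x i|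
          ≤ C * meanOsc (δ n) (q t) x := fun n x => by
      have := norm_integral_mul_sub_le (hδ0 n) (hρ n) (hq.locallyIntegrable t) (he i) x
      rwa [hin t x i] at this
    refine tendsto_integral_of_dominated_convergence (fun x => (C * (2 * K) + K) ^ 2 * χ t x)
      (fun n => ?_) ((hχ.isTubeBounded.integrable ht).const_mul _) (fun n => .of_forall fun x => ?_)
      ?_
    · exact ((((hq.inner_const _).stronglyMeasurable_integral_sub_mul
        (hρ n).contDiff.continuous).comp_measurable
        measurable_prodMk_left).aestronglyMeasurable.pow 2).mul (hχm t)
    · rcases lt_or_ge R ‖x‖ with hx | hx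
      · simp [hχ.isTubeBounded.eq_zero t ht x hx]
      · rw [norm_mul, norm_pow, Real.norm_eq_abs, Real.norm_eq_abs, abs_of_nonneg (hχ.nonneg t x)]
        refine mul_le_mul_of_nonneg_right (pow_le_pow_left₀ (abs_nonneg _) ?_ 2) (hχ.nonneg t x)
        have h1 := hdiff n x
        have h2 := meanOsc_le (hδ0 n) (hδ1 n) (hK t) hx
        have h3 : |q t x i| ≤ K := (PiLp.norm_apply_le (q t x) i).trans (hK t x (by linarith))
        have h4 := abs_sub_abs_le_abs_sub
          (∫ z, ρ n (x - z) * inner ℝ (q t z) (EuclideanSpace.single i (1 : ℝ))) (q t x i)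
        have h5 : C * meanOsc (δ n) (q t) x ≤ C * (2 * K) := by gcongr
        linarith
    · filter_upwards [ae_tendsto_meanOsc (hq.locallyIntegrable t) hδlim] with x hx
      have h1 : Tendsto (fun n =>
          ∫ z, ρ n (x - z) * inner ℝ (q t z) (EuclideanSpace.single i (1 : ℝ))) atTop
          (𝓝 (q t x i)) := by
        rw [tendsto_iff_norm_sub_tendsto_zero]
        refine squeeze_zero (fun n => norm_nonneg _) (fun n => hdiff n x) ?_
        simpa using hx.const_mul C
      exact (h1.pow 2).mul_const _
  -- convergence of the right hand sides
  have hbound : ∀ n s x, s ∈ Icc t₀ T →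
      ‖M * ((‖q s x‖ ^ 2 + meanOsc (δ n) (q s) x ^ 2) * χ s x)‖
        ≤ M * (K ^ 2 + (2 * K) ^ 2) * χ s x := fun n s x hs => by
    rcases lt_or_ge R ‖x‖ with hx | hx
    · simp [hχ.isTubeBounded.eq_zero s hs x hx]
    · have hχ0 := hχ.nonneg s x
      have h1 := hK s x (by linarith)
      have h2 := meanOsc_le (hδ0 n) (hδ1 n) (hK s) hx
      have h3 := meanOsc_nonneg (δ n) (q s) x
      rw [Real.norm_eq_abs, abs_of_nonneg (by positivity), ← mul_assoc]
      gcongr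
  have hSt : ∀ n, IsTubeBounded t₀ T R fun s x =>
      M * ((‖q s x‖ ^ 2 + meanOsc (δ n) (q s) x ^ 2) * χ s x) := fun n => by
    refine ⟨(((hqm.norm.pow 2).add ((stronglyMeasurable_meanOsc hqm (δ n)).pow 2)).mul
      hχ.isTubeBounded.stronglyMeasurable).const_mul M, ?_, fun s hs x hx => by
        simp [hχ.isTubeBounded.eq_zero s hs x hx]⟩
    obtain ⟨D, hD⟩ := hχ.isTubeBounded.bound
    refine ⟨M * (K ^ 2 + (2 * K) ^ 2) * D, fun s hs x hx => (hbound n s x hs).trans ?_⟩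
    gcongr
    exact (Real.le_norm_self _).trans (hD s hs x hx)
  have hlim2 : ∀ t ∈ Icc t₀ T, Tendsto (fun n => ∫ s in t..T, ∫ x,
      M * ((‖q s x‖ ^ 2 + meanOsc (δ n) (q s) x ^ 2) * χ s x)) atTop
      (𝓝 (∫ s in t..T, ∫ x, M * (‖q s x‖ ^ 2 * χ s x))) := fun t ht => by
    have hmem : ∀ s, s ∈ Set.uIoc t T → s ∈ Icc t₀ T := fun s hs => by
      rw [uIoc_of_le ht.2] at hs
      exact ⟨ht.1.trans hs.1.le, hs.2⟩
    have hbt := (hχ.isTubeBounded.const_mul (M * (K ^ 2 + (2 * K) ^ 2))).mono ht.1 le_rfl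
    refine intervalIntegral.tendsto_integral_filter_of_dominated_convergence
      (fun s => ∫ x, M * (K ^ 2 + (2 * K) ^ 2) * χ s x) (.of_forall fun n => ?_)
      (.of_forall fun n => .of_forall fun s hs => ?_) (hbt.intervalIntegrable_integral ht.2)
      (.of_forall fun s hs => ?_)
    · rw [uIoc_of_le ht.2]
      exact (((hSt n).mono ht.1 le_rfl).intervalIntegrable_integral ht.2).1.aestronglyMeasurable
    · exact norm_integral_le_of_norm_le
        ((hχ.isTubeBounded.const_mul _).integrable (hmem s hs))
        (.of_forall fun x => hbound n s x (hmem s hs))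
    · refine tendsto_integral_of_dominated_convergence
        (fun x => M * (K ^ 2 + (2 * K) ^ 2) * χ s x)
        (fun n => ((hSt n).integrable (hmem s hs)).aestronglyMeasurable)
        ((hχ.isTubeBounded.const_mul _).integrable (hmem s hs))
        (fun n => .of_forall fun x => hbound n s x (hmem s hs)) ?_
      filter_upwards [ae_tendsto_meanOsc (hq.locallyIntegrable s) hδlim] with x hx
      have := (((hx.pow 2).const_add (‖q s x‖ ^ 2)).mul_const (χ s x)).const_mul M
      simpa using this
  refine ⟨N * M, by positivity, ?_⟩
  filter_upwards [hae, ae_restrict_mem measurableSet_Icc] with t ht htm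
  have hi : ∀ i, ∫ x, q t x i ^ 2 * χ t x ≤ ∫ s in t..T, ∫ x, M * (‖q s x‖ ^ 2 * χ s x) :=
    fun i => le_of_tendsto_of_tendsto' (hlim1 t htm i) (hlim2 t htm) fun n => ht n i
  have hint : ∀ i, Integrable fun x => q t x i ^ 2 * χ t x := fun i => by
    refine (hq2t.integrable htm).mono' ?_ (.of_forall fun x => ?_)
    · exact (((EuclideanSpace.proj (𝕜 := ℝ) i).continuous.comp_aestronglyMeasurable
        (hqsm t)).pow 2).mul (hχm t)
    · rw [norm_mul, norm_pow, Real.norm_eq_abs (χ t x), abs_of_nonneg (hχ.nonneg t x)]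
      exact mul_le_mul_of_nonneg_right (pow_le_pow_left₀ (norm_nonneg _)
        (PiLp.norm_apply_le (q t x) i) 2) (hχ.nonneg t x)
  calc ∫ x, ‖q t x‖ ^ 2 * χ t x = ∑ i, ∫ x, q t x i ^ 2 * χ t x := by
        rw [← integral_finsetSum _ fun i _ => hint i]
        refine integral_congr_ae (.of_forall fun x => ?_)
        simp only [EuclideanSpace.real_norm_sq_eq, Finset.sum_mul]
    _ ≤ ∑ _i : Fin N, ∫ s in t..T, ∫ x, M * (‖q s x‖ ^ 2 * χ s x) :=
        Finset.sum_le_sum fun i _ => hi i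
    _ = N * M * ∫ s in t..T, ∫ x, ‖q s x‖ ^ 2 * χ s x := by
        simp only [integral_const_mul, intervalIntegral.integral_const_mul]
        simp [mul_assoc]

/-- A solution vanishes where a weight is positive: Gronwall's inequality for the weighted energy. -/
theorem IsTransported.ae_eq_zero_of_weight {v q : ℝ → Vec N → Vec N}
    (hqT : IsTransported T v q) (hv : IsCaratheodory v)
    (hqm : StronglyMeasurable fun r : ℝ × Vec N => q r.1 r.2) (hq : IsLocBdd q) {t₀ R : ℝ}
    (ht₀ : 0 ≤ t₀) {χ χ' : ℝ → Vec N → ℝ} (hχ : IsWeight t₀ T R v χ χ') :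
    ∀ᵐ t ∂volume.restrict (Icc t₀ T), ∀ᵐ x, χ t x ≠ 0 → q t x = 0 := by
  rcases lt_or_ge T t₀ with hlt | hle
  · simp [Icc_eq_empty hlt.not_ge]
  obtain ⟨K, hK⟩ := hq.bound R
  have hq2t : IsTubeBounded t₀ T R fun s x => ‖q s x‖ ^ 2 * χ s x :=
    hχ.isTubeBounded.mul (hqm.norm.pow 2) ⟨K ^ 2, fun s _ x hx => by
      rw [norm_pow, norm_norm]
      exact pow_le_pow_left₀ (norm_nonneg _) (hK s x hx) 2⟩
  obtain ⟨M, hM, hle'⟩ := hqT.integral_norm_sq_mul_le hv hqm hq ht₀ hχ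
  filter_upwards [ae_nonpos_of_le_mul_integral hM (hq2t.intervalIntegrable_integral hle) hle',
    ae_restrict_mem measurableSet_Icc] with t ht htm
  have hnn : ∀ x, 0 ≤ ‖q t x‖ ^ 2 * χ t x := fun x =>
    mul_nonneg (sq_nonneg _) (hχ.nonneg t x)
  have h0 := le_antisymm ht (integral_nonneg hnn)
  rw [integral_eq_zero_iff_of_nonneg hnn (hq2t.integrable htm)] at h0
  filter_upwards [h0] with x hx hne
  simpa [hne] using hx

end Uniqueness

/-! ### Weights along trajectories -/

section TubeWeight

variable {N : ℕ}

/-- The profile of the weight: positive exactly where `|ζ| < e^{L (t - T)}`, that is, in a tube of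
radius at most `1` at the times `t ≤ T`. -/
noncomputable def tubeProfile (L T : ℝ) (p : ℝ × Vec N) : ℝ :=
  expNegInvGlue (1 - Real.exp (-(2 * L) * (p.1 - T)) * ‖p.2‖ ^ 2)

theorem contDiff_tubeProfile (L T : ℝ) : ContDiff ℝ 1 (tubeProfile (N := N) L T) := by
  refine (expNegInvGlue.contDiff (n := 1)).comp (contDiff_const.sub (ContDiff.mul ?_ ?_))
  · exact (contDiff_const.mul (contDiff_fst.sub contDiff_const)).exp
  · exact contDiff_snd.norm_sq ℝ

theorem exp_mul_exp_sq (a b : ℝ) : Real.exp (-(2 * a) * b) * Real.exp (a * b) ^ 2 = 1 := by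
  rw [← Real.exp_nat_mul, ← Real.exp_add, Real.exp_eq_one_iff]
  push_cast
  ring

theorem tubeProfile_eq_zero {L T : ℝ} {p : ℝ × Vec N} (h : Real.exp (L * (p.1 - T)) ≤ ‖p.2‖) :
    tubeProfile L T p = 0 := by
  refine expNegInvGlue.zero_of_nonpos ?_
  have h1 : Real.exp (L * (p.1 - T)) ^ 2 ≤ ‖p.2‖ ^ 2 :=
    pow_le_pow_left₀ (Real.exp_pos _).le h 2
  have h3 := mul_le_mul_of_nonneg_left h1 (Real.exp_pos (-(2 * L) * (p.1 - T))).le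
  rw [exp_mul_exp_sq] at h3
  linarith

theorem fderiv_tubeProfile_eq_zero {L T : ℝ} {p : ℝ × Vec N}
    (h : Real.exp (L * (p.1 - T)) < ‖p.2‖) : fderiv ℝ (tubeProfile L T) p = 0 := by
  have : tubeProfile L T =ᶠ[𝓝 p] fun _ => (0 : ℝ) := by
    filter_upwards [(isOpen_lt (f := fun p : ℝ × Vec N => Real.exp (L * (p.1 - T)))
      (g := fun p => ‖p.2‖) (by fun_prop) (by fun_prop)).mem_nhds h] with r hr
    exact tubeProfile_eq_zero (le_of_lt hr)
  rw [this.fderiv_eq, fderiv_const_apply]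

theorem tubeProfile_ne_zero {L T : ℝ} {p : ℝ × Vec N} (h : ‖p.2‖ < Real.exp (L * (p.1 - T))) :
    tubeProfile L T p ≠ 0 := by
  refine (expNegInvGlue.pos_of_pos ?_).ne'
  have h1 : ‖p.2‖ ^ 2 < Real.exp (L * (p.1 - T)) ^ 2 :=
    pow_lt_pow_left₀ h (norm_nonneg _) two_ne_zero
  have h3 := mul_lt_mul_of_pos_left h1 (Real.exp_pos (-(2 * L) * (p.1 - T)))
  rw [exp_mul_exp_sq] at h3
  linarith

/-- The profile increases in the directions `(1, w)` where `w` grows at most linearly in `ζ`. -/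
theorem fderiv_tubeProfile_nonneg {L T t : ℝ} {ζ w : Vec N} (hw : ‖w‖ ≤ L * ‖ζ‖) :
    0 ≤ fderiv ℝ (tubeProfile L T) (t, ζ) (1, w) := by
  set σ : ℝ × Vec N → ℝ := fun p => 1 - Real.exp (-(2 * L) * (p.1 - T)) * ‖p.2‖ ^ 2 with hσ
  have hline : HasDerivAt (fun τ : ℝ => (t, ζ) + τ • ((1 : ℝ), w)) ((1 : ℝ), w) 0 := by
    simpa using ((hasDerivAt_id (0 : ℝ)).smul_const ((1 : ℝ), w)).const_add (t, ζ)
  have hd : DifferentiableAt ℝ (tubeProfile L T) ((t, ζ) + (0 : ℝ) • ((1 : ℝ), w)) :=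
    (contDiff_tubeProfile L T).differentiable one_ne_zero _
  have h1 := hd.hasFDerivAt.comp_hasDerivAt (0 : ℝ) hline
  -- the argument of the profile along the line
  have h2 : HasDerivAt (fun τ : ℝ => σ ((t, ζ) + τ • ((1 : ℝ), w)))
      (Real.exp (-(2 * L) * (t - T)) * (2 * L * ‖ζ‖ ^ 2 - 2 * inner ℝ ζ w)) 0 := by
    have e1 : HasDerivAt (fun τ : ℝ => Real.exp (-(2 * L) * (t + τ - T)))
        (Real.exp (-(2 * L) * (t + 0 - T)) * (-(2 * L) * 1)) 0 :=
      ((((hasDerivAt_id (0 : ℝ)).const_add t).sub_const T).const_mul (-(2 * L))).exp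
    have e2 : HasDerivAt (fun τ : ℝ => ‖ζ + τ • w‖ ^ 2) (2 * inner ℝ (ζ + (0 : ℝ) • w) w) 0 := by
      have : HasDerivAt (fun τ : ℝ => ζ + τ • w) w 0 := by
        simpa using ((hasDerivAt_id (0 : ℝ)).smul_const w).const_add ζ
      exact this.norm_sq
    have e3 := (e1.mul e2).const_sub 1
    have e4 : (fun τ : ℝ => σ ((t, ζ) + τ • ((1 : ℝ), w)))
        = fun τ => 1 - ((fun τ : ℝ => Real.exp (-(2 * L) * (t + τ - T)))
          * fun τ : ℝ => ‖ζ + τ • w‖ ^ 2) τ := by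
      funext τ
      simp [hσ]
    rw [e4]
    refine e3.congr_deriv ?_
    simp only [zero_smul, add_zero]
    ring
  have h3 : HasDerivAt (fun τ : ℝ => tubeProfile L T ((t, ζ) + τ • ((1 : ℝ), w))) _ 0 :=
    (((expNegInvGlue.contDiff (n := 1)).differentiable one_ne_zero).differentiableAt.hasDerivAt
      (x := σ ((t, ζ) + (0 : ℝ) • ((1 : ℝ), w)))).comp (0 : ℝ) h2
  have h4 := h1.unique h3
  rw [zero_smul, add_zero] at h4
  rw [h4]
  refine mul_nonneg expNegInvGlue.monotone.deriv_nonneg (mul_nonneg (Real.exp_pos _).le ?_)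
  have h5 := (real_inner_le_norm ζ w).trans (mul_le_mul_of_nonneg_left hw (norm_nonneg ζ))
  nlinarith

variable {T : ℝ}

/-- The weight carried by a trajectory. -/
theorem isWeight_tubeProfile {v : ℝ → Vec N → Vec N} (hv : IsCaratheodory v) {t₀ R : ℝ}
    (ht₀ : t₀ ≤ T) {y : Vec N} {x₀ : ℝ → Vec N} (hx₀ : Continuous x₀)
    (hx : IsTrajectory T v t₀ y x₀) {L : NNReal}
    (hL : ∀ t, LipschitzOnWith L (v t) (closedBall 0 R))
    (hLb : ∀ t, ∀ x ∈ closedBall (0 : Vec N) R, ‖v t x‖ ≤ L)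
    (hR : ∀ s ∈ Icc t₀ T, ‖x₀ s‖ + 1 ≤ R) :
    IsWeight t₀ T R v (fun s x => tubeProfile L T (s, x - x₀ s))
      fun s x => fderiv ℝ (tubeProfile L T) (s, x - x₀ s) (1, -v s (x₀ s)) := by
  have hΘ := contDiff_tubeProfile (N := N) L T
  have hΘ' : Continuous (fderiv ℝ (tubeProfile (N := N) L T)) := hΘ.continuous_fderiv one_ne_zero
  have hxR : ∀ s ∈ Icc t₀ T, ‖x₀ s‖ ≤ R := fun s hs => by
    linarith [hR s hs]
  have hpair : Continuous fun p : ℝ × Vec N => (p.1, p.2 - x₀ p.1) := by fun_prop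
  have hfar : ∀ s ∈ Icc t₀ T, ∀ x, R < ‖x‖ → Real.exp (L * (s - T)) < ‖x - x₀ s‖ :=
    fun s hs x hxR' => by
      have h1 : Real.exp (L * (s - T)) ≤ 1 := Real.exp_le_one_iff.2
        (mul_nonpos_of_nonneg_of_nonpos L.coe_nonneg (by linarith [hs.2]))
      linarith [hR s hs, norm_sub_norm_le x (x₀ s)]
  have hcomp : IsCompact (Icc t₀ T ×ˢ closedBall (0 : Vec N) R) :=
    isCompact_Icc.prod (isCompact_closedBall 0 R)
  have hlip : ∀ x, ∃ C, LipschitzOnWith C (fun s => tubeProfile L T (s, x - x₀ s)) (Icc t₀ T) :=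
    fun x => by
    have hx₀l : LipschitzOnWith L x₀ (Icc t₀ T) := by
      refine LipschitzOnWith.of_dist_le_mul fun s hs r hr => ?_
      rcases le_total s r with h | h
      · rw [dist_comm, dist_comm s, dist_eq_norm, Real.dist_eq, abs_of_nonneg (sub_nonneg.2 h)]
        exact hx.norm_sub_le_mul hv hLb hxR hs ⟨h, hr.2⟩
      · rw [dist_eq_norm, Real.dist_eq, abs_of_nonneg (sub_nonneg.2 h)]
        exact hx.norm_sub_le_mul hv hLb hxR hr ⟨h, hs.2⟩
    have hp : LipschitzOnWith (max 1 (0 + L)) (fun s => (s, x - x₀ s)) (Icc t₀ T) :=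
      LipschitzWith.id.lipschitzOnWith.prodMk
        ((LipschitzWith.const x).lipschitzOnWith.sub hx₀l)
    obtain ⟨C, hC⟩ := hΘ.locallyLipschitz.locallyLipschitzOn.exists_lipschitzOnWith_of_compact
      (isCompact_Icc.image_of_continuousOn
        (hpair.comp (Continuous.prodMk continuous_id (continuous_const (y := x)))).continuousOn)
    exact ⟨_, hC.comp hp fun s hs => ⟨s, hs, rfl⟩⟩
  refine ⟨fun s => ?_, fun s x => expNegInvGlue.nonneg _, ⟨?_, ?_, fun s hs x h => ?_⟩,
    ⟨?_, ?_, fun s hs x h => ?_⟩, fun x => ?_, fun x => ?_, fun s hs x hxR' => ?_⟩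
  · exact hΘ.comp (contDiff_const.prodMk (contDiff_id.sub contDiff_const))
  · exact (hΘ.continuous.comp hpair).stronglyMeasurable
  · obtain ⟨C, hC⟩ := hcomp.exists_bound_of_continuousOn (hΘ.continuous.comp hpair).continuousOn
    exact ⟨C, fun s hs x hx' => hC (s, x) ⟨hs, by simpa using hx'⟩⟩
  · exact tubeProfile_eq_zero (hfar s hs x h).le
  · refine (isBoundedBilinearMap_apply (𝕜 := ℝ) (E := ℝ × Vec N) (F := ℝ)).continuous
      |>.comp_stronglyMeasurable (((hΘ'.comp hpair).stronglyMeasurable).prodMk ?_)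
    refine stronglyMeasurable_const.prodMk (StronglyMeasurable.neg ?_)
    exact hv.stronglyMeasurable.comp_measurable (g := fun p : ℝ × Vec N => (p.1, x₀ p.1))
      (measurable_fst.prodMk (hx₀.measurable.comp measurable_fst))
  · obtain ⟨C, hC⟩ := hcomp.exists_bound_of_continuousOn (hΘ'.comp hpair).continuousOn
    refine ⟨C * max 1 L, fun s hs x hx' => ?_⟩
    have h1 := hC (s, x) ⟨hs, by simpa using hx'⟩
    refine (ContinuousLinearMap.le_opNorm _ _).trans
      (mul_le_mul h1 ?_ (norm_nonneg _) ((norm_nonneg _).trans h1))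
    rw [Prod.norm_def, norm_neg, norm_one]
    exact max_le_max le_rfl (hLb s _ (by simpa using hxR s hs))
  · rw [fderiv_tubeProfile_eq_zero (hfar s hs x h)]
    rfl
  · obtain ⟨C, hC⟩ := hlip x
    rw [← uIcc_of_le ht₀] at hC
    exact hC.absolutelyContinuousOnInterval
  · have hne : ∀ c : ℝ, ∀ᵐ s : ℝ, s ≠ c := fun c => by simp [ae_iff, measure_singleton]
    have hvi := hv.intervalIntegrable_comp ht₀ hx.1
    filter_upwards [hvi.ae_hasDerivAt_integral, hne t₀, hne T] with s hs h0 h1 hsm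
    have hso : s ∈ Ioo t₀ T := ⟨lt_of_le_of_ne hsm.1 h0.symm, lt_of_le_of_ne hsm.2 h1⟩
    have hd := (hs (by rwa [uIcc_of_le ht₀]) t₀ (by simp)).const_add y
    have hdx : HasDerivAt x₀ (v s (x₀ s)) s := by
      refine hd.congr_of_eventuallyEq ?_
      filter_upwards [Icc_mem_nhds hso.1 hso.2] with r hr
      exact hx.2 r hr
    have hp : HasDerivAt (fun r => (r, x - x₀ r)) ((1 : ℝ), -v s (x₀ s)) s :=
      (hasDerivAt_id s).prodMk (hdx.const_sub x)
    exact (hΘ.differentiable one_ne_zero _).hasFDerivAt.comp_hasDerivAt s hp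
  · have h1 : fderiv ℝ (fun x => tubeProfile L T (s, x - x₀ s)) x (v s x)
        = fderiv ℝ (tubeProfile L T) (s, x - x₀ s) (0, v s x) := by
      have hp : HasFDerivAt (fun x => (s, x - x₀ s)) (ContinuousLinearMap.inr ℝ ℝ (Vec N)) x :=
        (hasFDerivAt_const s x).prodMk ((hasFDerivAt_id x).sub_const (x₀ s))
      have hd : HasFDerivAt (fun x => tubeProfile L T (s, x - x₀ s)) _ x :=
        (hΘ.differentiable one_ne_zero _).hasFDerivAt.comp x hp
      rw [hd.fderiv]
      simp
    have h2 : ((1 : ℝ), -v s (x₀ s)) + (0, v s x) = (1, v s x - v s (x₀ s)) := by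
      simp [neg_add_eq_sub]
    rw [h1, ← map_add, h2]
    exact fderiv_tubeProfile_nonneg ((hL s).norm_sub_le (by simpa using hxR')
      (by simpa using hxR s hs))

/-- A solution vanishes in a tube around a trajectory. The tube narrows backwards in time, and its
radius is bounded below by `e^{-LT}`. -/
theorem IsTransported.ae_eq_zero_of_trajectory {v q : ℝ → Vec N → Vec N}
    (hqT : IsTransported T v q) (hv : IsCaratheodory v)
    (hqm : StronglyMeasurable fun r : ℝ × Vec N => q r.1 r.2) (hq : IsLocBdd q) {t₀ R : ℝ}
    (ht₀ : t₀ ∈ Icc 0 T) {y : Vec N} {x₀ : ℝ → Vec N} (hx : IsTrajectory T v t₀ y x₀) {L : NNReal}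
    (hL : ∀ t, LipschitzOnWith L (v t) (closedBall 0 R))
    (hLb : ∀ t, ∀ x ∈ closedBall (0 : Vec N) R, ‖v t x‖ ≤ L)
    (hR : ∀ s ∈ Icc t₀ T, ‖x₀ s‖ + 1 ≤ R) :
    ∀ᵐ t ∂volume.restrict (Icc t₀ T), ∀ᵐ x, ‖x - x₀ t‖ < Real.exp (-(L * T)) → q t x = 0 := by
  -- a continuous extension of the trajectory to all times
  set z : ℝ → Vec N := IccExtend ht₀.2 ((Icc t₀ T).domRestrict x₀) with hz
  have hzc : Continuous z := (continuousOn_iff_continuous_domRestrict.1 hx.1).Icc_extend'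
  have hzeq : ∀ s ∈ Icc t₀ T, z s = x₀ s := fun s hs => by
    rw [hz, IccExtend_of_mem _ _ hs, domRestrict_apply]
  have hzt : IsTrajectory T v t₀ y z := by
    refine ⟨hzc.continuousOn, fun s hs => ?_⟩
    rw [hzeq s hs, hx.2 s hs]
    congr 1
    refine intervalIntegral.integral_congr fun r hr => ?_
    rw [uIcc_of_le hs.1] at hr
    simp only [hzeq r ⟨hr.1, hr.2.trans hs.2⟩]
  have hw := isWeight_tubeProfile hv ht₀.2 hzc hzt hL hLb fun s hs => by
    rw [hzeq s hs]
    exact hR s hs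
  filter_upwards [hqT.ae_eq_zero_of_weight hv hqm hq ht₀.1 hw,
    ae_restrict_mem measurableSet_Icc] with t ht htm
  filter_upwards [ht] with x hx' hlt
  refine hx' (tubeProfile_ne_zero ?_)
  rw [hzeq t htm]
  refine hlt.trans_le (Real.exp_le_exp.2 ?_)
  nlinarith [mul_nonneg L.coe_nonneg (ht₀.1.trans htm.1)]

/-- A solution of the transport system without source and with zero terminal value vanishes, if
the field has trajectories on `[t, T]` from every initial position. -/
theorem IsTransported.ae_eq_zero {v q : ℝ → Vec N → Vec N} (hqT : IsTransported T v q)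
    (hv : IsCaratheodory v) (hqm : StronglyMeasurable fun r : ℝ × Vec N => q r.1 r.2)
    (hq : IsLocBdd q) {X : ℝ → Vec N → ℝ → Vec N}
    (hX : ∀ t ∈ Icc 0 T, ∀ y, IsTrajectory T v t y (X t y)) :
    ∀ᵐ t ∂volume.restrict (Icc 0 T), ∀ᵐ x, q t x = 0 := by
  choose L hL hLb using fun n : ℕ => hv.bound (n + 1)
  set d : ℕ → Vec N := TopologicalSpace.denseSeq (Vec N)
  have hd : DenseRange d := TopologicalSpace.denseRange_denseSeq _
  -- the tubes around the trajectories from rational times and points of a dense sequence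
  have htube : ∀ (r : ℚ) (k n : ℕ), ∀ᵐ t, t ∈ Icc 0 T → (r : ℝ) ∈ Icc 0 t →
      (∀ s ∈ Icc (r : ℝ) T, ‖X r (d k) s‖ ≤ n) →
      ∀ᵐ x, ‖x - X r (d k) t‖ < Real.exp (-(L n * T)) → q t x = 0 := fun r k n => by
    by_cases h : (r : ℝ) ∈ Icc 0 T ∧ ∀ s ∈ Icc (r : ℝ) T, ‖X r (d k) s‖ ≤ n
    · have := hqT.ae_eq_zero_of_trajectory hv hqm hq h.1 (hX r h.1 (d k)) (hL n) (hLb n)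
        fun s hs => by linarith [h.2 s hs]
      rw [ae_restrict_iff' measurableSet_Icc] at this
      filter_upwards [this] with t ht htm hr _ using ht ⟨hr.2, htm.2⟩
    · exact .of_forall fun t htm hr hb => absurd ⟨⟨hr.1, hr.2.trans htm.2⟩, hb⟩ h
  have hne : ∀ᵐ t : ℝ, t ≠ 0 := by simp [ae_iff, measure_singleton]
  rw [ae_restrict_iff' measurableSet_Icc]
  filter_upwards [ae_all_iff.2 fun r => ae_all_iff.2 fun k => ae_all_iff.2 (htube r k), hne] with
    t ht ht0 htm
  have htp : 0 < t := lt_of_le_of_ne htm.1 ht0.symm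
  have ht' : ∀ᵐ x, ∀ (r : ℚ) (k n : ℕ), (r : ℝ) ∈ Icc 0 t →
      (∀ s ∈ Icc (r : ℝ) T, ‖X r (d k) s‖ ≤ n) →
      ‖x - X r (d k) t‖ < Real.exp (-(L n * T)) → q t x = 0 := by
    refine ae_all_iff.2 fun r => ae_all_iff.2 fun k => ae_all_iff.2 fun n => ?_
    by_cases h : (r : ℝ) ∈ Icc 0 t ∧ ∀ s ∈ Icc (r : ℝ) T, ‖X r (d k) s‖ ≤ n
    · filter_upwards [ht r k n htm h.1 h.2] with x hx _ _ using hx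
    · exact .of_forall fun x h1 h2 => absurd ⟨h1, h2⟩ h
  filter_upwards [ht'] with x hx
  obtain ⟨R, δ, hδ, hR⟩ := exists_ball_of_trajectories hv hX htm x
  obtain ⟨n, hn⟩ := exists_nat_ge R
  set ε := Real.exp (-(L n * T)) with hε
  have hε0 : 0 < ε := Real.exp_pos _
  set M : ℝ := 2 * (L n + 1) with hM
  have hM0 : 0 < M := by positivity
  obtain ⟨r, hr1, hr2⟩ := exists_rat_btwn (show max 0 (t - min δ (ε / M)) < t from
    max_lt htp (by linarith [lt_min hδ (div_pos hε0 hM0)]))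
  have hr0 : (0 : ℝ) ≤ r := (le_max_left _ _).trans hr1.le
  have hrt : t - r < min δ (ε / M) := by linarith [(le_max_right 0 _).trans_lt hr1]
  obtain ⟨k, hk⟩ := hd.exists_dist_lt x (lt_min hδ (half_pos hε0))
  rw [dist_eq_norm] at hk
  have hrm : (r : ℝ) ∈ Icc 0 T := ⟨hr0, hr2.le.trans htm.2⟩
  have hb : ∀ s ∈ Icc (r : ℝ) T, ‖X r (d k) s‖ ≤ n := fun s hs =>
    (hR r hrm (d k) (by
      rw [abs_sub_comm, abs_of_pos (by linarith)]
      exact hrt.trans_le (min_le_left _ _)) (by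
      rw [norm_sub_rev]
      exact hk.trans_le (min_le_left _ _)) s hs).trans hn
  refine hx r k n ⟨hr0, hr2.le⟩ hb ?_
  have htraj := hX r hrm (d k)
  have h1 : ‖X r (d k) t - X r (d k) r‖ ≤ L n * (t - r) :=
    htraj.norm_sub_le_mul hv (R := n) (fun t x hx => hLb n t x
      (closedBall_subset_closedBall (by linarith) hx)) hb ⟨le_rfl, hrm.2⟩ ⟨hr2.le, htm.2⟩
  rw [htraj.apply_self hrm.2] at h1
  have h2 : (L n : ℝ) * (t - r) < ε / 2 := by
    have h3 : t - r < ε / M := hrt.trans_le (min_le_right _ _)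
    rw [lt_div_iff₀ hM0] at h3
    have h4 : 0 < t - r := by linarith
    nlinarith [(L n).coe_nonneg]
  calc ‖x - X r (d k) t‖ = ‖(x - d k) - (X r (d k) t - d k)‖ := by congr 1; abel
    _ ≤ ‖x - d k‖ + ‖X r (d k) t - d k‖ := norm_sub_le _ _
    _ < ε := by linarith [hk.trans_le (min_le_right _ _)]

end TubeWeight

/-! ### The costate of an optimal feedback map -/

section Optimal

variable {N m : ℕ} {T : ℝ}

/-- States depend on the feedback map only up to a null set of times. -/
theorem IsState.congr_feedback {f : Vec N → Vec m → Vec N} {u u' : ℝ → Vec N → Vec m}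
    (h : ∀ᵐ t ∂volume.restrict (Icc 0 T), u' t = u t) {t : ℝ} (ht : 0 ≤ t) {y : Vec N}
    {x : ℝ → Vec N} (hx : IsState T f u t y x) : IsState T f u' t y x := by
  refine ⟨hx.1, fun s hs => ?_⟩
  rw [hx.2 s hs]
  congr 1
  refine intervalIntegral.integral_congr_ae ?_
  filter_upwards [(ae_restrict_iff' measurableSet_Icc).1 h] with r hr hrm
  rw [uIoc_of_le hs.1] at hrm
  rw [hr ⟨ht.trans hrm.1.le, hrm.2.trans hs.2⟩]

theorem cost_congr_feedback {F : Vec N → Vec m → ℝ} {g : Vec N → ℝ} {u u' : ℝ → Vec N → Vec m}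
    (h : ∀ᵐ t ∂volume.restrict (Icc 0 T), u' t = u t) {t : ℝ} (ht : t ∈ Icc 0 T) (x : ℝ → Vec N) :
    cost T F g u' t x = cost T F g u t x := by
  rw [cost, cost]
  congr 1
  refine intervalIntegral.integral_congr_ae ?_
  filter_upwards [(ae_restrict_iff' measurableSet_Icc).1 h] with r hr hrm
  rw [uIoc_of_le ht.2] at hrm
  rw [hr ⟨ht.1.trans hrm.1.le, hrm.2⟩]

/-- The value function is a Carathéodory field. -/
theorem isCaratheodory_extValue {l : ℝ → Vec N → ℝ} {g : Vec N → ℝ} {X : ℝ → Vec N → ℝ → Vec N}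
    (hT : 0 ≤ T) (hW : LocallyLipschitz (extValue T l g X)) :
    IsCaratheodory fun t x => extValue T l g X (t, x) where
  stronglyMeasurable := hW.continuous.stronglyMeasurable
  bound R := by
    set c : ℝ → ℝ := fun t => max 0 (min T t) with hc
    have hcm : ∀ t, c t ∈ Icc 0 T := fun t => ⟨le_max_left _ _, max_le hT (min_le_left _ _)⟩
    have hcW : ∀ t x, extValue T l g X (t, x) = extValue T l g X (c t, x) := fun t x => by
      rw [extValue_of_mem (hcm t)]
      rfl
    have hmem : ∀ t, ∀ x ∈ closedBall (0 : Vec N) R,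
        (c t, x) ∈ closedBall (0 : ℝ × Vec N) (max T R) := fun t x hx => by
      rw [mem_closedBall_zero_iff, Prod.norm_def, Real.norm_eq_abs, abs_of_nonneg (hcm t).1]
      exact max_le_max (hcm t).2 (by simpa using hx)
    obtain ⟨L, hL⟩ := hW.exists_lipschitzOnWith_closedBall (max T R)
    obtain ⟨C, hC⟩ := (isCompact_closedBall (0 : ℝ × Vec N) (max T R)).exists_bound_of_continuousOn
      hW.continuous.continuousOn
    refine ⟨max L C.toNNReal, fun t => LipschitzOnWith.of_dist_le_mul fun x hx y hy => ?_,
      fun t x hx => ?_⟩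
    · rw [hcW t x, hcW t y]
      refine (hL.dist_le_mul _ (hmem t x hx) _ (hmem t y hy)).trans ?_
      rw [Prod.dist_eq, dist_self, max_eq_right dist_nonneg]
      gcongr
      exact le_max_left _ _
    · rw [hcW t x, NNReal.coe_max]
      exact (hC _ (hmem t x hx)).trans ((Real.le_coe_toNNReal C).trans (le_max_right _ _))

theorem fderiv_slice {W : ℝ × Vec N → ℝ} {t : ℝ} {x : Vec N} (hd : DifferentiableAt ℝ W (t, x))
    (e : Vec N) : fderiv ℝ (fun x => W (t, x)) x e = fderiv ℝ W (t, x) (0, e) := by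
  have hp : HasFDerivAt (fun x : Vec N => (t, x)) (ContinuousLinearMap.inr ℝ ℝ (Vec N)) x :=
    (hasFDerivAt_const t x).prodMk (hasFDerivAt_id x)
  have : HasFDerivAt (fun x => W (t, x)) _ x := hd.hasFDerivAt.comp x hp
  rw [this.fderiv]
  simp

/-- A function on an interval with a minimum at its left end point has a nonnegative derivative
there. -/
theorem nonneg_of_hasDerivAt_of_le {φ : ℝ → ℝ} {a : ℝ} (h : HasDerivAt φ a 0)
    (hφ : ∀ ε ∈ Icc (0 : ℝ) 1, φ 0 ≤ φ ε) : 0 ≤ a := by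
  refine ge_of_tendsto h.tendsto_slope_zero_right ?_
  filter_upwards [Ioo_mem_nhdsGT one_pos] with ε hε
  rw [zero_add, smul_eq_mul]
  exact mul_nonneg (inv_nonneg.2 hε.1.le) (sub_nonneg.2 (hφ ε ⟨hε.1.le, hε.2.le⟩))

/-- The pointwise maximum principle: if `u` is optimal, then `∇I(u)` is nonnegative in the directions
that point into `K`. -/
theorem IsOptimal.ae_gradI_nonneg (hT : 0 < T) {F : Vec N → Vec m → ℝ}
    {f : Vec N → Vec m → Vec N} {g : Vec N → ℝ}
    (hF : ContDiff ℝ 1 fun q : Vec N × Vec m => F q.1 q.2)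
    (hf : ContDiff ℝ 1 fun q : Vec N × Vec m => f q.1 q.2) (hg : ContDiff ℝ 1 g)
    {K : Set (Vec m)} (hK : IsCompact K) (hKc : Convex ℝ K) {u : ℝ → Vec N → Vec m}
    (hopt : IsOptimal T K F f g u) {p : ℝ → Vec N → Vec N} (hp : IsCostate T F f g u p) :
    ∀ᵐ t ∂volume.restrict (Icc 0 T), ∀ᵐ x, ∀ k ∈ K, 0 ≤ gradI F f u p t x (k - u t x) := by
  obtain ⟨u', hu', hu'u⟩ := hopt.1.exists_isRegularFeedback hT
  obtain ⟨p', hp'm, hp'b, hp'p⟩ := hp.exists_modification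
  have hv : IsCaratheodory fun t x => f x (u' t x) := hu'.isCaratheodory hK hKc hf
  have hl : IsCaratheodory fun t x => F x (u' t x) := hu'.isCaratheodory hK hKc hF
  -- optimal states
  have hex : ∀ t ∈ Icc 0 T, ∀ y, ∃ x, IsState T f u' t y x ∧
      ∀ (V : ℝ → Vec N → Vec m) (z : ℝ → Vec N), IsFeasible T K V → IsState T f V t y z →
        cost T F g u' t x ≤ cost T F g V t z := fun t ht y => by
    obtain ⟨x, hx, hxo⟩ := hopt.2 t ht y
    refine ⟨x, hx.congr_feedback hu'u ht.1, fun V z hV hz => ?_⟩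
    rw [cost_congr_feedback hu'u ht]
    exact hxo V z hV hz
  choose! X hX using hex
  have hXs : ∀ t ∈ Icc 0 T, ∀ y, IsState T f u' t y (X t y) := fun t ht y => (hX t ht y).1
  have hXo : ∀ t ∈ Icc 0 T, ∀ y, ∀ (V : ℝ → Vec N → Vec m) (z : ℝ → Vec N),
      IsFeasible T K V → IsState T f V t y z → cost T F g u' t (X t y) ≤ cost T F g V t z :=
    fun t ht y => (hX t ht y).2
  -- the value function
  set W : ℝ × Vec N → ℝ := extValue T (fun t x => F x (u' t x)) g X with hWdef
  have hW : LocallyLipschitz W := locallyLipschitz_extValue hT.le hv hl hg.locallyLipschitz hXs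
  have hwc : IsCaratheodory fun t x => W (t, x) := isCaratheodory_extValue hT.le hW
  have hWT : (fun x => W (T, x)) = g := by
    funext x
    have hTm : T ∈ Icc 0 T := ⟨hT.le, le_rfl⟩
    rw [hWdef, extValue_of_mem hTm, valueFn, intervalIntegral.integral_same, zero_add,
      IsTrajectory.apply_self (v := fun t x => f x (u' t x)) le_rfl (hXs T hTm x)]
  have hd : ∀ᵐ q : ℝ × Vec N, DifferentiableAt ℝ W q :=
    hW.ae_differentiableAt ((volume : Measure ℝ).prod (volume : Measure (Vec N)))
  have hd' : ∀ᵐ t : ℝ, ∀ᵐ x : Vec N, DifferentiableAt ℝ W (t, x) :=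
    Measure.ae_ae_of_ae_prod (μ := (volume : Measure ℝ)) (ν := (volume : Measure (Vec N))) hd
  have hne : ∀ c : ℝ, ∀ᵐ s : ℝ, s ≠ c := fun c => by simp [ae_iff, measure_singleton]
  have hIoo : ∀ᵐ t ∂volume.restrict (Icc 0 T), t ∈ Ioo 0 T := by
    rw [ae_restrict_iff' measurableSet_Icc]
    filter_upwards [hne 0, hne T] with t h0 h1 hm
    exact ⟨lt_of_le_of_ne hm.1 h0.symm, lt_of_le_of_ne hm.2 h1⟩
  -- the Hamilton-Jacobi equation along the feedback
  have hHJ : ∀ᵐ t ∂volume.restrict (Icc 0 T), ∀ᵐ x,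
      fderiv ℝ W (t, x) (1, f x (u' t x)) + F x (u' t x) = 0 := by
    filter_upwards [hIoo, ae_restrict_of_ae hv.ae_hasDerivAt_integral,
      ae_restrict_of_ae hl.ae_hasDerivAt_integral, ae_restrict_of_ae hd'] with t ht hvt hlt hdt
    filter_upwards [hdt] with x hx
    exact fderiv_extValue_apply_field hv hl hXs ht (hvt x) (hlt x) hx
  have heq : ∀ᵐ t ∂volume.restrict (Icc 0 T), ∀ᵐ x, fderiv ℝ W (t, x) (1, 0)
      + fderiv ℝ (fun x => W (t, x)) x (f x (u' t x)) + F x (u' t x) = 0 := by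
    filter_upwards [hHJ, ae_restrict_of_ae hd'] with t ht hdt
    filter_upwards [ht, hdt] with x hx hdx
    rw [fderiv_slice hdx, ← map_add, Prod.mk_add_mk, add_zero, zero_add]
    exact hx
  -- the costate is minus the gradient of the value function
  have hp'lb : IsLocBdd p' := ⟨⟨_, hp'm, fun s => .of_forall fun x => rfl⟩, hp'b⟩
  have hgm := stronglyMeasurable_spaceGrad (w := fun t x => W (t, x)) hW.continuous
  have hgb : IsLocBdd (spaceGrad fun t x => W (t, x)) :=
    ⟨⟨_, hgm, fun s => .of_forall fun x => rfl⟩, exists_norm_spaceGrad_le hwc⟩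
  have hzero := (hp.isTransported_add_spaceGrad hT hu'u hp'p hp'lb hv hl (w := fun t x => W (t, x))
    hW hwc hWT hd heq).ae_eq_zero hv (hp'm.add hgm) (hp'lb.add hgb) hXs
  filter_upwards [hIoo, hHJ, ae_restrict_of_ae hd', hu'u, hp'p, hzero] with t ht hHJt hdt hut hpt
    hzt
  filter_upwards [hHJt, hdt, hpt, hzt] with x hHJx hdx hpx hzx k hk
  set a : Vec m := u t x with ha
  have haK : a ∈ K := hopt.1.mem t ⟨ht.1.le, ht.2.le⟩ x
  have hFx : HasFDerivAt (F x) (fderiv ℝ (F x) a) a :=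
    ((hF.comp (contDiff_prodMk_right x)).differentiable one_ne_zero a).hasFDerivAt
  have hfx : HasFDerivAt (f x) (fderiv ℝ (f x) a) a :=
    ((hf.comp (contDiff_prodMk_right x)).differentiable one_ne_zero a).hasFDerivAt
  have hline : HasDerivAt (fun ε : ℝ => a + ε • (k - a)) (k - a) 0 := by
    simpa using ((hasDerivAt_id (0 : ℝ)).smul_const (k - a)).const_add a
  have ha0 : a + (0 : ℝ) • (k - a) = a := by simp
  have h1 : HasDerivAt (fun ε : ℝ => f x (a + ε • (k - a))) (fderiv ℝ (f x) a (k - a)) 0 := by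
    rw [← ha0] at hfx
    have := hfx.comp_hasDerivAt (0 : ℝ) hline
    rwa [ha0] at this
  have h2 : HasDerivAt (fun ε : ℝ => F x (a + ε • (k - a))) (fderiv ℝ (F x) a (k - a)) 0 := by
    rw [← ha0] at hFx
    have := hFx.comp_hasDerivAt (0 : ℝ) hline
    rwa [ha0] at this
  have h3 : HasDerivAt (fun ε : ℝ => fderiv ℝ W (t, x) (1, f x (a + ε • (k - a))))
      (fderiv ℝ W (t, x) (0, fderiv ℝ (f x) a (k - a))) 0 :=
    (fderiv ℝ W (t, x)).hasFDerivAt.comp_hasDerivAt (0 : ℝ)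
      ((hasDerivAt_const (0 : ℝ) (1 : ℝ)).prodMk h1)
  have h4 := nonneg_of_hasDerivAt_of_le (h3.add h2) fun ε hε => by
    have hkε : a + ε • (k - a) ∈ K := hKc.add_smul_sub_mem haK hk hε
    have := fderiv_extValue_apply_const_control hu' hF.continuous hf hv hl hXs hXo hkε ht hdx
    simp only [Pi.add_apply, ha0]
    rw [hut] at hHJx
    rw [hHJx]
    exact this
  have h5 : p t x = -spaceGrad (fun t x => W (t, x)) t x := by
    rw [← hpx]
    exact eq_neg_of_add_eq_zero_left hzx
  rw [gradI, h5]
  simp only [map_neg, ContinuousLinearMap.neg_comp, sub_neg_eq_add, _root_.add_apply,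
    ContinuousLinearMap.comp_apply, innerSL_apply_apply, inner_spaceGrad]
  rw [fderiv_slice hdx, add_comm]
  exact h4

end Optimal

end FeedbackControl

theorem mainTheorem2 {N m : ℕ} (hN : 0 < N) {T : ℝ} (hT : 0 < T)
    {F : FeedbackControl.Vec N → FeedbackControl.Vec m → ℝ}
    {f : FeedbackControl.Vec N → FeedbackControl.Vec m → FeedbackControl.Vec N}
    {g : FeedbackControl.Vec N → ℝ}
    (hF : ContDiff ℝ 1 (fun q : FeedbackControl.Vec N × FeedbackControl.Vec m => F q.1 q.2))
    (hf : ContDiff ℝ 1 (fun q : FeedbackControl.Vec N × FeedbackControl.Vec m => f q.1 q.2))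
    (hg : ContDiff ℝ 1 g)
    {K : Set (FeedbackControl.Vec m)} (hKcompact : IsCompact K) (hKconvex : Convex ℝ K)
    {u : ℝ → FeedbackControl.Vec N → FeedbackControl.Vec m}
    (hu : FeedbackControl.IsFeasible T K u)
    {p : ℝ → FeedbackControl.Vec N → FeedbackControl.Vec N}
    (hp : FeedbackControl.IsCostate T F f g u p) :
    (∀ U : ℝ → FeedbackControl.Vec N → FeedbackControl.Vec m,
      FeedbackControl.IsFeasible T K U →
      (∀ ε ∈ Icc (0 : ℝ) 1,
        FeedbackControl.IsFeasible T K (fun t x => u t x + ε • (U t x - u t x))) ∧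
      ∀ t ∈ Icc 0 T,
        FeedbackControl.IsObstacleSolution K (u t) (FeedbackControl.gradI F f u p t) (U t) →
        ∫ x, FeedbackControl.gradI F f u p t x (U t x - u t x)
            ≤ - ∫ x, ‖FeedbackControl.weakGradient (U t) x
                - FeedbackControl.weakGradient (u t) x‖ ^ 2 ∧
          ∫ x, FeedbackControl.gradI F f u p t x (U t x - u t x) ≤ 0) ∧
    (FeedbackControl.IsOptimal T K F f g u →
      ∀ᵐ t ∂(volume.restrict (Icc 0 T)), ∀ V : FeedbackControl.Vec N → FeedbackControl.Vec m,
        FeedbackControl.IsObstacleSolution K (u t) (FeedbackControl.gradI F f u p t) V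
          ↔ V =ᵐ[volume] u t) := by
  have hlip : ∀ t ∈ Icc 0 T, ∃ D, FeedbackControl.HasWeakGradient (u t) D := fun t ht => by
    obtain ⟨L, hL⟩ := hu.lipschitz
    exact ⟨_, FeedbackControl.hasWeakGradient_of_locallyLipschitz (hL t ht).locallyLipschitz⟩
  refine ⟨fun U hU => ⟨fun ε hε => FeedbackControl.IsFeasible.add_smul_sub hKconvex hu hU hε,
    fun t ht hsol => ?_⟩, fun hopt => ?_⟩
  · have h := FeedbackControl.IsObstacleSolution.integral_le hKconvex (hlip t ht)
      (.of_forall (hu.mem t ht)) hsol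
    exact ⟨h, h.trans (neg_nonpos.2 (integral_nonneg fun x => sq_nonneg _))⟩
  · filter_upwards [FeedbackControl.IsOptimal.ae_gradI_nonneg hT hF hf hg hKcompact hKconvex hopt hp,
      ae_restrict_mem measurableSet_Icc] with t ht htm V
    exact FeedbackControl.isObstacleSolution_iff hN (hlip t htm) (.of_forall (hu.mem t htm)) ht
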